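/- Let $\beta\in(0,\pi)$, let $\mathcal S_\beta=\{\mathbf x\in\mathbb R^2:\ \pi-\beta<\vartheta(\mathbf x)<\pi\}$ be the infinite sector of opening angle $\beta$, where $\vartheta(\mathbf x)=\arg(x+\mathrm i y)\in[0,2\pi)$ for $\mathbf x=(x,y)\neq 0$, and let $\mathbf F(x,y)=\tfrac12(-y,x)$. Let $$W^{1,2}_{\mathbf F}(\mathcal S_\beta)=\{\psi\in L^2(\mathcal S_\beta;\mathbb C):\ (\nabla+\mathrm i\mathbf F)\psi\in L^2(\mathcal S_\beta;\mathbb C^2)\},$$ with $(\nabla+\mathrm i\mathbf F)\psi$ taken in the sense of distributions (no condition is imposed on $\partial\mathcal S_\beta$), and set $$\mu_\beta=\inf\Big\{\int_{\mathcal S_\beta}|(\nabla+\mathrm i\mathbf F)\psi|^2\,\mathrm d\mathbf x:\ \psi\in W^{1,2}_{\mathbf F}(\mathcal S_\beta),\ \|\psi\|_{L^2(\mathcal S_\beta)}=1\Big\},$$ $$\Theta_0=\inf_{\alpha\in\mathbb R}\ \inf_{f}\int_0^{+\infty}\big\{|f'(t)|^2+(t+\alpha)^2|f(t)|^2\big\}\,\mathrm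 d t,$$ where the inner infimum is over $f\in H^1(0,\infty)$ with $tf\in L^2(0,\infty)$ and $\|f\|_{L^2(0,\infty)}=1$. For $\mu\in\mathbb R$ let $$\mathcal E_\mu[\psi]=\int_{\mathcal S_\beta}\Big\{|(\nabla+\mathrm i\mathbf F)\psi|^2-\mu|\psi|^2+\tfrac12\mu|\psi|^4\Big\}\,\mathrm d\mathbf x,\qquad E_{\mathrm{sector}}(\mu)=\inf_{\psi\in W^{1,2}_{\mathbf F}(\mathcal S_\beta)}\mathcal E_\mu[\psi]\in[-\infty,0].$$ A minimizer at $\mu$ is a $\psi\in W^{1,2}_{\mathbf F}(\mathcal S_\beta)$ with $\mathcal E_\mu[\psi]=E_{\mathrm{sector}}(\mu)$; it is non-trivial if it is not almost everywhere zero. Assume that $\mu_\beta<\Theta_0$. Then: 1. The function $\mu\mapsto E_{\mathrm{sector}}(\mu)$ is finite, strictly decreasing and concave on the interval $(\mu_\beta,\Theta_0)$. 2. For every $\mu\in(\mu_\beta,\Theta_0]$ one has $E_{\mathrm{sector}}(\mu)<0$. Moreover, there is a constant $C$, independent of $\mu$, such that for every $\mu\in(\mu_\beta,\Theta_0)$ there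 exists a non-trivial minimizer at $\mu$, and every minimizer $\psi$ at $\mu$ satisfies $$\int_{\mathcal S_\beta}\Big\{|(\nabla+\mathrm i\mathbf F)\psi|^2+|\psi|^2+|\psi|^4\Big\}\,\mathrm d\mathbf x\le\frac{C}{\Theta_0-\mu}.$$ -/

import Mathlib

open scoped ContDiff

noncomputable section

namespace SectorGL

open MeasureTheory

/-- The infinite sector of opening angle `β`, `{π - β < ϑ < π}` in polar coordinates. For
`0 < β < π` all the angles involved lie in `(0, π)`, where the argument with values in `(-π, π]`
and the one with values in `[0, 2π)` agree (and the origin is excluded). -/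
def sector (β : ℝ) : Set (ℝ × ℝ) :=
  {p | Real.pi - β < Complex.arg ⟨p.1, p.2⟩ ∧ Complex.arg ⟨p.1, p.2⟩ < Real.pi}

/-- The first component of the magnetic potential `F (x, y) = (-y, x) / 2`. -/
def F₁ (p : ℝ × ℝ) : ℝ := -p.2 / 2

/-- The second component of the magnetic potential `F (x, y) = (-y, x) / 2`. -/
def F₂ (p : ℝ × ℝ) : ℝ := p.1 / 2

/-- Real-valued smooth test functions with compact support inside `U`. -/
structure IsTest {E : Type*} [NormedAddCommGroup E] [NormedSpace ℝ E] (U : Set E) (φ : E → ℝ) :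
    Prop where
  smooth : ContDiff ℝ ∞ φ
  compact : HasCompactSupport φ
  support : tsupport φ ⊆ U

/-- `g` is the distribution `∂_v ψ + i a ψ` on the open set `U`. -/
def IsWeakMagDeriv (U : Set (ℝ × ℝ)) (v : ℝ × ℝ) (a : ℝ × ℝ → ℝ) (ψ g : ℝ × ℝ → ℂ) : Prop :=
  ∀ φ : ℝ × ℝ → ℝ, IsTest U φ →
    ∫ p in U, (φ p : ℂ) * g p =
      ∫ p in U, (-((fderiv ℝ φ p v : ℝ) : ℂ) * ψ p + Complex.I * (a p : ℂ) * (φ p : ℂ) * ψ p)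

/-- The magnetic Sobolev space of the sector: functions `ψ ∈ L²` with `(∇ + i F) ψ ∈ L²`, the
magnetic gradient being taken in the sense of distributions. No condition is imposed on the
boundary. An element carries a representative `(grad₁, grad₂)` of its magnetic gradient, which is
determined by `ψ` up to null sets (see `W.grad_unique`). -/
structure W (β : ℝ) where
  /-- the function `ψ` -/
  toFun : ℝ × ℝ → ℂ
  /-- first component of `(∇ + i F) ψ` -/
  grad₁ : ℝ × ℝ → ℂ
  /-- second component of `(∇ + i F) ψ` -/
  grad₂ : ℝ × ℝ → ℂ
  memLp : MemLp toFun 2 (volume.restrict (sector β))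
  memLp₁ : MemLp grad₁ 2 (volume.restrict (sector β))
  memLp₂ : MemLp grad₂ 2 (volume.restrict (sector β))
  weak₁ : IsWeakMagDeriv (sector β) (1, 0) F₁ toFun grad₁
  weak₂ : IsWeakMagDeriv (sector β) (0, 1) F₂ toFun grad₂

lemma isOpen_sector {β : ℝ} (hβ : β < Real.pi) : IsOpen (sector β) := by
  rw [isOpen_iff_mem_nhds]
  intro p hp
  have hc : ContinuousAt (fun q : ℝ × ℝ => Complex.arg ⟨q.1, q.2⟩) p := by
    have h1 : ContinuousAt Complex.arg (⟨p.1, p.2⟩ : ℂ) := by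
      apply Complex.continuousAt_arg
      rw [Complex.mem_slitPlane_iff_arg]
      refine ⟨hp.2.ne, ?_⟩
      intro h0
      have h2 := hp.1
      rw [h0, Complex.arg_zero] at h2
      linarith
    have h3 : Continuous (fun q : ℝ × ℝ => (⟨q.1, q.2⟩ : ℂ)) :=
      Complex.equivRealProdCLM.symm.continuous
    exact ContinuousAt.comp (f := fun q : ℝ × ℝ => (⟨q.1, q.2⟩ : ℂ)) h1 h3.continuousAt
  exact hc.preimage_mem_nhds (isOpen_Ioo.mem_nhds hp)

lemma IsWeakMagDeriv.unique {U : Set (ℝ × ℝ)} (hU : IsOpen U) {v : ℝ × ℝ} {a : ℝ × ℝ → ℝ}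
    {ψ χ g h : ℝ × ℝ → ℂ} (hψ : IsWeakMagDeriv U v a ψ g) (hχ : IsWeakMagDeriv U v a χ h)
    (hψχ : ψ =ᵐ[volume.restrict U] χ) (hg : MemLp g 2 (volume.restrict U))
    (hh : MemLp h 2 (volume.restrict U)) : g =ᵐ[volume.restrict U] h := by
  have hgl : LocallyIntegrable g (volume.restrict U) := hg.locallyIntegrable (by norm_num)
  have hhl : LocallyIntegrable h (volume.restrict U) := hh.locallyIntegrable (by norm_num)
  have key : ∀ᵐ p ∂volume, p ∈ U → (g - h) p = 0 := by
    apply hU.ae_eq_zero_of_integral_contDiff_smul_eq_zero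
    · exact (locallyIntegrableOn_of_locallyIntegrable_restrict hgl).sub
        (locallyIntegrableOn_of_locallyIntegrable_restrict hhl)
    · intro φ h1 h2 h3
      have hφ : IsTest U φ := ⟨h1, h2, h3⟩
      have e : ∫ p in U, (φ p : ℂ) * g p = ∫ p in U, (φ p : ℂ) * h p := by
        rw [hψ φ hφ, hχ φ hφ]
        apply integral_congr_ae
        filter_upwards [hψχ] with p hp
        rw [hp]
      have i1 : Integrable (fun p => φ p • g p) (volume.restrict U) :=
        hgl.integrable_smul_left_of_hasCompactSupport h1.continuous h2
      have i2 : Integrable (fun p => φ p • h p) (volume.restrict U) :=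
        hhl.integrable_smul_left_of_hasCompactSupport h1.continuous h2
      have hz : ∀ p, p ∉ U → φ p • (g - h) p = 0 := by
        intro p hp
        rw [image_eq_zero_of_notMem_tsupport (fun hq => hp (h3 hq)), zero_smul]
      rw [← setIntegral_eq_integral_of_forall_compl_eq_zero hz]
      simp only [Pi.sub_apply, smul_sub]
      rw [integral_sub i1 i2]
      simpa [sub_eq_zero] using e
  rw [Filter.EventuallyEq, ae_restrict_iff' hU.measurableSet]
  filter_upwards [key] with p hp hpU
  exact sub_eq_zero.mp (hp hpU)

/-- The magnetic gradient carried by an element of `W β` is determined by the function. -/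
lemma W.grad_unique {β : ℝ} (hβ : β < Real.pi) (ψ χ : W β)
    (h : ψ.toFun =ᵐ[volume.restrict (sector β)] χ.toFun) :
    ψ.grad₁ =ᵐ[volume.restrict (sector β)] χ.grad₁ ∧
      ψ.grad₂ =ᵐ[volume.restrict (sector β)] χ.grad₂ :=
  ⟨ψ.weak₁.unique (isOpen_sector hβ) χ.weak₁ h ψ.memLp₁ χ.memLp₁,
    ψ.weak₂.unique (isOpen_sector hβ) χ.weak₂ h ψ.memLp₂ χ.memLp₂⟩

/-- `∫_{S_β} |(∇ + i F) ψ|²`. -/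
def W.kinetic {β : ℝ} (ψ : W β) : ℝ :=
  ∫ p in sector β, (‖ψ.grad₁ p‖ ^ 2 + ‖ψ.grad₂ p‖ ^ 2)

/-- `∫_{S_β} |ψ|²`. -/
def W.mass {β : ℝ} (ψ : W β) : ℝ := ∫ p in sector β, ‖ψ.toFun p‖ ^ 2

/-- The bottom `μ_β` of the spectrum of the magnetic Neumann Laplacian in the sector. -/
def muBeta (β : ℝ) : ℝ := sInf {q : ℝ | ∃ ψ : W β, ψ.mass = 1 ∧ q = ψ.kinetic}

/-- The energy `∫_{S_β} (|(∇ + i F) ψ|² - μ |ψ|² + (μ / 2) |ψ|⁴)`. The first two terms are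
finite on `W β`; the integral of `|ψ|⁴` is taken in `[0, ∞]`. -/
def W.energy {β : ℝ} (μ : ℝ) (ψ : W β) : EReal :=
  ((ψ.kinetic - μ * ψ.mass : ℝ) : EReal) +
    ((μ / 2 : ℝ) : EReal) * ((∫⁻ p in sector β, ‖ψ.toFun p‖ₑ ^ 4 : ENNReal) : EReal)

/-- The sector energy, the infimum in the extended reals of the energy over `W β`. -/
def eSector (β μ : ℝ) : EReal := ⨅ ψ : W β, ψ.energy μ

/-- `ψ` attains the sector energy. -/
def W.IsMinimizer {β : ℝ} (μ : ℝ) (ψ : W β) : Prop := ψ.energy μ = eSector β μ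

/-- `ψ` is not (almost everywhere) zero on the sector. -/
def W.Nontrivial {β : ℝ} (ψ : W β) : Prop := ¬ ψ.toFun =ᵐ[volume.restrict (sector β)] 0

/-- Functions on the half-line with `f, f', t f ∈ L²(0, ∞)`, the derivative `f'` being taken in the
sense of distributions on `(0, ∞)`. -/
structure HalfLine where
  /-- the function `f` -/
  toFun : ℝ → ℂ
  /-- the weak derivative of `f` -/
  der : ℝ → ℂ
  memLp : MemLp toFun 2 (volume.restrict (Set.Ioi 0))
  memLp_der : MemLp der 2 (volume.restrict (Set.Ioi 0))
  memLp_mul : MemLp (fun t : ℝ => (t : ℂ) * toFun t) 2 (volume.restrict (Set.Ioi 0))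
  weak : ∀ φ : ℝ → ℝ, IsTest (Set.Ioi 0) φ →
    ∫ t in Set.Ioi (0 : ℝ), (φ t : ℂ) * der t =
      -∫ t in Set.Ioi (0 : ℝ), ((deriv φ t : ℝ) : ℂ) * toFun t

/-- The universal constant `Θ₀`: the infimum of `∫₀^∞ (|f'|² + (t + α)² |f|²)` over all real `α`
and all `L²(0, ∞)`-normalized `f`. -/
def Theta0 : ℝ :=
  sInf {q : ℝ | ∃ (α : ℝ) (f : HalfLine), (∫ t in Set.Ioi (0 : ℝ), ‖f.toFun t‖ ^ 2) = 1 ∧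
    q = ∫ t in Set.Ioi (0 : ℝ), (‖f.der t‖ ^ 2 + (t + α) ^ 2 * ‖f.toFun t‖ ^ 2)}

end SectorGL

end

/-! A minimizing sequence can fail to be compact only by escaping to infinity, and there the problem
looks like the half-plane one, whose ground energy is Θ₀. This is made quantitative by
`exists_hardy`: Θ₀ times the mass is at most the kinetic energy plus C ∫ |ψ|²/(1+|x|²). The cutoffs
behind it have gradients of size O(1/|x|). A piece living near one edge extends by zero to a
half-plane, where `half_plane_bound` applies; that bound follows from a gauge change, a Fourier
series in the tangential variable, and the one-dimensional definition of Θ₀ applied to each mode.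

The weight 1/(1+|x|²) is square integrable in the plane, so Young's inequality absorbs the error
into the quartic term (`exists_coercive`). For 0 < μ ≤ Θ₀ this bounds the energy below, and for μ <
Θ₀ it bounds the mass by a multiple of 1/(Θ₀-μ). Applied to the remainder of a weakly convergent
minimizing sequence, the localized inequality shows that the remainder has asymptotically
non-negative quadratic energy, because its weighted mass tends to zero (`tendsto_wmass`). Weak lower
semicontinuity of the L⁴ norm then yields `exists_minimizer`.

Sobolev embedding and Rellich compactness are replaced by parallel transport, ψ ↦ exp(-i F(q)·x)
ψ(x+q) with q in the sector. The sector is a convex cone, so no extension across the boundary is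
needed, and `integral_tr_sub_le` bounds the displacement of ψ by |q| times the square root of the
kinetic energy. Averaging over small q gives bounded functions close to ψ in L²: this supplies L⁴
approximants (`exists_L4_approx`) and local compactness. Transports commute only up to a flux phase,
which forces μ_β > 0 (`exists_mass_le_kinetic`) and hence a positive quartic coefficient.

Negativity comes from a small multiple of an almost optimal function for μ_β. For fixed ψ the energy
is affine in μ, so concavity and strict decrease follow by using minimizers as trial functions. -/

noncomputable section

namespace SectorGL

open MeasureTheory ProbabilityTheory

/-! ### Calculus of distributional derivatives. -/

/-- Complex-valued smooth test functions with compact support inside `U`. -/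
structure CTest (U : Set (ℝ × ℝ)) (Φ : ℝ × ℝ → ℂ) : Prop where
  smooth : ContDiff ℝ ∞ Φ
  compact : HasCompactSupport Φ
  support : tsupport Φ ⊆ U

/-- `d` is the distributional derivative of `ψ` on `U` in the direction `v`. -/
def WD (U : Set (ℝ × ℝ)) (v : ℝ × ℝ) (ψ d : ℝ × ℝ → ℂ) : Prop :=
  ∀ Φ : ℝ × ℝ → ℂ, CTest U Φ → ∫ p, Φ p * d p = -∫ p, fderiv ℝ Φ p v * ψ p

lemma CTest.mono {U V : Set (ℝ × ℝ)} {Φ : ℝ × ℝ → ℂ} (h : CTest U Φ) (hUV : U ⊆ V) : CTest V Φ :=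
  ⟨h.smooth, h.compact, h.support.trans hUV⟩

/-- The condition on `tsupport χ` lets V be larger than U. This is the mechanism by which a function
on the sector, once cut off, extends by zero to a half-plane without losing its weak derivatives. -/
lemma CTest.mul_left {U V : Set (ℝ × ℝ)} {Φ χ : ℝ × ℝ → ℂ} (h : CTest V Φ) (hχ : ContDiff ℝ ∞ χ)
    (hs : tsupport χ ∩ V ⊆ U) : CTest U (fun p => χ p * Φ p) := by
  refine ⟨hχ.mul h.smooth, h.compact.mul_left, ?_⟩
  intro p hp
  exact hs ⟨closure_mono (Function.support_mul_subset_left χ Φ) hp,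
    h.support (closure_mono (Function.support_mul_subset_right χ Φ) hp)⟩

lemma CTest.fderiv_apply {U : Set (ℝ × ℝ)} {Φ : ℝ × ℝ → ℂ} (h : CTest U Φ) (v : ℝ × ℝ) :
    CTest U (fun p => fderiv ℝ Φ p v) := by
  refine ⟨?_, h.compact.fderiv_apply ℝ v, (tsupport_fderiv_apply_subset ℝ v).trans h.support⟩
  exact (h.smooth.fderiv_right (m := ∞) (by simp)).clm_apply contDiff_const

lemma CTest.integrable_mul {U : Set (ℝ × ℝ)} {Φ f : ℝ × ℝ → ℂ} (h : CTest U Φ)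
    (hf : LocallyIntegrableOn f U) : Integrable (fun p => Φ p * f p) := by
  have h1 : IntegrableOn f (tsupport Φ) := hf.integrableOn_compact_subset h.support h.compact
  have h2 : IntegrableOn (fun p => Φ p * f p) (tsupport Φ) :=
    h1.continuousOn_mul h.smooth.continuous.continuousOn h.compact
  rw [integrableOn_iff_integrable_of_support_subset] at h2
  · exact h2
  · exact (Function.support_mul_subset_left Φ f).trans (subset_tsupport _)

lemma CTest.setIntegral_mul {U : Set (ℝ × ℝ)} {Φ f : ℝ × ℝ → ℂ} (h : CTest U Φ) :
    ∫ p in U, Φ p * f p = ∫ p, Φ p * f p := by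
  apply setIntegral_eq_integral_of_forall_compl_eq_zero
  intro p hp
  rw [image_eq_zero_of_notMem_tsupport (fun hq => hp (h.support hq)), zero_mul]

lemma IsTest.ofReal {U : Set (ℝ × ℝ)} {φ : ℝ × ℝ → ℝ} (h : IsTest U φ) :
    CTest U (fun p => (φ p : ℂ)) := by
  refine ⟨Complex.ofRealCLM.contDiff.comp h.smooth, ?_, ?_⟩
  · exact h.compact.comp_left (g := fun x : ℝ => (x : ℂ)) (by simp)
  · exact (closure_mono (fun p hp => by
      simpa using hp)).trans h.support

lemma CTest.re {U : Set (ℝ × ℝ)} {Φ : ℝ × ℝ → ℂ} (h : CTest U Φ) :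
    IsTest U (fun p => (Φ p).re) := by
  refine ⟨Complex.reCLM.contDiff.comp h.smooth, ?_, ?_⟩
  · exact h.compact.comp_left (g := Complex.re) (by simp)
  · refine (closure_mono (fun p hp => ?_)).trans h.support
    intro h0; apply hp; simp [h0]

lemma CTest.im {U : Set (ℝ × ℝ)} {Φ : ℝ × ℝ → ℂ} (h : CTest U Φ) :
    IsTest U (fun p => (Φ p).im) := by
  refine ⟨Complex.imCLM.contDiff.comp h.smooth, ?_, ?_⟩
  · exact h.compact.comp_left (g := Complex.im) (by simp)
  · refine (closure_mono (fun p hp => ?_)).trans h.support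
    intro h0; apply hp; simp [h0]

lemma fderiv_ofReal_comp {φ : ℝ × ℝ → ℝ} (h : ContDiff ℝ ∞ φ) (p v : ℝ × ℝ) :
    fderiv ℝ (fun p => (φ p : ℂ)) p v = ((fderiv ℝ φ p v : ℝ) : ℂ) := by
  have h1 : HasFDerivAt (fun p => (φ p : ℂ)) (Complex.ofRealCLM.comp (fderiv ℝ φ p)) p :=
    Complex.ofRealCLM.hasFDerivAt.comp p (h.differentiable (by simp) p).hasFDerivAt
  rw [h1.fderiv]; rfl

/-- Testing with real functions is enough. -/
lemma WD.of_real {U : Set (ℝ × ℝ)} {v : ℝ × ℝ} {ψ d : ℝ × ℝ → ℂ}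
    (hψ : LocallyIntegrableOn ψ U) (hd : LocallyIntegrableOn d U)
    (h : ∀ φ, IsTest U φ → ∫ p, (φ p : ℂ) * d p = -∫ p, ((fderiv ℝ φ p v : ℝ) : ℂ) * ψ p) :
    WD U v ψ d := by
  intro Φ hΦ
  have hr := h _ hΦ.re
  have hi := h _ hΦ.im
  have hre := hΦ.re.ofReal
  have him := hΦ.im.ofReal
  have e1 : ∀ p, Φ p * d p = ((Φ p).re : ℂ) * d p + Complex.I * (((Φ p).im : ℂ) * d p) := by
    intro p
    conv_lhs => rw [← Complex.re_add_im (Φ p)]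
    ring
  have e2 : ∀ p, fderiv ℝ Φ p v * ψ p = ((fderiv ℝ (fun p => (Φ p).re) p v : ℝ) : ℂ) * ψ p
      + Complex.I * (((fderiv ℝ (fun p => (Φ p).im) p v : ℝ) : ℂ) * ψ p) := by
    intro p
    have hd := (hΦ.smooth.differentiable (by simp) p).hasFDerivAt
    have r1 : HasFDerivAt (fun p => (Φ p).re) (Complex.reCLM.comp (fderiv ℝ Φ p)) p :=
      Complex.reCLM.hasFDerivAt.comp p hd
    have r2 : HasFDerivAt (fun p => (Φ p).im) (Complex.imCLM.comp (fderiv ℝ Φ p)) p :=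
      Complex.imCLM.hasFDerivAt.comp p hd
    rw [r1.fderiv, r2.fderiv]
    conv_lhs => rw [← Complex.re_add_im (fderiv ℝ Φ p v)]
    simp only [ContinuousLinearMap.comp_apply, Complex.reCLM_apply, Complex.imCLM_apply]
    ring
  simp_rw [e1, e2]
  have i1 := hre.integrable_mul hd
  have i2 := him.integrable_mul hd
  have i3 := (hre.fderiv_apply v).integrable_mul hψ
  have i4 := (him.fderiv_apply v).integrable_mul hψ
  simp_rw [fderiv_ofReal_comp hΦ.re.smooth] at i3
  simp_rw [fderiv_ofReal_comp hΦ.im.smooth] at i4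
  rw [integral_add i1 (i2.const_mul _), integral_add i3 (i4.const_mul _), integral_const_mul,
    integral_const_mul, hr, hi]
  ring

lemma IsTest.integral_mag {U : Set (ℝ × ℝ)} {v : ℝ × ℝ} {a : ℝ × ℝ → ℝ} {φ : ℝ × ℝ → ℝ}
    {ψ : ℝ × ℝ → ℂ} (hφ : IsTest U φ) (hψ : LocallyIntegrableOn ψ U)
    (haψ : LocallyIntegrableOn (fun p => Complex.I * a p * ψ p) U) :
    ∫ p in U, (-((fderiv ℝ φ p v : ℝ) : ℂ) * ψ p + Complex.I * (a p : ℂ) * (φ p : ℂ) * ψ p)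
      = -(∫ p, ((fderiv ℝ φ p v : ℝ) : ℂ) * ψ p)
        + ∫ p, (φ p : ℂ) * (Complex.I * (a p : ℂ) * ψ p) := by
  have hC := hφ.ofReal
  have i2 := hC.integrable_mul haψ
  have i3 := (hC.fderiv_apply v).integrable_mul hψ
  simp only [fderiv_ofReal_comp hφ.smooth] at i3
  rw [← integral_neg, ← integral_add i3.fun_neg i2]
  symm
  rw [← setIntegral_eq_integral_of_forall_compl_eq_zero (s := U) (μ := volume)]
  · congr 1; ext p; ring
  · intro p hp
    have z1 := image_eq_zero_of_notMem_tsupport (fun hq => hp (hC.support hq))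
    have z2 := image_eq_zero_of_notMem_tsupport (fun hq => hp ((hC.fderiv_apply v).support hq))
    simp only [fderiv_ofReal_comp hφ.smooth] at z1 z2
    rw [z1, z2]; ring

/-- Removing the potential leaves an ordinary weak derivative, for which gauge factors, cutoffs and
changes of variables obey the usual rules. `WD.isWeakMagDeriv` puts the potential back. -/
lemma WD.of_isWeakMagDeriv {U : Set (ℝ × ℝ)} (hU : IsOpen U) {v : ℝ × ℝ} {a : ℝ × ℝ → ℝ}
    (ha : Continuous a)
    {ψ g : ℝ × ℝ → ℂ} (hψ : LocallyIntegrableOn ψ U) (hg : LocallyIntegrableOn g U)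
    (h : IsWeakMagDeriv U v a ψ g) : WD U v ψ (fun p => g p - Complex.I * a p * ψ p) := by
  have hc : Continuous (fun p => Complex.I * (a p : ℂ)) := by fun_prop
  have haψ : LocallyIntegrableOn (fun p => Complex.I * a p * ψ p) U :=
    hψ.continuousOn_mul hc.continuousOn hU.isLocallyClosed
  refine WD.of_real hψ (hg.sub haψ) ?_
  intro φ hφ
  have h1 := h φ hφ
  have hC := hφ.ofReal
  have i1 := hC.integrable_mul hg
  have i2 := hC.integrable_mul haψ
  rw [hC.setIntegral_mul, hφ.integral_mag hψ haψ] at h1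
  simp only [mul_sub]
  rw [integral_sub i1 i2, h1]; ring

lemma WD.isWeakMagDeriv {U : Set (ℝ × ℝ)} (hU : IsOpen U) {v : ℝ × ℝ} {a : ℝ × ℝ → ℝ}
    (ha : Continuous a)
    {ψ d : ℝ × ℝ → ℂ} (hψ : LocallyIntegrableOn ψ U) (hd : LocallyIntegrableOn d U)
    (h : WD U v ψ d) : IsWeakMagDeriv U v a ψ (fun p => d p + Complex.I * a p * ψ p) := by
  have hc : Continuous (fun p => Complex.I * (a p : ℂ)) := by fun_prop
  have haψ : LocallyIntegrableOn (fun p => Complex.I * a p * ψ p) U :=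
    hψ.continuousOn_mul hc.continuousOn hU.isLocallyClosed
  intro φ hφ
  have hC := hφ.ofReal
  have h1 := h _ hC
  have i1 := hC.integrable_mul hd
  have i2 := hC.integrable_mul haψ
  rw [hC.setIntegral_mul, hφ.integral_mag hψ haψ]
  simp only [fderiv_ofReal_comp hφ.smooth] at h1
  simp only [mul_add]
  rw [integral_add i1 i2, h1]

lemma WD.mono {U V : Set (ℝ × ℝ)} {v : ℝ × ℝ} {ψ d : ℝ × ℝ → ℂ} (h : WD U v ψ d) (hV : V ⊆ U) :
    WD V v ψ d := fun Φ hΦ => h Φ (hΦ.mono hV)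

lemma WD.congr_ae {U : Set (ℝ × ℝ)} {v : ℝ × ℝ} {ψ d ψ' d' : ℝ × ℝ → ℂ}
    (h : WD U v ψ d)
    (h1 : ψ =ᵐ[volume.restrict U] ψ') (h2 : d =ᵐ[volume.restrict U] d') : WD U v ψ' d' := by
  intro Φ hΦ
  have e := h Φ hΦ
  rw [← hΦ.setIntegral_mul, ← (hΦ.fderiv_apply v).setIntegral_mul] at e ⊢
  rw [integral_congr_ae (g := fun p => Φ p * d p), e, integral_congr_ae]
  · filter_upwards [h1] with p hp; rw [hp]
  · filter_upwards [h2] with p hp; rw [hp]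

lemma WD.comb {U : Set (ℝ × ℝ)} {v : ℝ × ℝ} {ψ d ψ' d' : ℝ × ℝ → ℂ} (h : WD U v ψ d)
    (h' : WD U v ψ' d') (a b : ℂ) (iψ : LocallyIntegrableOn ψ U) (id : LocallyIntegrableOn d U)
    (iψ' : LocallyIntegrableOn ψ' U) (id' : LocallyIntegrableOn d' U) :
    WD U v (fun p => a * ψ p + b * ψ' p) (fun p => a * d p + b * d' p) := by
  intro Φ hΦ
  have e1 : ∀ p, Φ p * (a * d p + b * d' p) = a * (Φ p * d p) + b * (Φ p * d' p) := by
    intro p; ring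
  have e2 : ∀ p, fderiv ℝ Φ p v * (a * ψ p + b * ψ' p) = a * (fderiv ℝ Φ p v * ψ p) +
    b * (fderiv ℝ Φ p v * ψ' p) := by intro p; ring
  simp_rw [e1, e2]
  rw [integral_add ((hΦ.integrable_mul id).const_mul a) ((hΦ.integrable_mul id').const_mul b),
    integral_add (((hΦ.fderiv_apply v).integrable_mul iψ).const_mul a)
     (((hΦ.fderiv_apply v).integrable_mul iψ').const_mul b)]
  simp_rw [integral_const_mul]
  rw [h Φ hΦ, h' Φ hΦ]; ring

/-- Needed twice: to differentiate along rotated axes, and along the displacement of a parallel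
transport. -/
lemma WD.comb_dir {U : Set (ℝ × ℝ)} {v w : ℝ × ℝ} {ψ d d' : ℝ × ℝ → ℂ} (h : WD U v ψ d)
    (h' : WD U w ψ d') (a b : ℝ) (iψ : LocallyIntegrableOn ψ U) (id : LocallyIntegrableOn d U)
    (id' : LocallyIntegrableOn d' U) :
    WD U (a • v + b • w) ψ (fun p => a * d p + b * d' p) := by
  intro Φ hΦ
  have e1 : ∀ p, Φ p * (a * d p + b * d' p) = a * (Φ p * d p) + b * (Φ p * d' p) := by
    intro p; ring
  have e2 : ∀ p, fderiv ℝ Φ p (a • v + b • w) * ψ p = a * (fderiv ℝ Φ p v * ψ p) +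
    b * (fderiv ℝ Φ p w * ψ p) := by
    intro p; simp only [map_add, map_smul, Complex.real_smul]; ring
  simp_rw [e1, e2]
  rw [integral_add ((hΦ.integrable_mul id).const_mul _) ((hΦ.integrable_mul id').const_mul _),
    integral_add (((hΦ.fderiv_apply v).integrable_mul iψ).const_mul _)
     (((hΦ.fderiv_apply w).integrable_mul iψ).const_mul _)]
  simp_rw [integral_const_mul]
  rw [h Φ hΦ, h' Φ hΦ]; ring

/-- Leibniz rule; the cutoff `χ` also extends the function from `U` to `V` by zero. -/
lemma WD.mul_smooth {U V : Set (ℝ × ℝ)} {v : ℝ × ℝ} {ψ d χ : ℝ × ℝ → ℂ} (h : WD U v ψ d)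
    (hχ : ContDiff ℝ ∞ χ) (hs : tsupport χ ∩ V ⊆ U) (iψ : LocallyIntegrableOn ψ U)
    (id : LocallyIntegrableOn d U) :
    WD V v (fun p => χ p * ψ p) (fun p => χ p * d p + fderiv ℝ χ p v * ψ p) := by
  intro Φ hΦ
  have hT := hΦ.mul_left hχ hs
  have hχ' : ContDiff ℝ ∞ (fun p => fderiv ℝ χ p v) :=
    (hχ.fderiv_right (m := ∞) (by simp)).clm_apply contDiff_const
  have hT' : CTest U (fun p => fderiv ℝ χ p v * Φ p) := by
    refine hΦ.mul_left hχ' ?_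
    exact (Set.inter_subset_inter_left _ (tsupport_fderiv_apply_subset ℝ v)).trans hs
  have hT'' : CTest U (fun p => χ p * fderiv ℝ Φ p v) := (hΦ.fderiv_apply v).mul_left hχ hs
  have e := h _ hT
  have e1 : ∀ p, fderiv ℝ (fun p => χ p * Φ p) p v
      = χ p * fderiv ℝ Φ p v + fderiv ℝ χ p v * Φ p := by
    intro p
    rw [fderiv_fun_mul (hχ.differentiable (by simp) p) (hΦ.smooth.differentiable (by simp) p)]
    simp [mul_comm]
  simp_rw [e1, add_mul] at e
  rw [integral_add (hT''.integrable_mul iψ) (hT'.integrable_mul iψ)] at e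
  have e2 : ∀ p, Φ p * (χ p * d p + fderiv ℝ χ p v * ψ p) =
    χ p * Φ p * d p + fderiv ℝ χ p v * Φ p * ψ p := by intro p; ring
  have e3 : ∀ p, fderiv ℝ Φ p v * (χ p * ψ p) = χ p * fderiv ℝ Φ p v * ψ p := by
    intro p; ring
  simp_rw [e2, e3]
  rw [integral_add (hT.integrable_mul id) (hT'.integrable_mul iψ), e]
  ring

/-- Affine volume-preserving change of variables. -/
lemma WD.comp_affine {U : Set (ℝ × ℝ)} {v : ℝ × ℝ} {ψ d : ℝ × ℝ → ℂ}
    (L : (ℝ × ℝ) ≃L[ℝ] (ℝ × ℝ)) (hL : MeasurePreserving L) (q : ℝ × ℝ) (h : WD U (L v) ψ d) :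
    WD ((fun p => L p + q) ⁻¹' U) v (fun p => ψ (L p + q)) (fun p => d (L p + q)) := by
  intro Φ hΦ
  let A : (ℝ × ℝ) ≃ₜ (ℝ × ℝ) := L.toHomeomorph.trans (Homeomorph.addRight q)
  have hA : MeasurePreserving A := (measurePreserving_add_right volume q).comp hL
  have hAa : ∀ p, A p = L p + q := fun p => rfl
  have hAs : ∀ p, A.symm p = L.symm (p - q) := by
    intro p; rw [A.symm_apply_eq]; simp [hAa]
  have hT : CTest U (fun p => Φ (A.symm p)) := by
    refine ⟨?_, ?_, ?_⟩
    · simp_rw [hAs]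
      exact hΦ.smooth.comp (L.symm.contDiff.comp (contDiff_id.sub contDiff_const))
    · exact hΦ.compact.comp_homeomorph A.symm
    · have := tsupport_comp_eq_preimage Φ A.symm
      change tsupport (Φ ∘ A.symm) ⊆ U
      rw [this]
      intro p hp
      have := hΦ.support hp
      simpa [← hAa] using this
  have e := h _ hT
  have e1 : ∀ p, fderiv ℝ (fun p => Φ (A.symm p)) p (L v) = fderiv ℝ Φ (A.symm p) v := by
    intro p
    have h1 : HasFDerivAt (fun p => A.symm p) (L.symm : (ℝ × ℝ) →L[ℝ] (ℝ × ℝ)) p := by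
      simp_rw [hAs]
      exact L.symm.hasFDerivAt.comp p ((hasFDerivAt_id p).sub_const q)
    have h2 := ((hΦ.smooth.differentiable (by simp) (A.symm p)).hasFDerivAt).comp p h1
    have h3 : fderiv ℝ (fun p => Φ (A.symm p)) p
      = (fderiv ℝ Φ (A.symm p)).comp (L.symm : (ℝ × ℝ) →L[ℝ] (ℝ × ℝ)) := h2.fderiv
    rw [h3]; simp
  simp_rw [e1] at e
  rw [← hA.integral_comp A.measurableEmbedding (fun p => Φ (A.symm p) * d p),
    ← hA.integral_comp A.measurableEmbedding (fun p => fderiv ℝ Φ (A.symm p) v * ψ p)] at e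
  simp only [A.symm_apply_apply] at e
  exact e

/-! ### Square integrals and the one-dimensional inequality defining Θ₀. -/

lemma integrable_norm_sq {α : Type*} [MeasurableSpace α] {μ : Measure α} {f : α → ℂ}
    (hf : MemLp f 2 μ) : Integrable (fun x => ‖f x‖ ^ 2) μ := by
  simpa using hf.integrable_norm_pow (p := 2) (by norm_num)

lemma lintegral_enorm_sq {α : Type*} [MeasurableSpace α] {μ : Measure α} {f : α → ℂ}
    (hf : MemLp f 2 μ) : ∫⁻ x, ‖f x‖ₑ ^ 2 ∂μ = ENNReal.ofReal (∫ x, ‖f x‖ ^ 2 ∂μ) := by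
  rw [ofReal_integral_eq_lintegral_ofReal (integrable_norm_sq hf)
    (Filter.Eventually.of_forall fun x => by positivity)]
  congr 1; ext x
  rw [ENNReal.ofReal_pow (norm_nonneg _), ofReal_norm]

lemma memLp_two_iff {α E : Type*} [MeasurableSpace α] [NormedAddCommGroup E] {μ : Measure α}
    {f : α → E}
    (hf : AEStronglyMeasurable f μ) : MemLp f 2 μ ↔ ∫⁻ x, ‖f x‖ₑ ^ 2 ∂μ < ⊤ := by
  have h := eLpNorm_lt_top_iff_lintegral_rpow_enorm_lt_top (f := f) (μ := μ) (p := 2)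
    (by norm_num) (by norm_num)
  simp only [ENNReal.toReal_ofNat, ENNReal.rpow_ofNat] at h
  rw [← h]
  exact ⟨fun h => h.2, fun h => ⟨hf, h⟩⟩

/-- Multiplication of a half-line function by a real constant. -/
def HalfLine.scale (c : ℝ) (f : HalfLine) : HalfLine where
  toFun t := c * f.toFun t
  der t := c * f.der t
  memLp := f.memLp.const_mul _
  memLp_der := f.memLp_der.const_mul _
  memLp_mul := by
    have := f.memLp_mul.const_mul (c : ℂ)
    refine this.congr_norm (this.1.congr (Filter.Eventually.of_forall fun t => by ring)) ?_
    exact Filter.Eventually.of_forall fun t => by simp only [norm_mul]; ring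
  weak φ hφ := by
    have := f.weak φ hφ
    have e1 : ∀ t, (φ t : ℂ) * (c * f.der t) = c * (φ t * f.der t) := fun t => by ring
    have e2 : ∀ t, ((deriv φ t : ℝ) : ℂ) * (c * f.toFun t) = c * ((deriv φ t : ℝ) * f.toFun t) :=
      fun t => by ring
    simp_rw [e1, e2, integral_const_mul, this]; ring

lemma HalfLine.memLp_shift (f : HalfLine) (α : ℝ) :
    MemLp (fun t : ℝ => ((t + α : ℝ) : ℂ) * f.toFun t) 2 (volume.restrict (Set.Ioi 0)) := by
  have := f.memLp_mul.add (f.memLp.const_mul (α : ℂ))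
  convert this using 2 with t
  simp; ring

lemma HalfLine.integral_eq (f : HalfLine) (α : ℝ) :
    ∫ t in Set.Ioi (0 : ℝ), (‖f.der t‖ ^ 2 + (t + α) ^ 2 * ‖f.toFun t‖ ^ 2)
    = (∫ t in Set.Ioi (0 : ℝ), ‖f.der t‖ ^ 2)
      + ∫ t in Set.Ioi (0 : ℝ), ‖((t + α : ℝ) : ℂ) * f.toFun t‖ ^ 2 := by
  rw [← integral_add (integrable_norm_sq f.memLp_der) (integrable_norm_sq (f.memLp_shift α))]
  congr 1; ext t
  rw [norm_mul, mul_pow, Complex.norm_real, Real.norm_eq_abs, sq_abs]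

lemma Theta0_mul_le (f : HalfLine) (α : ℝ) :
    Theta0 * ∫ t in Set.Ioi (0 : ℝ), ‖f.toFun t‖ ^ 2 ≤
      ∫ t in Set.Ioi (0 : ℝ), (‖f.der t‖ ^ 2 + (t + α) ^ 2 * ‖f.toFun t‖ ^ 2) := by
  set m := ∫ t in Set.Ioi (0 : ℝ), ‖f.toFun t‖ ^ 2 with hm
  have hm0 : 0 ≤ m := integral_nonneg fun t => by positivity
  rcases hm0.eq_or_lt with h0 | h0
  · rw [← h0, mul_zero]; exact integral_nonneg fun t => by positivity
  rw [← le_div_iff₀ h0]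
  apply csInf_le
  · refine ⟨0, ?_⟩
    rintro q ⟨α, f, -, rfl⟩
    exact integral_nonneg fun t => by positivity
  · refine ⟨α, f.scale (Real.sqrt m)⁻¹, ?_, ?_⟩
    · simp only [HalfLine.scale, norm_mul, mul_pow, integral_const_mul]
      rw [← hm, Complex.norm_real, Real.norm_eq_abs, sq_abs, inv_pow, Real.sq_sqrt hm0]
      field_simp
    · simp only [HalfLine.scale, norm_mul, mul_pow]
      rw [Complex.norm_real, Real.norm_eq_abs, sq_abs, inv_pow, Real.sq_sqrt hm0,
        div_eq_inv_mul, ← integral_const_mul]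
      congr 1; ext t; ring

lemma Theta0_nonneg : 0 ≤ Theta0 := by
  apply Real.sInf_nonneg
  rintro q ⟨α, f, -, rfl⟩
  exact integral_nonneg fun t => by positivity

/-- Integrals with values in [0, ∞] are used so that the inequality can be summed over all Fourier
modes with no summability condition. -/
lemma Theta0_lintegral_le (f : HalfLine) (α : ℝ) :
    ENNReal.ofReal Theta0 * ∫⁻ t in Set.Ioi (0 : ℝ), ‖f.toFun t‖ₑ ^ 2 ≤
      (∫⁻ t in Set.Ioi (0 : ℝ), ‖f.der t‖ₑ ^ 2)
        + ∫⁻ t in Set.Ioi (0 : ℝ), ‖((t + α : ℝ) : ℂ) * f.toFun t‖ₑ ^ 2 := by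
  rw [lintegral_enorm_sq f.memLp, lintegral_enorm_sq f.memLp_der,
    lintegral_enorm_sq (f.memLp_shift α), ← ENNReal.ofReal_mul Theta0_nonneg,
    ← ENNReal.ofReal_add (integral_nonneg fun t => by positivity)
      (integral_nonneg fun t => by positivity), ← f.integral_eq]
  exact ENNReal.ofReal_le_ofReal (Theta0_mul_le f α)

/-! ### Lower bound in the upper half-plane by Fourier series. -/

/-- The upper half-plane. -/
def upper : Set (ℝ × ℝ) := {p | 0 < p.2}

lemma isOpen_upper : IsOpen upper := isOpen_lt continuous_const continuous_snd

lemma restrict_upper : (volume : Measure (ℝ × ℝ)).restrict upper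
    = (volume : Measure ℝ).prod (volume.restrict (Set.Ioi (0 : ℝ))) := by
  have : upper = Set.univ ×ˢ Set.Ioi (0 : ℝ) := by ext p; simp [upper]
  rw [this, Measure.volume_eq_prod, ← Measure.prod_restrict, Measure.restrict_univ]

/-- The character `s ↦ exp (-i π n s / R)`. -/
def wave (R : ℝ) (n : ℤ) (s : ℝ) : ℂ := Complex.exp (-(Real.pi * n / R : ℝ) * s * Complex.I)

lemma contDiff_wave (R : ℝ) (n : ℤ) : ContDiff ℝ ∞ (wave R n) := by
  unfold wave
  exact ((contDiff_const.mul Complex.ofRealCLM.contDiff).mul contDiff_const).cexp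

lemma deriv_wave (R : ℝ) (n : ℤ) (s : ℝ) :
    deriv (wave R n) s = -(Complex.I * (Real.pi * n / R : ℝ)) * wave R n s := by
  have h : HasDerivAt (fun s : ℝ => -((Real.pi * n / R : ℝ) : ℂ) * s * Complex.I)
      (-((Real.pi * n / R : ℝ) : ℂ) * 1 * Complex.I) s :=
    ((Complex.ofRealCLM.hasDerivAt (x := s)).const_mul _).mul_const _
  have := h.cexp.deriv
  unfold wave
  rw [this]; ring

/-- The normalized Fourier mode in the first variable, of frequency `n` on `(-R, R]`. -/
def mode (R : ℝ) (n : ℤ) (f : ℝ × ℝ → ℂ) (t : ℝ) : ℂ :=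
  ((1 / (2 * R) : ℝ) : ℂ) * ∫ s : ℝ, wave R n s * f (s, t)

/-- The period is 2R. Since f vanishes off the strip, the integral over one period is an integral
over the whole line, which is the form that pairings with test functions produce. -/
lemma fourierCoeffOn_eq_mode {R : ℝ} (hR : -R < R) {f : ℝ × ℝ → ℂ}
    (hf : ∀ p : ℝ × ℝ, p.1 ∉ Set.Ioc (-R) R → f p = 0) (n : ℤ) (t : ℝ) :
    fourierCoeffOn hR (fun s => f (s, t)) n = mode R n f t := by
  have hR0 : R ≠ 0 := by intro h; simp [h] at hR
  rw [fourierCoeffOn_eq_integral, intervalIntegral.integral_of_le hR.le,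
    setIntegral_eq_integral_of_forall_compl_eq_zero
      (fun s hs => by rw [hf (s, t) hs, smul_zero]), mode, Complex.real_smul]
  have e : R - -R = 2 * R := by ring
  congr 1
  · rw [e]
  · refine integral_congr_ae (Filter.Eventually.of_forall fun s => ?_)
    beta_reduce
    rw [fourier_coe_apply, smul_eq_mul, wave]
    congr 2
    push_cast
    have : (R : ℂ) ≠ 0 := by exact_mod_cast hR0
    field_simp
    ring

lemma aestronglyMeasurable_mode {R : ℝ} {n : ℤ} {f : ℝ × ℝ → ℂ}
    (hf : AEStronglyMeasurable f (volume.restrict upper)) :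
    AEStronglyMeasurable (mode R n f) (volume.restrict (Set.Ioi 0)) := by
  unfold mode
  rw [restrict_upper] at hf
  apply AEStronglyMeasurable.const_mul
  have h1 : Continuous (fun p : ℝ × ℝ => wave R n p.1) :=
    (contDiff_wave R n).continuous.comp continuous_fst
  exact (h1.aestronglyMeasurable.mul hf).prod_swap.integral_prod_right'

/-- Parseval on almost every horizontal slice, followed by Tonelli in the transverse variable. -/
lemma lintegral_tsum_mode {R : ℝ} (hR : 0 < R) {f : ℝ × ℝ → ℂ}
    (hf : MemLp f 2 (volume.restrict upper))
    (h0 : ∀ p : ℝ × ℝ, p.1 ∉ Set.Ioc (-R) R → f p = 0) :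
    ∑' n : ℤ, ∫⁻ t in Set.Ioi (0 : ℝ), ‖mode R n f t‖ₑ ^ 2 =
      ENNReal.ofReal (1 / (2 * R)) * ∫⁻ p in upper, ‖f p‖ₑ ^ 2 := by
  have hlt := (memLp_two_iff hf.1).1 hf
  have hm : AEStronglyMeasurable f (volume.prod (volume.restrict (Set.Ioi (0 : ℝ)))) := by
    rw [← restrict_upper]; exact hf.1
  rw [← lintegral_tsum fun n => ((aestronglyMeasurable_mode hf.1).enorm.pow_const 2)]
  rw [restrict_upper, lintegral_prod_symm _ (hm.enorm.pow_const 2),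
    ← lintegral_const_mul' _ _ ENNReal.ofReal_ne_top]
  apply lintegral_congr_ae
  have hfin : ∀ᵐ t ∂(volume.restrict (Set.Ioi (0 : ℝ))), ∫⁻ s, ‖f (s, t)‖ₑ ^ 2 < ⊤ := by
    rw [restrict_upper, lintegral_prod_symm _ (hm.enorm.pow_const 2)] at hlt
    exact ae_lt_top' ((hm.enorm.pow_const 2).prod_swap.lintegral_prod_right') hlt.ne
  have hsl : ∀ᵐ t ∂(volume.restrict (Set.Ioi (0 : ℝ))),
      AEStronglyMeasurable (fun s => f (s, t)) volume := hm.prodMk_right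
  filter_upwards [hfin, hsl] with t ht hs
  have hL : MemLp (fun s => f (s, t)) 2 volume := (memLp_two_iff hs).2 ht
  have hRR : -R < R := by linarith
  have hP := hasSum_sq_fourierCoeffOn hRR (hL.restrict _)
  simp_rw [fourierCoeffOn_eq_mode hRR h0] at hP
  rw [intervalIntegral.integral_of_le hRR.le, setIntegral_eq_integral_of_forall_compl_eq_zero
      (fun s hs => by rw [h0 (s, t) hs]; simp)] at hP
  have h2 := ENNReal.ofReal_tsum_of_nonneg (fun n => sq_nonneg ‖mode R n f t‖) hP.summable
  rw [hP.tsum_eq] at h2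
  have h3 : ∀ n, ENNReal.ofReal (‖mode R n f t‖ ^ 2) = ‖mode R n f t‖ₑ ^ 2 := fun n => by
    rw [ENNReal.ofReal_pow (norm_nonneg _), ofReal_norm]
  simp_rw [h3] at h2
  rw [← h2, smul_eq_mul, ENNReal.ofReal_mul (by rw [inv_nonneg]; linarith), lintegral_enorm_sq hL]
  congr 2
  rw [one_div]; congr 1; ring

lemma memLp_mode {R : ℝ} (hR : 0 < R) {f : ℝ × ℝ → ℂ}
    (hf : MemLp f 2 (volume.restrict upper))
    (h0 : ∀ p : ℝ × ℝ, p.1 ∉ Set.Ioc (-R) R → f p = 0) (n : ℤ) :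
    MemLp (mode R n f) 2 (volume.restrict (Set.Ioi 0)) := by
  rw [memLp_two_iff (aestronglyMeasurable_mode hf.1)]
  refine lt_of_le_of_lt (ENNReal.le_tsum (f := fun n => ∫⁻ t in Set.Ioi (0 : ℝ), ‖mode R n f t‖ₑ ^ 2) n) ?_
  rw [lintegral_tsum_mode hR hf h0]
  exact ENNReal.mul_lt_top ENNReal.ofReal_lt_top ((memLp_two_iff hf.1).1 hf)

lemma CTest.of_prod {E : ℝ → ℂ} {φ : ℝ → ℝ} (hE : ContDiff ℝ ∞ E) (hEc : HasCompactSupport E)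
    (hφ : IsTest (Set.Ioi 0) φ) : CTest upper (fun p => E p.1 * (φ p.2 : ℂ)) := by
  have hsub : tsupport (fun p : ℝ × ℝ => E p.1 * (φ p.2 : ℂ)) ⊆ tsupport E ×ˢ tsupport φ := by
    apply closure_minimal
    · intro p hp
      have h1 := left_ne_zero_of_mul hp
      have h2 := right_ne_zero_of_mul hp
      exact ⟨subset_tsupport _ h1, subset_tsupport _ (by simpa using h2)⟩
    · exact (isClosed_tsupport _).prod (isClosed_tsupport _)
  refine ⟨?_, ?_, ?_⟩
  · exact (hE.comp contDiff_fst).mul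
      (Complex.ofRealCLM.contDiff.comp (hφ.smooth.comp contDiff_snd))
  · exact (hEc.isCompact.prod hφ.compact.isCompact).of_isClosed_subset (isClosed_tsupport _) hsub
  · exact fun p hp => hφ.support (hsub hp).2

lemma fderiv_prod_mul {E : ℝ → ℂ} {φ : ℝ → ℝ} (hE : ContDiff ℝ ∞ E) (hφ : ContDiff ℝ ∞ φ)
    (p v : ℝ × ℝ) : fderiv ℝ (fun p : ℝ × ℝ => E p.1 * (φ p.2 : ℂ)) p v =
      v.1 * deriv E p.1 * φ p.2 + v.2 * E p.1 * (deriv φ p.2 : ℝ) := by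
  have h1 : HasFDerivAt (fun p : ℝ × ℝ => E p.1)
      ((fderiv ℝ E p.1).comp (ContinuousLinearMap.fst ℝ ℝ ℝ)) p :=
    ((hE.differentiable (by simp) p.1).hasFDerivAt).comp p hasFDerivAt_fst
  have h2 : HasFDerivAt (fun p : ℝ × ℝ => (φ p.2 : ℂ))
      (Complex.ofRealCLM.comp ((fderiv ℝ φ p.2).comp (ContinuousLinearMap.snd ℝ ℝ ℝ))) p :=
    Complex.ofRealCLM.hasFDerivAt.comp p
      (((hφ.differentiable (by simp) p.2).hasFDerivAt).comp p hasFDerivAt_snd)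
  rw [HasFDerivAt.fderiv (h1.fun_mul h2)]
  have e1 : fderiv ℝ E p.1 v.1 = v.1 * deriv E p.1 := by
    rw [← mul_one v.1, ← smul_eq_mul, map_smul, fderiv_apply_one_eq_deriv]; simp
  have e2 : fderiv ℝ φ p.2 v.2 = v.2 * deriv φ p.2 := by
    rw [← mul_one v.2, ← smul_eq_mul, map_smul, fderiv_apply_one_eq_deriv]; simp
  simp [e1, e2]
  ring

/-- A character has no compact support, so it is multiplied by a bump equal to one near the strip.
Everything tested against it vanishes outside the strip, where alone the bump would be visible. -/
lemma exists_cutoff_wave {R : ℝ} (hR : 0 < R) (n : ℤ) : ∃ E : ℝ → ℂ, ContDiff ℝ ∞ E ∧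
    HasCompactSupport E ∧ (∀ s ∈ Set.Ioc (-R) R, E s = wave R n s) ∧
    ∀ s ∈ Set.Ioc (-R) R, deriv E s = -(Complex.I * (Real.pi * n / R : ℝ)) * wave R n s := by
  let η : ContDiffBump (0 : ℝ) := ⟨R + 1, R + 2, by linarith, by linarith⟩
  have hs : ∀ s ∈ Set.Ioc (-R) R, s ∈ Metric.ball (0 : ℝ) (R + 1) := by
    intro s hs
    rw [Metric.mem_ball, dist_zero_right, Real.norm_eq_abs, abs_lt]
    constructor <;> linarith [hs.1, hs.2]
  have he : ∀ s ∈ Set.Ioc (-R) R,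
      (fun s => (η s : ℂ) * wave R n s) =ᶠ[nhds s] wave R n := by
    intro s h
    filter_upwards [η.eventuallyEq_one_of_mem_ball (hs s h)] with x hx
    simp [hx]
  refine ⟨fun s => (η s : ℂ) * wave R n s, ?_, ?_, ?_, ?_⟩
  · exact (Complex.ofRealCLM.contDiff.comp η.contDiff).mul (contDiff_wave R n)
  · exact HasCompactSupport.mul_right
      (η.hasCompactSupport.comp_left (g := fun x : ℝ => (x : ℂ)) (by simp))
  · exact fun s h => (he s h).eq_of_nhds
  · intro s h
    rw [(he s h).deriv_eq, deriv_wave]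

lemma integral_mode {R : ℝ} (hR : 0 < R) {n : ℤ} {E : ℝ → ℂ} (hE : ContDiff ℝ ∞ E)
    (hEc : HasCompactSupport E) (hw : ∀ s ∈ Set.Ioc (-R) R, E s = wave R n s)
    {φ : ℝ → ℝ} (hφ : IsTest (Set.Ioi 0) φ) {f : ℝ × ℝ → ℂ}
    (hf : LocallyIntegrableOn f upper) (h0 : ∀ p : ℝ × ℝ, p.1 ∉ Set.Ioc (-R) R → f p = 0) :
    ∫ p : ℝ × ℝ, E p.1 * (φ p.2 : ℂ) * f p
      = (2 * R : ℝ) * ∫ t in Set.Ioi (0 : ℝ), (φ t : ℂ) * mode R n f t := by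
  have hi := (CTest.of_prod hE hEc hφ).integrable_mul hf
  rw [Measure.volume_eq_prod] at hi ⊢
  rw [integral_prod_symm _ hi, setIntegral_eq_integral_of_forall_compl_eq_zero,
    ← integral_const_mul]
  · congr 1; ext t
    rw [mode]
    have e : ∀ s : ℝ, E s * (φ t : ℂ) * f (s, t) = (φ t : ℂ) * (wave R n s * f (s, t)) := by
      intro s
      by_cases hs : s ∈ Set.Ioc (-R) R
      · rw [hw s hs]; ring
      · rw [h0 (s, t) hs]; simp
    simp_rw [e, integral_const_mul]
    have hR' : ((R : ℝ) : ℂ) ≠ 0 := by exact_mod_cast hR.ne'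
    push_cast
    field_simp
  · intro t ht
    rw [image_eq_zero_of_notMem_tsupport (fun h => ht (hφ.support h))]; simp

lemma IsTest.deriv {U : Set ℝ} {φ : ℝ → ℝ} (h : IsTest U φ) : IsTest U (deriv φ) := by
  refine ⟨?_, h.compact.deriv, ?_⟩
  · exact ((contDiff_infty_iff_deriv).1 h.smooth).2
  · exact (closure_minimal support_deriv_subset (isClosed_tsupport _)).trans h.support

/-- The lower bound in the Landau gauge, for functions that vanish outside a vertical strip. -/
lemma landau_bound_of_strip {R : ℝ} (hR : 0 < R) {v G D : ℝ × ℝ → ℂ}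
    (hv : MemLp v 2 (volume.restrict upper)) (hG : MemLp G 2 (volume.restrict upper))
    (hD : MemLp D 2 (volume.restrict upper))
    (v0 : ∀ p : ℝ × ℝ, p.1 ∉ Set.Ioc (-R) R → v p = 0)
    (G0 : ∀ p : ℝ × ℝ, p.1 ∉ Set.Ioc (-R) R → G p = 0)
    (D0 : ∀ p : ℝ × ℝ, p.1 ∉ Set.Ioc (-R) R → D p = 0)
    (h1 : WD upper (1, 0) v (fun p => G p + Complex.I * p.2 * v p))
    (h2 : WD upper (0, 1) v D) :
    ENNReal.ofReal Theta0 * ∫⁻ p in upper, ‖v p‖ₑ ^ 2 ≤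
      (∫⁻ p in upper, ‖D p‖ₑ ^ 2) + ∫⁻ p in upper, ‖G p‖ₑ ^ 2 := by
  have lv : LocallyIntegrableOn v upper :=
    locallyIntegrableOn_of_locallyIntegrable_restrict (hv.locallyIntegrable (by norm_num))
  have lG : LocallyIntegrableOn G upper :=
    locallyIntegrableOn_of_locallyIntegrable_restrict (hG.locallyIntegrable (by norm_num))
  have lD : LocallyIntegrableOn D upper :=
    locallyIntegrableOn_of_locallyIntegrable_restrict (hD.locallyIntegrable (by norm_num))
  have ltv : LocallyIntegrableOn (fun p : ℝ × ℝ => Complex.I * p.2 * v p) upper :=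
    lv.continuousOn_mul (by fun_prop) isOpen_upper.isLocallyClosed
  -- In the Landau gauge G = (∂₁ - i t) v, and on the n-th mode ∂₁ acts as multiplication by iπn/R.
  -- The identity is obtained by testing with E(s) φ(t).
  have key : ∀ n, ∀ᵐ t ∂(volume.restrict (Set.Ioi (0 : ℝ))),
      mode R n G t = Complex.I * ((Real.pi * n / R - t : ℝ) : ℂ) * mode R n v t := by
    intro n
    obtain ⟨E, hE, hEc, hw, hdw⟩ := exists_cutoff_wave hR n
    have mG : LocallyIntegrableOn (mode R n G) (Set.Ioi 0) :=
      locallyIntegrableOn_of_locallyIntegrable_restrict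
        ((memLp_mode hR hG G0 n).locallyIntegrable (by norm_num))
    have mv : LocallyIntegrableOn (mode R n v) (Set.Ioi 0) :=
      locallyIntegrableOn_of_locallyIntegrable_restrict
        ((memLp_mode hR hv v0 n).locallyIntegrable (by norm_num))
    have mtv : LocallyIntegrableOn (fun t : ℝ =>
        Complex.I * ((Real.pi * n / R - t : ℝ) : ℂ) * mode R n v t) (Set.Ioi 0) :=
      mv.continuousOn_mul (by fun_prop) isOpen_Ioi.isLocallyClosed
    have hz := isOpen_Ioi.ae_eq_zero_of_integral_contDiff_smul_eq_zero (mG.sub mtv) (by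
      intro φ hφ1 hφ2 hφ3
      have hφ : IsTest (Set.Ioi 0) φ := ⟨hφ1, hφ2, hφ3⟩
      have hT := CTest.of_prod hE hEc hφ
      have e := h1 _ hT
      have e1 : ∀ p : ℝ × ℝ, fderiv ℝ (fun p : ℝ × ℝ => E p.1 * (φ p.2 : ℂ)) p (1, 0) * v p
          = -(Complex.I * (Real.pi * n / R : ℝ)) * (E p.1 * (φ p.2 : ℂ) * v p) := by
        intro p
        rw [fderiv_prod_mul hE hφ1]
        by_cases hs : p.1 ∈ Set.Ioc (-R) R
        · rw [hdw _ hs, hw _ hs]; simp; ring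
        · rw [v0 p hs]; simp
      simp_rw [e1, mul_add] at e
      rw [integral_add (hT.integrable_mul lG) (hT.integrable_mul ltv), integral_const_mul,
        integral_mode hR hE hEc hw hφ lG G0, integral_mode hR hE hEc hw hφ lv v0,
        integral_mode hR hE hEc hw hφ ltv (fun p hp => by rw [v0 p hp, mul_zero])] at e
      have e2 : ∀ t, mode R n (fun p : ℝ × ℝ => Complex.I * p.2 * v p) t
          = Complex.I * t * mode R n v t := by
        intro t
        simp only [mode]
        have : ∀ s : ℝ, wave R n s * (Complex.I * t * v (s, t))
          = Complex.I * t * (wave R n s * v (s, t)) := fun s => by ring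
        simp_rw [this, integral_const_mul]; ring
      simp_rw [e2] at e
      have hR' : ((2 * R : ℝ) : ℂ) ≠ 0 := by
        rw [Complex.ofReal_ne_zero]; positivity
      have hz0 : ∀ t ∉ Set.Ioi (0 : ℝ), φ t = 0 := fun t ht =>
        image_eq_zero_of_notMem_tsupport (fun h => ht (hφ3 h))
      rw [← setIntegral_eq_integral_of_forall_compl_eq_zero (s := Set.Ioi (0 : ℝ))
        (fun t ht => by rw [hz0 t ht, zero_smul])]
      have il : ∀ {f : ℝ → ℂ}, LocallyIntegrableOn f (Set.Ioi 0) →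
          Integrable (fun t => (φ t : ℂ) * f t) (volume.restrict (Set.Ioi 0)) := by
        intro f hf
        have k1 : IntegrableOn f (tsupport φ) := hf.integrableOn_compact_subset hφ3 hφ2
        have k2 : IntegrableOn (fun t => (φ t : ℂ) * f t) (tsupport φ) :=
          k1.continuousOn_mul (Complex.continuous_ofReal.comp hφ1.continuous).continuousOn hφ2
        rw [integrableOn_iff_integrable_of_support_subset] at k2
        · exact k2.restrict
        · intro t ht
          have := left_ne_zero_of_mul ht
          exact subset_tsupport _ (by simpa using this)
      have tv : LocallyIntegrableOn (fun t : ℝ => Complex.I * t * mode R n v t) (Set.Ioi 0) :=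
        mv.continuousOn_mul (by fun_prop) isOpen_Ioi.isLocallyClosed
      have e3 : ∀ t : ℝ, φ t • (mode R n G - fun t : ℝ =>
          Complex.I * ((Real.pi * n / R - t : ℝ) : ℂ) * mode R n v t) t
          = ((φ t : ℂ) * mode R n G t + (φ t : ℂ) * (Complex.I * t * mode R n v t))
            + (-(Complex.I * (Real.pi * n / R : ℝ))) * ((φ t : ℂ) * mode R n v t) := by
        intro t
        simp only [Pi.sub_apply, Complex.real_smul, Complex.ofReal_sub]; ring
      simp_rw [e3]
      rw [integral_add ((il mG).fun_add (il tv)) ((il mv).const_mul _), integral_add (il mG) (il tv),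
        integral_const_mul]
      apply mul_left_cancel₀ hR'
      rw [mul_zero, mul_add, mul_add, e]; ring)
    rw [ae_restrict_iff' measurableSet_Ioi]
    filter_upwards [hz] with t ht hti
    exact sub_eq_zero.1 (ht hti)
  have hn : ∀ n : ℤ, ENNReal.ofReal Theta0 * ∫⁻ t in Set.Ioi (0 : ℝ), ‖mode R n v t‖ₑ ^ 2 ≤
      (∫⁻ t in Set.Ioi (0 : ℝ), ‖mode R n D t‖ₑ ^ 2)
        + ∫⁻ t in Set.Ioi (0 : ℝ), ‖mode R n G t‖ₑ ^ 2 := by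
    intro n
    obtain ⟨E, hE, hEc, hw, hdw⟩ := exists_cutoff_wave hR n
    let f : HalfLine :=
      { toFun := mode R n v
        der := mode R n D
        memLp := memLp_mode hR hv v0 n
        memLp_der := memLp_mode hR hD D0 n
        -- No decay of v in t is assumed: by `key`, t times the mode of v equals (πn/R) times that
        -- mode plus i times the mode of G, and both are square integrable.
        memLp_mul := by
          have h := ((memLp_mode hR hv v0 n).const_mul ((Real.pi * n / R : ℝ) : ℂ)).add
            ((memLp_mode hR hG G0 n).const_mul Complex.I)
          refine (memLp_congr_ae ?_).1 h
          filter_upwards [key n] with t ht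
          simp only [Pi.add_apply]
          rw [ht]
          push_cast
          linear_combination (Real.pi * n / R - t : ℂ) * mode R n v t * Complex.I_mul_I
        weak := by
          intro φ hφ
          have hT := CTest.of_prod hE hEc hφ
          have e := h2 _ hT
          have e1 : ∀ p : ℝ × ℝ, fderiv ℝ (fun p : ℝ × ℝ => E p.1 * (φ p.2 : ℂ)) p (0, 1) * v p
              = E p.1 * ((deriv φ p.2 : ℝ) : ℂ) * v p := by
            intro p
            rw [fderiv_prod_mul hE hφ.smooth]; simp
          simp_rw [e1] at e
          rw [integral_mode hR hE hEc hw hφ lD D0, integral_mode hR hE hEc hw hφ.deriv lv v0] at e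
          have hR' : ((2 * R : ℝ) : ℂ) ≠ 0 := by
            rw [Complex.ofReal_ne_zero]; positivity
          apply mul_left_cancel₀ hR'
          rw [e]; ring }
    -- The frequency plays the role of the parameter α in Θ₀, with α = -πn/R.
    have h := Theta0_lintegral_le f (-(Real.pi * n / R))
    refine h.trans_eq ?_
    congr 1
    apply lintegral_congr_ae
    filter_upwards [key n] with t ht
    rw [ht]
    simp only [enorm_mul, f]
    congr 2
    rw [← enorm_neg, ← one_mul ‖-_‖ₑ]
    congr 1
    · simp [← ofReal_norm]
    · congr 1; push_cast; ring
  have hs := ENNReal.tsum_le_tsum hn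
  rw [ENNReal.tsum_mul_left, ENNReal.tsum_add, lintegral_tsum_mode hR hv v0,
    lintegral_tsum_mode hR hD D0, lintegral_tsum_mode hR hG G0, ← mul_add, mul_left_comm] at hs
  have c0 : ENNReal.ofReal (1 / (2 * R)) ≠ 0 := by
    rw [ne_eq, ENNReal.ofReal_eq_zero, not_le]; positivity
  exact (ENNReal.mul_le_mul_iff_right c0 ENNReal.ofReal_ne_top).1 hs

lemma locallyIntegrableOn_of_memLp {U : Set (ℝ × ℝ)} {f : ℝ × ℝ → ℂ}
    (hf : MemLp f 2 (volume.restrict U)) : LocallyIntegrableOn f U :=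
  locallyIntegrableOn_of_locallyIntegrable_restrict (hf.locallyIntegrable (by norm_num))

lemma continuous_F₁ : Continuous F₁ := by unfold F₁; fun_prop
lemma continuous_F₂ : Continuous F₂ := by unfold F₂; fun_prop

lemma locallyIntegrableOn_sub {U : Set (ℝ × ℝ)} (hU : IsOpen U) {a : ℝ × ℝ → ℝ}
    (ha : Continuous a) {ψ g : ℝ × ℝ → ℂ}
    (hψ : LocallyIntegrableOn ψ U) (hg : LocallyIntegrableOn g U) :
    LocallyIntegrableOn (fun p => g p - Complex.I * a p * ψ p) U := by
  have hc : Continuous (fun p => Complex.I * (a p : ℂ)) := by fun_prop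
  exact hg.sub (hψ.continuousOn_mul hc.continuousOn hU.isLocallyClosed)

lemma WD.congr {U : Set (ℝ × ℝ)} {v : ℝ × ℝ} {ψ d d' : ℝ × ℝ → ℂ} (h : WD U v ψ d)
    (hd : ∀ p, d p = d' p) : WD U v ψ d' := by
  rwa [← funext hd]

/-- The gauge factor exp(i x y / 2) turns the symmetric potential (-y, x)/2 into (-y, 0) and leaves
all moduli unchanged. -/
lemma upper_bound_of_strip {R : ℝ} (hR : 0 < R) {u g h : ℝ × ℝ → ℂ}
    (hu : MemLp u 2 (volume.restrict upper)) (hg : MemLp g 2 (volume.restrict upper))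
    (hh : MemLp h 2 (volume.restrict upper))
    (u0 : ∀ p : ℝ × ℝ, p.1 ∉ Set.Ioc (-R) R → u p = 0)
    (g0 : ∀ p : ℝ × ℝ, p.1 ∉ Set.Ioc (-R) R → g p = 0)
    (h0 : ∀ p : ℝ × ℝ, p.1 ∉ Set.Ioc (-R) R → h p = 0)
    (h1 : WD upper (1, 0) u (fun p => g p - Complex.I * F₁ p * u p))
    (h2 : WD upper (0, 1) u (fun p => h p - Complex.I * F₂ p * u p)) :
    ENNReal.ofReal Theta0 * ∫⁻ p in upper, ‖u p‖ₑ ^ 2 ≤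
      (∫⁻ p in upper, ‖h p‖ₑ ^ 2) + ∫⁻ p in upper, ‖g p‖ₑ ^ 2 := by
  let χ : ℝ × ℝ → ℂ := fun p => Complex.exp (Complex.I * ((p.1 * p.2 / 2 : ℝ) : ℂ))
  have cp : ContDiff ℝ ∞ (fun p : ℝ × ℝ => p.1 * p.2 / 2) :=
    (contDiff_fst.mul contDiff_snd).div_const 2
  have hχ : ContDiff ℝ ∞ χ := (contDiff_const.mul (Complex.ofRealCLM.contDiff.comp cp)).cexp
  have hdχ : ∀ p w : ℝ × ℝ, fderiv ℝ χ p w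
      = Complex.I * ((w.1 * p.2 + p.1 * w.2 : ℝ) : ℂ) / 2 * χ p := by
    intro p w
    have k0 : HasFDerivAt (fun p : ℝ × ℝ => p.1 * p.2 / 2) ((2 : ℝ)⁻¹ •
        (p.1 • ContinuousLinearMap.snd ℝ ℝ ℝ + p.2 • ContinuousLinearMap.fst ℝ ℝ ℝ)) p := by
      have := (hasFDerivAt_fst (𝕜 := ℝ) (p := p)).fun_mul (hasFDerivAt_snd (𝕜 := ℝ) (p := p))
      simpa only [div_eq_inv_mul] using this.const_mul (2 : ℝ)⁻¹
    have k1 := ((Complex.ofRealCLM.hasFDerivAt.comp p k0).const_mul Complex.I).cexp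
    have k2 : fderiv ℝ χ p = _ := k1.fderiv
    rw [k2]
    simp [χ]
    ring
  have nχ : ∀ p, ‖χ p‖ₑ = 1 := by
    intro p
    rw [← ofReal_norm]
    simp only [χ]
    rw [mul_comm Complex.I, Complex.norm_exp_ofReal_mul_I]; simp
  have mχ : ∀ {f : ℝ × ℝ → ℂ}, MemLp f 2 (volume.restrict upper) →
      MemLp (fun p => χ p * f p) 2 (volume.restrict upper) := by
    intro f hf
    refine hf.congr_norm (hχ.continuous.aestronglyMeasurable.mul hf.1) ?_
    refine Filter.Eventually.of_forall fun p => ?_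
    have := nχ p
    rw [← ofReal_norm, ENNReal.ofReal_eq_one] at this
    rw [norm_mul, this, one_mul]
  have lu := locallyIntegrableOn_of_memLp hu
  have w1 := h1.mul_smooth hχ (V := upper) Set.inter_subset_right lu
    (locallyIntegrableOn_sub isOpen_upper continuous_F₁ lu (locallyIntegrableOn_of_memLp hg))
  have w2 := h2.mul_smooth hχ (V := upper) Set.inter_subset_right lu
    (locallyIntegrableOn_sub isOpen_upper continuous_F₂ lu (locallyIntegrableOn_of_memLp hh))
  have := landau_bound_of_strip hR (mχ hu) (mχ hg) (mχ hh) (fun p hp => by rw [u0 p hp, mul_zero])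
    (fun p hp => by rw [g0 p hp, mul_zero]) (fun p hp => by rw [h0 p hp, mul_zero])
    (by convert w1 using 1; funext p
        rw [hdχ]; simp only [F₁]; push_cast; ring)
    (by convert w2 using 1; funext p
        rw [hdχ]; simp only [F₂]; push_cast; ring)
  simpa only [enorm_mul, nχ, one_mul] using this

lemma tendsto_enorm_sq {ι : Type*} {l : Filter ι} {f : ι → ℂ} {a : ℂ}
    (h : Filter.Tendsto f l (nhds a)) :
    Filter.Tendsto (fun i => ‖f i‖ₑ ^ 2) l (nhds (‖a‖ₑ ^ 2)) :=
  ENNReal.Tendsto.pow (continuous_enorm.continuousAt.tendsto.comp h)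

/-- The strip assumption is removed by cutoffs b(x/κ) in the tangential variable only. They leave
the boundary and the second component of the gradient alone, and their derivative is O(1/κ), so all
integrals pass to the limit by dominated convergence. -/
lemma upper_bound {u g h : ℝ × ℝ → ℂ}
    (hu : MemLp u 2 (volume.restrict upper)) (hg : MemLp g 2 (volume.restrict upper))
    (hh : MemLp h 2 (volume.restrict upper))
    (h1 : WD upper (1, 0) u (fun p => g p - Complex.I * F₁ p * u p))
    (h2 : WD upper (0, 1) u (fun p => h p - Complex.I * F₂ p * u p)) :
    ENNReal.ofReal Theta0 * ∫⁻ p in upper, ‖u p‖ₑ ^ 2 ≤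
      (∫⁻ p in upper, ‖h p‖ₑ ^ 2) + ∫⁻ p in upper, ‖g p‖ₑ ^ 2 := by
  let b : ContDiffBump (0 : ℝ) := ⟨1, 2, by norm_num, by norm_num⟩
  have hb : ContDiff ℝ ∞ b := b.contDiff
  have hb' : Continuous (deriv b) := ((contDiff_infty_iff_deriv).1 hb).2.continuous
  obtain ⟨B, hB⟩ := b.hasCompactSupport.deriv.exists_bound_of_continuous hb'
  have hB0 : 0 ≤ B := (norm_nonneg _).trans (hB 0)
  have hbz : ∀ x : ℝ, 3 ≤ |x| → b x = 0 ∧ deriv b x = 0 := by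
    intro x hx
    have hx' : x ∉ tsupport b := by
      rw [b.tsupport_eq, Metric.mem_closedBall, dist_zero_right, Real.norm_eq_abs]
      change ¬ |x| ≤ 2
      linarith
    exact ⟨image_eq_zero_of_notMem_tsupport hx',
      image_eq_zero_of_notMem_tsupport
        (fun h => hx' (closure_minimal support_deriv_subset (isClosed_tsupport _) h))⟩
  -- The shift by one gives κ ≥ 1, so the cutoff derivatives are bounded by B uniformly in k.
  let κ : ℕ → ℝ := fun k => (k : ℝ) + 1
  have κ0 : ∀ k, 0 < κ k := fun k => by positivity
  have κ1 : ∀ k, 1 ≤ κ k := fun k => by simp [κ]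
  let χ : ℕ → ℝ × ℝ → ℂ := fun k p => ((b (p.1 / κ k) : ℝ) : ℂ)
  have hχ : ∀ k, ContDiff ℝ ∞ (χ k) := fun k =>
    Complex.ofRealCLM.contDiff.comp (hb.comp (contDiff_fst.div_const _))
  have hdχ : ∀ k (p w : ℝ × ℝ), fderiv ℝ (χ k) p w = ((deriv b (p.1 / κ k) * (w.1 / κ k) : ℝ) : ℂ) := by
    intro k p w
    have k0 : HasFDerivAt (fun p : ℝ × ℝ => p.1 / κ k)
        ((κ k)⁻¹ • ContinuousLinearMap.fst ℝ ℝ ℝ) p := by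
      simpa only [div_eq_inv_mul] using (hasFDerivAt_fst (𝕜 := ℝ) (p := p)).const_mul (κ k)⁻¹
    have k1 : HasDerivAt b (deriv b (p.1 / κ k)) (p.1 / κ k) :=
      (hb.differentiable (by simp) _).hasDerivAt
    have k2 := HasDerivAt.comp_hasFDerivAt (h₂ := fun x => b x) p k1 k0
    have k3 : HasFDerivAt (χ k) _ p := Complex.ofRealCLM.hasFDerivAt.comp p k2
    rw [k3.fderiv]
    simp
    left; ring
  have strip : ∀ k (p : ℝ × ℝ), p.1 ∉ Set.Ioc (-(3 * κ k)) (3 * κ k) → 3 ≤ |p.1 / κ k| := by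
    intro k p hp
    rw [abs_div, abs_of_pos (κ0 k), le_div_iff₀ (κ0 k)]
    by_contra hlt
    rw [not_le, abs_lt] at hlt
    exact hp ⟨hlt.1, hlt.2.le⟩
  have lu := locallyIntegrableOn_of_memLp hu
  have bχ : ∀ k p, ‖χ k p‖ ≤ 1 := by
    intro k p
    rw [Complex.norm_real, Real.norm_of_nonneg b.nonneg]; exact b.le_one
  have mχ : ∀ k {f : ℝ × ℝ → ℂ}, MemLp f 2 (volume.restrict upper) →
      MemLp (fun p => χ k p * f p) 2 (volume.restrict upper) := by
    intro k f hf
    refine hf.mono ((hχ k).continuous.aestronglyMeasurable.mul hf.1) ?_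
    refine Filter.Eventually.of_forall fun p => ?_
    rw [norm_mul]
    exact mul_le_of_le_one_left (norm_nonneg _) (bχ k p)
  have bd : ∀ k (p : ℝ × ℝ), ‖fderiv ℝ (χ k) p (1, 0)‖ ≤ B / κ k := by
    intro k p
    rw [hdχ, Complex.norm_real, norm_mul, norm_div, norm_one, Real.norm_of_nonneg (κ0 k).le,
      mul_one_div]
    exact div_le_div_of_nonneg_right (hB _) (κ0 k).le
  have bd' : ∀ k (p : ℝ × ℝ), ‖fderiv ℝ (χ k) p (1, 0)‖ ≤ B := fun k p =>
    (bd k p).trans (div_le_self hB0 (κ1 k))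
  have mG : ∀ k, MemLp (fun p => χ k p * g p + fderiv ℝ (χ k) p (1, 0) * u p) 2
      (volume.restrict upper) := by
    intro k
    refine (mχ k hg).add ?_
    have hc : Continuous (fun p => fderiv ℝ (χ k) p (1, 0)) :=
      (((hχ k).fderiv_right (m := ∞) (by simp)).clm_apply contDiff_const).continuous
    refine (hu.const_mul (B : ℂ)).mono (hc.aestronglyMeasurable.mul hu.1) ?_
    refine Filter.Eventually.of_forall fun p => ?_
    rw [norm_mul, norm_mul, Complex.norm_real, Real.norm_of_nonneg hB0]
    exact mul_le_mul_of_nonneg_right (bd' k p) (norm_nonneg _)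
  have main : ∀ k, ENNReal.ofReal Theta0 * ∫⁻ p in upper, ‖χ k p * u p‖ₑ ^ 2 ≤
      (∫⁻ p in upper, ‖χ k p * h p‖ₑ ^ 2) +
        ∫⁻ p in upper, ‖χ k p * g p + fderiv ℝ (χ k) p (1, 0) * u p‖ₑ ^ 2 := by
    intro k
    have w1 := h1.mul_smooth (hχ k) (V := upper) Set.inter_subset_right lu
      (locallyIntegrableOn_sub isOpen_upper continuous_F₁ lu (locallyIntegrableOn_of_memLp hg))
    have w2 := h2.mul_smooth (hχ k) (V := upper) Set.inter_subset_right lu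
      (locallyIntegrableOn_sub isOpen_upper continuous_F₂ lu (locallyIntegrableOn_of_memLp hh))
    refine upper_bound_of_strip (R := 3 * κ k) (by have := κ0 k; positivity) (mχ k hu) (mG k)
      (mχ k hh) ?_ ?_ ?_ ?_ ?_
    · intro p hp; simp [χ, (hbz _ (strip k p hp)).1]
    · intro p hp; rw [hdχ]; simp [χ, (hbz _ (strip k p hp)).1, (hbz _ (strip k p hp)).2]
    · intro p hp; simp [χ, (hbz _ (strip k p hp)).1]
    · convert w1 using 1; funext p; ring
    · convert w2 using 1; funext p; rw [hdχ]; simp; ring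
  have κt : Filter.Tendsto κ Filter.atTop Filter.atTop :=
    Filter.tendsto_atTop_add_const_right _ _ tendsto_natCast_atTop_atTop
  have χt : ∀ p, Filter.Tendsto (fun k => χ k p) Filter.atTop (nhds 1) := by
    intro p
    have h1 : Filter.Tendsto (fun k => p.1 / κ k) Filter.atTop (nhds 0) :=
      κt.const_div_atTop p.1
    have h2 := (Complex.continuous_ofReal.tendsto _).comp ((hb.continuous.tendsto 0).comp h1)
    have h3 : b 0 = 1 := b.one_of_mem_closedBall (Metric.mem_closedBall_self (by
      change (0 : ℝ) ≤ 1; norm_num))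
    rw [h3, Complex.ofReal_one] at h2
    exact h2
  have dt : ∀ p, Filter.Tendsto (fun k => fderiv ℝ (χ k) p (1, 0)) Filter.atTop (nhds 0) := by
    intro p
    exact squeeze_zero_norm (fun k => bd k p) (κt.const_div_atTop B)
  have conv : ∀ {f : ℝ × ℝ → ℂ}, MemLp f 2 (volume.restrict upper) →
      Filter.Tendsto (fun k => ∫⁻ p in upper, ‖χ k p * f p‖ₑ ^ 2) Filter.atTop
        (nhds (∫⁻ p in upper, ‖f p‖ₑ ^ 2)) := by
    intro f hf
    apply tendsto_lintegral_of_dominated_convergence' (fun p => ‖f p‖ₑ ^ 2)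
    · exact fun k => (mχ k hf).1.enorm.pow_const 2
    · refine fun k => Filter.Eventually.of_forall fun p => ?_
      simp only [enorm_mul]
      gcongr
      refine mul_le_of_le_one_left (by simp) ?_
      rw [← ofReal_norm]; exact ENNReal.ofReal_le_one.2 (bχ k p)
    · exact ((memLp_two_iff hf.1).1 hf).ne
    · refine Filter.Eventually.of_forall fun p => tendsto_enorm_sq ?_
      simpa using (χt p).mul_const (f p)
  have convG : Filter.Tendsto
      (fun k => ∫⁻ p in upper, ‖χ k p * g p + fderiv ℝ (χ k) p (1, 0) * u p‖ₑ ^ 2) Filter.atTop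
        (nhds (∫⁻ p in upper, ‖g p‖ₑ ^ 2)) := by
    have hm : MemLp (fun p => ‖g p‖ + B * ‖u p‖) 2 (volume.restrict upper) :=
      hg.norm.add (hu.norm.const_mul B)
    apply tendsto_lintegral_of_dominated_convergence' (fun p => ‖‖g p‖ + B * ‖u p‖‖ₑ ^ 2)
    · exact fun k => (mG k).1.enorm.pow_const 2
    · refine fun k => Filter.Eventually.of_forall fun p => ?_
      refine pow_le_pow_left₀ (by simp) ?_ 2
      rw [enorm_le_iff_norm_le, Real.norm_of_nonneg (by positivity)]
      refine (norm_add_le _ _).trans ?_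
      rw [norm_mul, norm_mul]
      gcongr
      · exact mul_le_of_le_one_left (norm_nonneg _) (bχ k p)
      · exact bd' k p
    · exact ((memLp_two_iff hm.1).1 hm).ne
    · refine Filter.Eventually.of_forall fun p => tendsto_enorm_sq ?_
      simpa using ((χt p).mul_const (g p)).add ((dt p).mul_const (u p))
  exact le_of_tendsto_of_tendsto' (ENNReal.Tendsto.const_mul (conv hu) (Or.inr ENNReal.ofReal_ne_top))
    ((conv hh).add convG) main

/-! ### Transfer to an arbitrary half-plane through the origin. -/

/-- Rotation of the plane by the angle with cosine `c` and sine `s`. -/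
lemma exists_rotation {c s : ℝ} (hcs : c ^ 2 + s ^ 2 = 1) : ∃ L : (ℝ × ℝ) ≃L[ℝ] (ℝ × ℝ),
    MeasurePreserving L ∧ ∀ p, L p = (c * p.1 - s * p.2, s * p.1 + c * p.2) := by
  let a : Circle := ⟨⟨c, s⟩, by
    rw [Submonoid.unitSphere, ← SetLike.mem_coe]
    change _ ∈ Metric.sphere (0 : ℂ) 1
    rw [mem_sphere_zero_iff_norm, Complex.norm_def, Complex.normSq_mk, Real.sqrt_eq_one]
    linarith⟩
  let L : (ℝ × ℝ) ≃L[ℝ] (ℝ × ℝ) := (Complex.equivRealProdCLM.symm.trans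
    (rotation a).toContinuousLinearEquiv).trans Complex.equivRealProdCLM
  refine ⟨L, ?_, ?_⟩
  · exact Complex.volume_preserving_equiv_real_prod.comp
      ((rotation a).measurePreserving.comp Complex.volume_preserving_equiv_real_prod.symm)
  · intro p
    have : L p = Complex.equivRealProdCLM ((a : ℂ) * ⟨p.1, p.2⟩) := rfl
    rw [this]
    rw [Complex.equivRealProdCLM_apply]
    simp [a, add_comm]

/-- The magnetic energy in any half-plane `{-s x + c y > 0}` is at least `Θ₀` times the mass. -/
lemma half_plane_bound {c s : ℝ} (hcs : c ^ 2 + s ^ 2 = 1) {U : Set (ℝ × ℝ)}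
    (hU : U = {p | 0 < -s * p.1 + c * p.2}) {u g h : ℝ × ℝ → ℂ}
    (hu : MemLp u 2 (volume.restrict U)) (hg : MemLp g 2 (volume.restrict U))
    (hh : MemLp h 2 (volume.restrict U))
    (h1 : WD U (1, 0) u (fun p => g p - Complex.I * F₁ p * u p))
    (h2 : WD U (0, 1) u (fun p => h p - Complex.I * F₂ p * u p)) :
    ENNReal.ofReal Theta0 * ∫⁻ p in U, ‖u p‖ₑ ^ 2 ≤
      ∫⁻ p in U, (‖g p‖ₑ ^ 2 + ‖h p‖ₑ ^ 2) := by
  obtain ⟨L, hL, hLp⟩ := exists_rotation hcs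
  have oU : IsOpen U := by rw [hU]; exact isOpen_lt continuous_const (by fun_prop)
  have pre : L ⁻¹' U = upper := by
    ext p
    simp only [hU, Set.mem_preimage, Set.mem_ofPred_eq, hLp, upper]
    have : -s * (c * p.1 - s * p.2) + c * (s * p.1 + c * p.2) = (c ^ 2 + s ^ 2) * p.2 := by ring
    rw [this, hcs, one_mul]
  have hLU : MeasurePreserving L (volume.restrict upper) (volume.restrict U) := by
    rw [← pre]; exact hL.restrict_preimage oU.measurableSet
  have emb : MeasurableEmbedding L := L.toHomeomorph.measurableEmbedding
  have lu := locallyIntegrableOn_of_memLp hu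
  have l1 := locallyIntegrableOn_sub oU continuous_F₁ lu (locallyIntegrableOn_of_memLp hg)
  have l2 := locallyIntegrableOn_sub oU continuous_F₂ lu (locallyIntegrableOn_of_memLp hh)
  -- Derivatives along the rotated axes. The potential F commutes with rotations about the origin,
  -- so pulling back by L reproduces the same potential and only rotates the pair (g, h).
  have w1 := h1.comb_dir h2 c s lu l1 l2
  have w2 := h1.comb_dir h2 (-s) c lu l1 l2
  have e1 : c • ((1 : ℝ), (0 : ℝ)) + s • ((0 : ℝ), (1 : ℝ)) = L (1, 0) := by
    rw [hLp]; ext <;> simp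
  have e2 : (-s) • ((1 : ℝ), (0 : ℝ)) + c • ((0 : ℝ), (1 : ℝ)) = L (0, 1) := by
    rw [hLp]; ext <;> simp
  rw [e1] at w1
  rw [e2] at w2
  have w1' := w1.comp_affine L hL 0
  have w2' := w2.comp_affine L hL 0
  simp only [add_zero] at w1' w2'
  rw [pre] at w1' w2'
  have hcs' : (c : ℂ) ^ 2 + (s : ℂ) ^ 2 = 1 := by exact_mod_cast hcs
  have m1 : MemLp (fun p => (c : ℂ) * g p + (s : ℂ) * h p) 2 (volume.restrict U) :=
    (hg.const_mul _).add (hh.const_mul _)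
  have m2 : MemLp (fun p => ((-s : ℝ) : ℂ) * g p + (c : ℂ) * h p) 2 (volume.restrict U) :=
    (hg.const_mul _).add (hh.const_mul _)
  have main := upper_bound (hu.comp_measurePreserving hLU) (m1.comp_measurePreserving hLU)
    (m2.comp_measurePreserving hLU)
    (w1'.congr fun p => by
        simp only [Function.comp_apply, hLp, F₁, F₂]
        push_cast
        linear_combination (Complex.I * p.2 * u (c * p.1 - s * p.2, s * p.1 + c * p.2) / 2) * hcs')
    (w2'.congr fun p => by
        simp only [Function.comp_apply, hLp, F₁, F₂]
        push_cast
        linear_combination (-(Complex.I * p.1 * u (c * p.1 - s * p.2, s * p.1 + c * p.2) / 2)) * hcs')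
  simp only [Function.comp_apply] at main
  rw [hLU.lintegral_comp_emb emb (fun p => ‖u p‖ₑ ^ 2),
    hLU.lintegral_comp_emb emb (fun p => ‖(c : ℂ) * g p + (s : ℂ) * h p‖ₑ ^ 2),
    hLU.lintegral_comp_emb emb (fun p => ‖((-s : ℝ) : ℂ) * g p + (c : ℂ) * h p‖ₑ ^ 2)] at main
  refine main.trans_eq ?_
  rw [← lintegral_add_left' (m2.1.enorm.pow_const 2)]
  congr 1; ext p
  have hr : ∀ z : ℂ, ‖z‖ₑ ^ 2 = ENNReal.ofReal (‖z‖ ^ 2) := fun z => by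
    rw [ENNReal.ofReal_pow (norm_nonneg _), ofReal_norm]
  rw [hr, hr, hr, hr, ← ENNReal.ofReal_add (by positivity) (by positivity),
    ← ENNReal.ofReal_add (by positivity) (by positivity)]
  congr 1
  simp only [← Complex.normSq_eq_norm_sq, Complex.normSq_apply]
  simp
  linear_combination ((g p).re ^ 2 + (g p).im ^ 2 + (h p).re ^ 2 + (h p).im ^ 2) * hcs

/-! ### Geometry of the sector and a partition of unity. -/

/-- With θ the argument, the two linear forms are |z| sin θ and -|z| sin(θ+β). Because β < π, their
joint positivity confines θ to (π-β, π). The linear description makes it evident that the sector is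
an open convex cone. -/
lemma sector_eq {β : ℝ} (h0 : 0 < β) (hπ : β < Real.pi) :
    sector β = {p | 0 < p.2 ∧ 0 < -Real.sin β * p.1 + -Real.cos β * p.2} := by
  ext p
  let z : ℂ := ⟨p.1, p.2⟩
  have hx : ‖z‖ * Real.cos z.arg = p.1 := Complex.norm_mul_cos_arg z
  have hy : ‖z‖ * Real.sin z.arg = p.2 := Complex.norm_mul_sin_arg z
  have ht : -Real.sin β * p.1 + -Real.cos β * p.2 = ‖z‖ * -Real.sin (z.arg + β) := by
    rw [← hx, ← hy, Real.sin_add]; ring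
  change (Real.pi - β < z.arg ∧ z.arg < Real.pi) ↔ (0 < p.2 ∧ _)
  rw [ht, ← hy]
  constructor
  · rintro ⟨h1, h2⟩
    have hz : 0 < ‖z‖ := by
      rw [norm_pos_iff]; intro hz
      rw [hz, Complex.arg_zero] at h1; linarith
    refine ⟨mul_pos hz (Real.sin_pos_of_pos_of_lt_pi (by linarith) h2), mul_pos hz ?_⟩
    rw [← Real.sin_sub_pi]
    exact Real.sin_pos_of_pos_of_lt_pi (by linarith) (by linarith)
  · rintro ⟨h1, h2⟩
    have s1 : 0 < Real.sin z.arg := pos_of_mul_pos_right h1 (norm_nonneg _)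
    have s2 : 0 < -Real.sin (z.arg + β) := pos_of_mul_pos_right h2 (norm_nonneg _)
    have a1 : z.arg ≠ Real.pi := by intro h; rw [h, Real.sin_pi] at s1; exact lt_irrefl _ s1
    have a2 : z.arg < Real.pi := lt_of_le_of_ne (Complex.arg_le_pi z) a1
    refine ⟨?_, a2⟩
    by_contra hle
    have a3 : 0 < z.arg := by
      by_contra h
      exact absurd (Real.sin_nonpos_of_nonpos_of_neg_pi_le (not_lt.1 h)
        (Complex.neg_pi_lt_arg z).le) (not_le.2 s1)
    have := Real.sin_nonneg_of_nonneg_of_le_pi (x := z.arg + β) (by linarith) (by linarith)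
    linarith

/-- The weight `1 / (1 + |x|²)`. -/
def wt (p : ℝ × ℝ) : ℝ := 1 / (1 + p.1 ^ 2 + p.2 ^ 2)

lemma wt_pos (p : ℝ × ℝ) : 0 < wt p := by unfold wt; positivity

lemma wt_le_one (p : ℝ × ℝ) : wt p ≤ 1 := by
  unfold wt; rw [div_le_one (by positivity)]; nlinarith [sq_nonneg p.1, sq_nonneg p.2]

lemma continuous_wt : Continuous wt := by
  unfold wt
  exact continuous_const.div (by fun_prop) fun p => by positivity

/-- The map `p ↦ p / (1 + |p|²)^{1/2}`. -/
def squash (p : ℝ × ℝ) : ℝ × ℝ :=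
  (p.1 / Real.sqrt (1 + p.1 ^ 2 + p.2 ^ 2), p.2 / Real.sqrt (1 + p.1 ^ 2 + p.2 ^ 2))

lemma contDiff_sqrt_one_add :
    ContDiff ℝ ∞ (fun p : ℝ × ℝ => Real.sqrt (1 + p.1 ^ 2 + p.2 ^ 2)) :=
  ((contDiff_const.add (contDiff_fst.pow 2)).add (contDiff_snd.pow 2)).sqrt
    fun p => by positivity

lemma contDiff_squash : ContDiff ℝ ∞ squash :=
  (contDiff_fst.div contDiff_sqrt_one_add fun p => by positivity).prodMk
    (contDiff_snd.div contDiff_sqrt_one_add fun p => by positivity)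

lemma squash_sq (p : ℝ × ℝ) : (squash p).1 ^ 2 + (squash p).2 ^ 2 = 1 - wt p := by
  have h : 0 < 1 + p.1 ^ 2 + p.2 ^ 2 := by positivity
  simp only [squash, wt, div_pow, Real.sq_sqrt h.le]
  field_simp; ring

/-- With s² = 1+|p|², the derivative along v is v/s - p (p·v)/s³. In each coordinate both terms are
at most 1/s in modulus, which gives 4/s²; the norm on the product is the maximum norm. -/
lemma norm_fderiv_squash_le (p v : ℝ × ℝ) (hv : v.1 ^ 2 + v.2 ^ 2 = 1) :
    ‖fderiv ℝ squash p v‖ ^ 2 ≤ 4 * wt p := by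
  set s := Real.sqrt (1 + p.1 ^ 2 + p.2 ^ 2) with hs
  have hpos : 0 < 1 + p.1 ^ 2 + p.2 ^ 2 := by positivity
  have s0 : 0 < s := Real.sqrt_pos.2 hpos
  have s2 : s ^ 2 = 1 + p.1 ^ 2 + p.2 ^ 2 := Real.sq_sqrt hpos.le
  have d1 : HasFDerivAt (fun p : ℝ × ℝ => p.1) (ContinuousLinearMap.fst ℝ ℝ ℝ) p := hasFDerivAt_fst
  have d2 : HasFDerivAt (fun p : ℝ × ℝ => p.2) (ContinuousLinearMap.snd ℝ ℝ ℝ) p := hasFDerivAt_snd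
  have ds := (((d1.pow 2).const_add 1).add (d2.pow 2)).sqrt hpos.ne'
  have ds' : HasFDerivAt (fun p : ℝ × ℝ => Real.sqrt (1 + p.1 ^ 2 + p.2 ^ 2)) _ p := ds
  have di := HasDerivAt.comp_hasFDerivAt (h₂ := fun x : ℝ => x⁻¹) p (hasDerivAt_inv s0.ne') ds'
  have q1 := d1.fun_mul di
  have q2 := d2.fun_mul di
  have hD : HasFDerivAt squash _ p := q1.prodMk q2
  have e : fderiv ℝ squash p v = (v.1 / s - p.1 * (p.1 * v.1 + p.2 * v.2) / s ^ 3,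
      v.2 / s - p.2 * (p.1 * v.1 + p.2 * v.2) / s ^ 3) := by
    rw [hD.fderiv]
    ext <;> · simp [← hs]; field_simp; ring
  have hw : wt p = 1 / s ^ 2 := by rw [s2]; rfl
  set l := p.1 * v.1 + p.2 * v.2 with hl
  have hl2 : l ^ 2 ≤ s ^ 2 := by
    rw [s2]; nlinarith [sq_nonneg (p.1 * v.2 - p.2 * v.1), hv]
  have bound : ∀ a b : ℝ, a ^ 2 ≤ 1 → b ^ 2 ≤ s ^ 2 → (a / s - b * l / s ^ 3) ^ 2 ≤ 4 / s ^ 2 := by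
    intro a b ha hb
    have : (a / s - b * l / s ^ 3) ^ 2 = (a - b * l / s ^ 2) ^ 2 / s ^ 2 := by
      field_simp
    rw [this]
    apply div_le_div_of_nonneg_right _ (by positivity)
    have h1 : (b * l / s ^ 2) ^ 2 ≤ 1 := by
      rw [div_pow, div_le_one (by positivity), mul_pow]
      calc b ^ 2 * l ^ 2 ≤ s ^ 2 * s ^ 2 := by gcongr
        _ = (s ^ 2) ^ 2 := by ring
    nlinarith [sq_nonneg (a + b * l / s ^ 2)]
  rw [e, hw, Prod.norm_mk, mul_one_div]
  rcases max_choice ‖v.1 / s - p.1 * l / s ^ 3‖ ‖v.2 / s - p.2 * l / s ^ 3‖ with h | h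
  · rw [h, Real.norm_eq_abs, sq_abs]
    exact bound _ _ (by nlinarith [sq_nonneg v.2]) (by rw [s2]; nlinarith [sq_nonneg p.2])
  · rw [h, Real.norm_eq_abs, sq_abs]
    exact bound _ _ (by nlinarith [sq_nonneg v.1]) (by rw [s2]; nlinarith [sq_nonneg p.1])

/-- The values of `squash` stay in a compact ball, where the gradient of X is bounded. Pulling back
by `squash` thus produces cutoffs that depend asymptotically on the direction only and remain smooth
at the vertex. -/
lemma exists_fderiv_comp_squash_bound {X : ℝ × ℝ → ℝ} (hX : ContDiff ℝ ∞ X) :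
    ∃ C, 0 ≤ C ∧ ∀ p v : ℝ × ℝ, v.1 ^ 2 + v.2 ^ 2 = 1 →
      (fderiv ℝ (fun p => X (squash p)) p v) ^ 2 ≤ C * wt p := by
  have hc : Continuous (fderiv ℝ X) := hX.continuous_fderiv (by simp)
  obtain ⟨B, hB⟩ := (isCompact_closedBall (0 : ℝ × ℝ) 1).exists_bound_of_continuousOn hc.continuousOn
  refine ⟨B ^ 2 * 4, by positivity, fun p v hv => ?_⟩
  have h1 : HasFDerivAt (fun p => X (squash p)) _ p :=
    (hX.differentiable (by simp) (squash p)).hasFDerivAt.comp p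
      (contDiff_squash.differentiable (by simp) p).hasFDerivAt
  have hmem : squash p ∈ Metric.closedBall (0 : ℝ × ℝ) 1 := by
    have h2 := squash_sq p
    have h3 := wt_pos p
    rw [mem_closedBall_zero_iff, Prod.norm_def, max_le_iff, Real.norm_eq_abs, Real.norm_eq_abs,
      ← sq_le_one_iff_abs_le_one, ← sq_le_one_iff_abs_le_one]
    constructor <;> nlinarith [sq_nonneg (squash p).1, sq_nonneg (squash p).2]
  rw [h1.fderiv, ContinuousLinearMap.comp_apply, ← sq_abs, ← Real.norm_eq_abs]
  calc ‖fderiv ℝ X (squash p) (fderiv ℝ squash p v)‖ ^ 2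
      ≤ (B * ‖fderiv ℝ squash p v‖) ^ 2 := by
        gcongr
        exact (ContinuousLinearMap.le_opNorm _ _).trans (by gcongr; exact hB _ hmem)
    _ = B ^ 2 * ‖fderiv ℝ squash p v‖ ^ 2 := by ring
    _ ≤ B ^ 2 * (4 * wt p) := by gcongr; exact norm_fderiv_squash_le p v hv
    _ = _ := by ring

/-- A quadratic partition of unity adapted to the two edges and the vertex of the sector. -/
lemma exists_partition {β : ℝ} (h0 : 0 < β) (hπ : β < Real.pi) :
    ∃ (χ : Fin 3 → ℝ × ℝ → ℝ) (C : ℝ), 0 ≤ C ∧ (∀ j, ContDiff ℝ ∞ (χ j)) ∧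
      (∀ p, ∑ j, χ j p ^ 2 = 1) ∧ (∀ p, χ 0 p ^ 2 ≤ C * wt p) ∧
      (∀ j (p v : ℝ × ℝ), v.1 ^ 2 + v.2 ^ 2 = 1 → (fderiv ℝ (χ j) p v) ^ 2 ≤ C * wt p) ∧
      tsupport (χ 1) ∩ {p | 0 < p.2} ⊆ sector β ∧
      tsupport (χ 2) ∩ {p | 0 < -Real.sin β * p.1 + -Real.cos β * p.2} ⊆ sector β := by
  have hsin : 0 < Real.sin β := Real.sin_pos_of_pos_of_lt_pi h0 hπ
  let t₂ : ℝ × ℝ → ℝ := fun p => -Real.sin β * p.1 + -Real.cos β * p.2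
  -- The forms `t₂` and y are the distances to the two edge lines, and Q compares them. The factor
  -- 2/sin β is matched to `far`: away from the vertex and outside the sector, but in one of the
  -- half-planes, Q is at least 3/2 or at most -1/2. The transition 0 < Q < 1 therefore occurs well
  -- inside.
  let Q : ℝ × ℝ → ℝ := fun a => (t₂ a - a.2) * (2 / Real.sin β) + 1 / 2
  -- The vertex cutoff cos g equals one for |a|² ≤ 1/2 and vanishes for |a|² ≥ 3/4.
  let g : ℝ × ℝ → ℝ := fun a =>
    Real.pi / 2 * Real.smoothTransition (4 * (a.1 ^ 2 + a.2 ^ 2) - 2)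
  let h : ℝ × ℝ → ℝ := fun a => Real.pi / 2 * Real.smoothTransition (Q a)
  have cQ : Continuous Q := by fun_prop
  have cg : ContDiff ℝ ∞ g := contDiff_const.mul (Real.smoothTransition.contDiff.comp (by fun_prop))
  have ch : ContDiff ℝ ∞ h := contDiff_const.mul (Real.smoothTransition.contDiff.comp (by fun_prop))
  -- Spherical coordinates make the squares sum to one. Index 0 is the vertex, index 1 the edge y =
  -- 0, index 2 the other edge.
  let X : Fin 3 → ℝ × ℝ → ℝ := ![fun a => Real.cos (g a), fun a => Real.sin (g a) * Real.sin (h a),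
    fun a => Real.sin (g a) * Real.cos (h a)]
  have cX : ∀ j, ContDiff ℝ ∞ (X j) := by
    intro j
    fin_cases j
    · exact cg.cos
    · exact cg.sin.mul ch.sin
    · exact cg.sin.mul ch.cos
  choose C hC0 hC using fun j => exists_fderiv_comp_squash_bound (cX j)
  -- points outside the sector in one of the half-planes
  have far : ∀ p : ℝ × ℝ, 1 / 2 ≤ (squash p).1 ^ 2 + (squash p).2 ^ 2 →
      p.2 * t₂ p ≤ 0 → Real.sin β / 2 ≤ |t₂ (squash p) - (squash p).2| := by
    intro p hp hle
    set s := Real.sqrt (1 + p.1 ^ 2 + p.2 ^ 2) with hs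
    have s0 : 0 < s := Real.sqrt_pos.2 (by positivity)
    have e1 : t₂ (squash p) = t₂ p / s := by simp only [t₂, squash, ← hs]; ring
    have e2 : (squash p).2 = p.2 / s := rfl
    set a := squash p with ha
    have hle' : a.2 * t₂ a ≤ 0 := by
      rw [e1, e2, div_mul_div_comm]
      exact div_nonpos_of_nonpos_of_nonneg hle (by positivity)
    have hx : Real.sin β * a.1 = -(t₂ a + Real.cos β * a.2) := by simp only [t₂]; ring
    have hcs := Real.sin_sq_add_cos_sq β
    have b1 : Real.sin β ^ 2 * (a.1 ^ 2 + a.2 ^ 2) ≤ 2 * (t₂ a - a.2) ^ 2 := by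
      have : Real.sin β ^ 2 * a.1 ^ 2 = (t₂ a + Real.cos β * a.2) ^ 2 := by
        rw [← mul_pow, hx]; ring
      nlinarith [sq_nonneg (t₂ a - Real.cos β * a.2)]
    rw [← abs_of_pos (half_pos hsin), ← sq_le_sq]
    nlinarith [sq_nonneg (Real.sin β)]
  have supp : ∀ j, j ≠ 0 → ∀ p ∈ tsupport (fun p => X j (squash p)),
      1 / 2 ≤ (squash p).1 ^ 2 + (squash p).2 ^ 2 := by
    intro j hj
    apply closure_minimal (t := {p | 1 / 2 ≤ (squash p).1 ^ 2 + (squash p).2 ^ 2})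
    · intro p hp
      by_contra hlt
      simp only [Set.mem_ofPred_eq, not_le] at hlt
      apply hp
      have : Real.sin (g (squash p)) = 0 := by
        simp only [g]
        rw [Real.smoothTransition.zero_of_nonpos (by linarith)]; simp
      fin_cases j
      · simp at hj
      · simp [X, this]
      · simp [X, this]
    · have h1 := contDiff_squash.continuous
      exact isClosed_le continuous_const ((h1.fst.pow 2).add (h1.snd.pow 2))
  refine ⟨fun j p => X j (squash p), C 0 + C 1 + C 2 + 4, ?_, ?_, ?_, ?_, ?_, ?_, ?_⟩
  · have := hC0 0; have := hC0 1; have := hC0 2; positivity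
  · exact fun j => (cX j).comp contDiff_squash
  · intro p
    simp only [Fin.sum_univ_three, X, Matrix.cons_val]
    have h1 := Real.sin_sq_add_cos_sq (g (squash p))
    have h2 := Real.sin_sq_add_cos_sq (h (squash p))
    linear_combination h1 + Real.sin (g (squash p)) ^ 2 * h2
  · intro p
    have hp := wt_pos p
    -- If 4 `wt` < 1, then |`squash`|² > 3/4 and the vertex cutoff is zero.
    have h4 : X 0 (squash p) ^ 2 ≤ 4 * wt p := by
      simp only [X, Matrix.cons_val]
      by_cases hw : 1 ≤ 4 * wt p
      · exact (Real.cos_sq_le_one _).trans hw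
      · have : Real.cos (g (squash p)) = 0 := by
          simp only [g]
          rw [squash_sq, Real.smoothTransition.one_of_one_le (by linarith), mul_one,
            Real.cos_pi_div_two]
        rw [this]; nlinarith
    have := hC0 0; have := hC0 1; have := hC0 2
    nlinarith
  · intro j p v hv
    refine (hC j p v hv).trans ?_
    apply mul_le_mul_of_nonneg_right _ (wt_pos p).le
    have := hC0 0; have := hC0 1; have := hC0 2
    fin_cases j <;> simp <;> linarith
  · rintro p ⟨hp, hp2⟩
    simp only [Set.mem_ofPred_eq] at hp2
    rw [sector_eq h0 hπ]
    refine ⟨hp2, ?_⟩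
    by_contra hle
    have hle' : t₂ p ≤ 0 := not_lt.1 hle
    have h1 := far p (supp 1 (by decide) p hp) (mul_nonpos_of_nonneg_of_nonpos hp2.le hle')
    have hQ : p ∈ {p | 0 ≤ Q (squash p)} := by
      refine closure_minimal ?_ ?_ hp
      · intro p hp
        by_contra hlt
        simp only [Set.mem_ofPred_eq, not_le] at hlt
        apply hp
        simp only [X, Matrix.cons_val, h]
        rw [Real.smoothTransition.zero_of_nonpos hlt.le]; simp
      · have := contDiff_squash.continuous
        exact isClosed_le continuous_const (cQ.comp this)
    simp only [Set.mem_ofPred_eq, Q] at hQ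
    have s0 : 0 < Real.sqrt (1 + p.1 ^ 2 + p.2 ^ 2) := Real.sqrt_pos.2 (by positivity)
    have e1 : t₂ (squash p) ≤ 0 := by
      have : t₂ (squash p) = t₂ p / Real.sqrt (1 + p.1 ^ 2 + p.2 ^ 2) := by
        simp only [t₂, squash]; ring
      rw [this]; exact div_nonpos_of_nonpos_of_nonneg hle' s0.le
    have e2 : 0 < (squash p).2 := div_pos hp2 s0
    rw [abs_of_nonpos (by linarith)] at h1
    have h3 : (t₂ (squash p) - (squash p).2) * (2 / Real.sin β) ≤ -1 := by
      rw [mul_div_assoc', div_le_iff₀ hsin]; linarith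
    linarith
  · rintro p ⟨hp, hp2⟩
    simp only [Set.mem_ofPred_eq] at hp2
    rw [sector_eq h0 hπ]
    refine ⟨?_, hp2⟩
    by_contra hle
    rw [not_lt] at hle
    have hp2' : 0 < t₂ p := hp2
    have h1 := far p (supp 2 (by decide) p hp) (mul_nonpos_of_nonpos_of_nonneg hle hp2'.le)
    have hQ : p ∈ {p | Q (squash p) ≤ 1} := by
      refine closure_minimal ?_ ?_ hp
      · intro p hp
        by_contra hlt
        simp only [Set.mem_ofPred_eq, not_le] at hlt
        apply hp
        simp only [X, Matrix.cons_val, h]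
        rw [Real.smoothTransition.one_of_one_le hlt.le]; simp
      · have := contDiff_squash.continuous
        exact isClosed_le (cQ.comp this) continuous_const
    simp only [Set.mem_ofPred_eq, Q] at hQ
    have s0 : 0 < Real.sqrt (1 + p.1 ^ 2 + p.2 ^ 2) := Real.sqrt_pos.2 (by positivity)
    have e1 : 0 < t₂ (squash p) := by
      have : t₂ (squash p) = t₂ p / Real.sqrt (1 + p.1 ^ 2 + p.2 ^ 2) := by
        simp only [t₂, squash]; ring
      rw [this]; exact div_pos hp2' s0
    have e2 : (squash p).2 ≤ 0 := div_nonpos_of_nonpos_of_nonneg hle s0.le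
    rw [abs_of_pos (by linarith)] at h1
    have h3 : 1 ≤ (t₂ (squash p) - (squash p).2) * (2 / Real.sin β) := by
      rw [mul_div_assoc', le_div_iff₀ hsin]; linarith
    linarith

/-! ### The space `W β` and the localization inequality. -/

lemma measurableSet_sector {β : ℝ} (h : β < Real.pi) : MeasurableSet (sector β) :=
  (isOpen_sector h).measurableSet

lemma W.wd₁ {β : ℝ} (h : β < Real.pi) (ψ : W β) :
    WD (sector β) (1, 0) ψ.toFun (fun p => ψ.grad₁ p - Complex.I * F₁ p * ψ.toFun p) :=
  WD.of_isWeakMagDeriv (isOpen_sector h) continuous_F₁ (locallyIntegrableOn_of_memLp ψ.memLp)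
    (locallyIntegrableOn_of_memLp ψ.memLp₁) ψ.weak₁

lemma W.wd₂ {β : ℝ} (h : β < Real.pi) (ψ : W β) :
    WD (sector β) (0, 1) ψ.toFun (fun p => ψ.grad₂ p - Complex.I * F₂ p * ψ.toFun p) :=
  WD.of_isWeakMagDeriv (isOpen_sector h) continuous_F₂ (locallyIntegrableOn_of_memLp ψ.memLp)
    (locallyIntegrableOn_of_memLp ψ.memLp₂) ψ.weak₂

/-- Constructor of `W β` from plain weak derivatives. -/
def W.mk' {β : ℝ} (h : β < Real.pi) (ψ g₁ g₂ : ℝ × ℝ → ℂ)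
    (m : MemLp ψ 2 (volume.restrict (sector β))) (m₁ : MemLp g₁ 2 (volume.restrict (sector β)))
    (m₂ : MemLp g₂ 2 (volume.restrict (sector β)))
    (w₁ : WD (sector β) (1, 0) ψ (fun p => g₁ p - Complex.I * F₁ p * ψ p))
    (w₂ : WD (sector β) (0, 1) ψ (fun p => g₂ p - Complex.I * F₂ p * ψ p)) : W β where
  toFun := ψ
  grad₁ := g₁
  grad₂ := g₂
  memLp := m
  memLp₁ := m₁
  memLp₂ := m₂
  weak₁ := by
    have l := locallyIntegrableOn_of_memLp m
    simpa using w₁.isWeakMagDeriv (isOpen_sector h) continuous_F₁ l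
      (locallyIntegrableOn_sub (isOpen_sector h) continuous_F₁ l (locallyIntegrableOn_of_memLp m₁))
  weak₂ := by
    have l := locallyIntegrableOn_of_memLp m
    simpa using w₂.isWeakMagDeriv (isOpen_sector h) continuous_F₂ l
      (locallyIntegrableOn_sub (isOpen_sector h) continuous_F₂ l (locallyIntegrableOn_of_memLp m₂))

/-- `a ψ + b χ`. -/
def W.comb {β : ℝ} (h : β < Real.pi) (a b : ℂ) (ψ χ : W β) : W β :=
  W.mk' h (fun p => a * ψ.toFun p + b * χ.toFun p) (fun p => a * ψ.grad₁ p + b * χ.grad₁ p)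
    (fun p => a * ψ.grad₂ p + b * χ.grad₂ p)
    ((ψ.memLp.const_mul a).add (χ.memLp.const_mul b))
    ((ψ.memLp₁.const_mul a).add (χ.memLp₁.const_mul b))
    ((ψ.memLp₂.const_mul a).add (χ.memLp₂.const_mul b))
    (((ψ.wd₁ h).comb (χ.wd₁ h) a b (locallyIntegrableOn_of_memLp ψ.memLp)
      (locallyIntegrableOn_sub (isOpen_sector h) continuous_F₁ (locallyIntegrableOn_of_memLp ψ.memLp)
        (locallyIntegrableOn_of_memLp ψ.memLp₁)) (locallyIntegrableOn_of_memLp χ.memLp)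
      (locallyIntegrableOn_sub (isOpen_sector h) continuous_F₁ (locallyIntegrableOn_of_memLp χ.memLp)
        (locallyIntegrableOn_of_memLp χ.memLp₁))).congr fun p => by ring)
    (((ψ.wd₂ h).comb (χ.wd₂ h) a b (locallyIntegrableOn_of_memLp ψ.memLp)
      (locallyIntegrableOn_sub (isOpen_sector h) continuous_F₂ (locallyIntegrableOn_of_memLp ψ.memLp)
        (locallyIntegrableOn_of_memLp ψ.memLp₂)) (locallyIntegrableOn_of_memLp χ.memLp)
      (locallyIntegrableOn_sub (isOpen_sector h) continuous_F₂ (locallyIntegrableOn_of_memLp χ.memLp)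
        (locallyIntegrableOn_of_memLp χ.memLp₂))).congr fun p => by ring)

lemma memLp_mul_bounded {U : Set (ℝ × ℝ)} {f : ℝ × ℝ → ℂ} {a : ℝ × ℝ → ℝ} {C : ℝ}
    (ha : Continuous a) (hC : ∀ p, a p ^ 2 ≤ C) (hf : MemLp f 2 (volume.restrict U)) :
    MemLp (fun p => (a p : ℂ) * f p) 2 (volume.restrict U) := by
  refine (hf.const_mul ((Real.sqrt C : ℝ) : ℂ)).mono
    ((Complex.continuous_ofReal.comp ha).aestronglyMeasurable.mul hf.1) ?_
  refine Filter.Eventually.of_forall fun p => ?_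
  rw [norm_mul, norm_mul, Complex.norm_real, Complex.norm_real, Real.norm_eq_abs,
    Real.norm_of_nonneg (Real.sqrt_nonneg _)]
  exact mul_le_mul_of_nonneg_right (Real.abs_le_sqrt (hC p)) (norm_nonneg _)

lemma memLp_extend {S U : Set (ℝ × ℝ)} (hS : MeasurableSet S) (hU : MeasurableSet U)
    {f : ℝ × ℝ → ℂ} (hf : MemLp f 2 (volume.restrict S)) (hz : ∀ p ∈ U, p ∉ S → f p = 0) :
    MemLp f 2 (volume.restrict U) := by
  have h1 : MemLp (S.indicator f) 2 volume := (memLp_indicator_iff_restrict hS).2 hf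
  refine (memLp_congr_ae ?_).1 (h1.restrict U)
  rw [Filter.EventuallyEq, ae_restrict_iff' hU]
  refine Filter.Eventually.of_forall fun p hp => ?_
  by_cases hpS : p ∈ S
  · rw [Set.indicator_of_mem hpS]
  · rw [Set.indicator_of_notMem hpS, hz p hp hpS]

lemma setLIntegral_extend {S U : Set (ℝ × ℝ)} (hS : MeasurableSet S) (hU : MeasurableSet U)
    (hSU : S ⊆ U) {f : ℝ × ℝ → ENNReal} (hz : ∀ p ∈ U, p ∉ S → f p = 0) :
    ∫⁻ p in U, f p = ∫⁻ p in S, f p := by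
  have : ∫⁻ p in U, f p = ∫⁻ p in U, S.indicator f p := by
    apply setLIntegral_congr_fun hU
    intro p hp
    by_cases hpS : p ∈ S
    · rw [Set.indicator_of_mem hpS]
    · rw [Set.indicator_of_notMem hpS, hz p hp hpS]
  rw [this, lintegral_indicator hS, Measure.restrict_restrict hS, Set.inter_eq_left.2 hSU]

/-- Energy bound for the part of `ψ` near one edge. -/
lemma W.edge_bound {β : ℝ} (hπ : β < Real.pi) (ψ : W β) {c s : ℝ} (hcs : c ^ 2 + s ^ 2 = 1)
    {χ : ℝ × ℝ → ℝ} (hχ : ContDiff ℝ ∞ χ) {C : ℝ} (h1 : ∀ p, χ p ^ 2 ≤ 1)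
    (hd : ∀ p v : ℝ × ℝ, v.1 ^ 2 + v.2 ^ 2 = 1 → (fderiv ℝ χ p v) ^ 2 ≤ C)
    (hsub : sector β ⊆ {p | 0 < -s * p.1 + c * p.2})
    (hsupp : tsupport χ ∩ {p | 0 < -s * p.1 + c * p.2} ⊆ sector β) :
    Theta0 * ∫ p in sector β, ‖(χ p : ℂ) * ψ.toFun p‖ ^ 2 ≤
      ∫ p in sector β, (‖(χ p : ℂ) * ψ.grad₁ p + (fderiv ℝ χ p (1, 0) : ℝ) * ψ.toFun p‖ ^ 2
        + ‖(χ p : ℂ) * ψ.grad₂ p + (fderiv ℝ χ p (0, 1) : ℝ) * ψ.toFun p‖ ^ 2) := by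
  set U : Set (ℝ × ℝ) := {p | 0 < -s * p.1 + c * p.2} with hU
  have oU : IsOpen U := isOpen_lt continuous_const (by fun_prop)
  have mS := measurableSet_sector hπ
  have cd : ∀ v, Continuous (fun p => fderiv ℝ χ p v) := fun v =>
    ((hχ.fderiv_right (m := ∞) (by simp)).clm_apply contDiff_const).continuous
  have χz : ∀ p ∈ U, p ∉ sector β → χ p = 0 := fun p hp hpS =>
    image_eq_zero_of_notMem_tsupport (fun h => hpS (hsupp ⟨h, hp⟩))
  have dz : ∀ v, ∀ p ∈ U, p ∉ sector β → fderiv ℝ χ p v = 0 := fun v p hp hpS =>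
    image_eq_zero_of_notMem_tsupport (f := fun p => fderiv ℝ χ p v) fun h =>
      hpS (hsupp ⟨tsupport_fderiv_apply_subset ℝ v h, hp⟩)
  have m0 := memLp_mul_bounded hχ.continuous h1 ψ.memLp
  have m1 : MemLp (fun p => (χ p : ℂ) * ψ.grad₁ p + (fderiv ℝ χ p (1, 0) : ℝ) * ψ.toFun p) 2
      (volume.restrict (sector β)) := (memLp_mul_bounded hχ.continuous h1 ψ.memLp₁).add
    (memLp_mul_bounded (cd _) (fun p => hd p (1, 0) (by simp)) ψ.memLp)
  have m2 : MemLp (fun p => (χ p : ℂ) * ψ.grad₂ p + (fderiv ℝ χ p (0, 1) : ℝ) * ψ.toFun p) 2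
      (volume.restrict (sector β)) := (memLp_mul_bounded hχ.continuous h1 ψ.memLp₂).add
    (memLp_mul_bounded (cd _) (fun p => hd p (0, 1) (by simp)) ψ.memLp)
  have lψ := locallyIntegrableOn_of_memLp ψ.memLp
  have z0 : ∀ p ∈ U, p ∉ sector β → (χ p : ℂ) * ψ.toFun p = 0 := fun p hp hS => by
    rw [χz p hp hS]; simp
  have z1 : ∀ p ∈ U, p ∉ sector β →
      (χ p : ℂ) * ψ.grad₁ p + (fderiv ℝ χ p (1, 0) : ℝ) * ψ.toFun p = 0 := fun p hp hS => by
    rw [χz p hp hS, dz _ p hp hS]; simp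
  have z2 : ∀ p ∈ U, p ∉ sector β →
      (χ p : ℂ) * ψ.grad₂ p + (fderiv ℝ χ p (0, 1) : ℝ) * ψ.toFun p = 0 := fun p hp hS => by
    rw [χz p hp hS, dz _ p hp hS]; simp
  have cχ : ContDiff ℝ ∞ (fun p => (χ p : ℂ)) := Complex.ofRealCLM.contDiff.comp hχ
  have cs : tsupport (fun p => (χ p : ℂ)) ∩ U ⊆ sector β := by
    refine (Set.inter_subset_inter_left _ (closure_mono fun p hp => ?_)).trans hsupp
    simpa using hp
  -- The cut-off function, extended by zero, has a magnetic gradient on the whole half-plane: the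
  -- support of χ reaches the boundary of the sector only along the edge that also bounds the
  -- half-plane.
  have main := half_plane_bound hcs hU (memLp_extend mS oU.measurableSet m0 z0)
    (memLp_extend mS oU.measurableSet m1 z1) (memLp_extend mS oU.measurableSet m2 z2)
    (((ψ.wd₁ hπ).mul_smooth cχ cs lψ (locallyIntegrableOn_sub (isOpen_sector hπ) continuous_F₁ lψ
      (locallyIntegrableOn_of_memLp ψ.memLp₁))).congr fun p => by
        rw [fderiv_ofReal_comp hχ]; ring)
    (((ψ.wd₂ hπ).mul_smooth cχ cs lψ (locallyIntegrableOn_sub (isOpen_sector hπ) continuous_F₂ lψ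
      (locallyIntegrableOn_of_memLp ψ.memLp₂))).congr fun p => by
        rw [fderiv_ofReal_comp hχ]; ring)
  rw [setLIntegral_extend mS oU.measurableSet hsub (fun p hp hS => by rw [z0 p hp hS]; simp),
    setLIntegral_extend mS oU.measurableSet hsub
      (fun p hp hS => by rw [z1 p hp hS, z2 p hp hS]; simp),
    lintegral_add_left' (m1.1.enorm.pow_const 2), lintegral_enorm_sq m0, lintegral_enorm_sq m1,
    lintegral_enorm_sq m2, ← ENNReal.ofReal_mul Theta0_nonneg,
    ← ENNReal.ofReal_add (integral_nonneg fun t => by positivity)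
      (integral_nonneg fun t => by positivity),
    ENNReal.ofReal_le_ofReal_iff (add_nonneg (integral_nonneg fun t => by positivity)
      (integral_nonneg fun t => by positivity))] at main
  rw [integral_add (integrable_norm_sq m1) (integrable_norm_sq m2)]
  exact main

/-- `∫_{S_β} |ψ|² / (1 + |x|²)`. -/
def W.wmass {β : ℝ} (ψ : W β) : ℝ := ∫ p in sector β, wt p * ‖ψ.toFun p‖ ^ 2

lemma integrable_wt_mul {U : Set (ℝ × ℝ)} {f : ℝ × ℝ → ℂ} (hf : MemLp f 2 (volume.restrict U)) :
    Integrable (fun p => wt p * ‖f p‖ ^ 2) (volume.restrict U) := by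
  refine (integrable_norm_sq hf).mono (continuous_wt.aestronglyMeasurable.mul
    (integrable_norm_sq hf).1) (Filter.Eventually.of_forall fun p => ?_)
  rw [norm_mul, Real.norm_of_nonneg (wt_pos p).le]
  exact mul_le_of_le_one_left (norm_nonneg _) (wt_le_one p)

/-- Localization: up to a multiple of the weighted mass, the energy dominates `Θ₀` times the
mass. -/
lemma exists_hardy {β : ℝ} (h0 : 0 < β) (hπ : β < Real.pi) :
    ∃ C, 0 ≤ C ∧ ∀ ψ : W β, Theta0 * ψ.mass ≤ ψ.kinetic + C * ψ.wmass := by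
  obtain ⟨χ, C, hC, hχ, hsum, hχ0, hd, hs1, hs2⟩ := exists_partition h0 hπ
  have hT := Theta0_nonneg
  -- The first term pays for the mass of the vertex piece; the factor 6 counts three cutoffs and two
  -- directions.
  refine ⟨Theta0 * C + 6 * C, by positivity, fun ψ => ?_⟩
  have h1 : ∀ j p, χ j p ^ 2 ≤ 1 := by
    intro j p
    rw [← hsum p]
    exact Finset.single_le_sum (f := fun j => χ j p ^ 2) (fun i _ => sq_nonneg _) (Finset.mem_univ j)
  have hdC : ∀ j (p v : ℝ × ℝ), v.1 ^ 2 + v.2 ^ 2 = 1 → (fderiv ℝ (χ j) p v) ^ 2 ≤ C :=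
    fun j p v hv => (hd j p v hv).trans (mul_le_of_le_one_right hC (wt_le_one p))
  have cd : ∀ j v, Continuous (fun p => fderiv ℝ (χ j) p v) := fun j v =>
    (((hχ j).fderiv_right (m := ∞) (by simp)).clm_apply contDiff_const).continuous
  have b1 := ψ.edge_bound hπ (c := 1) (s := 0) (by norm_num) (hχ 1) (h1 1) (hdC 1)
    (by rw [sector_eq h0 hπ]; intro p hp; simpa using hp.1) (by simpa using hs1)
  have b2 := ψ.edge_bound hπ (c := -Real.cos β) (s := Real.sin β)
    (by rw [neg_sq, Real.cos_sq_add_sin_sq]) (hχ 2) (h1 2) (hdC 2)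
    (by rw [sector_eq h0 hπ]; intro p hp; exact hp.2) hs2
  have m0 : ∀ j, MemLp (fun p => (χ j p : ℂ) * ψ.toFun p) 2 (volume.restrict (sector β)) :=
    fun j => memLp_mul_bounded (hχ j).continuous (h1 j) ψ.memLp
  have m1 : ∀ j, MemLp (fun p => (χ j p : ℂ) * ψ.grad₁ p +
      (fderiv ℝ (χ j) p (1, 0) : ℝ) * ψ.toFun p) 2 (volume.restrict (sector β)) := fun j =>
    (memLp_mul_bounded (hχ j).continuous (h1 j) ψ.memLp₁).add
    (memLp_mul_bounded (cd j _) (fun p => hdC j p (1, 0) (by simp)) ψ.memLp)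
  have m2 : ∀ j, MemLp (fun p => (χ j p : ℂ) * ψ.grad₂ p +
      (fderiv ℝ (χ j) p (0, 1) : ℝ) * ψ.toFun p) 2 (volume.restrict (sector β)) := fun j =>
    (memLp_mul_bounded (hχ j).continuous (h1 j) ψ.memLp₂).add
    (memLp_mul_bounded (cd j _) (fun p => hdC j p (0, 1) (by simp)) ψ.memLp)
  have i0 := fun j => integrable_norm_sq (m0 j)
  have ik := fun j => (integrable_norm_sq (m1 j)).fun_add (integrable_norm_sq (m2 j))
  have sum_deriv : ∀ p v, ∑ j, χ j p * fderiv ℝ (χ j) p v = 0 := by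
    intro p v
    have e1 : HasFDerivAt (fun p => ∑ j, χ j p ^ 2)
        (∑ j, (2 • χ j p ^ (2 - 1)) • fderiv ℝ (χ j) p) p := by
      apply HasFDerivAt.fun_sum
      intro j _
      exact ((hχ j).differentiable (by simp) p).hasFDerivAt.pow 2
    have e2 : (fun p => ∑ j, χ j p ^ 2) = fun _ => (1 : ℝ) := funext hsum
    rw [e2] at e1
    have e3 := e1.unique (hasFDerivAt_const (1 : ℝ) p)
    have e4 := DFunLike.congr_fun e3 v
    simp only [Fin.sum_univ_three] at e4 ⊢
    simp at e4
    linarith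
  -- The IMS localization formula: differentiating Σ χ_j² = 1 kills the cross terms and leaves only
  -- Σ |∂χ_j|² |u|².
  have ident : ∀ p (z u : ℂ) (v : ℝ × ℝ), ∑ j, ‖(χ j p : ℂ) * z + (fderiv ℝ (χ j) p v : ℝ) * u‖ ^ 2
      = ‖z‖ ^ 2 + (∑ j, (fderiv ℝ (χ j) p v) ^ 2) * ‖u‖ ^ 2 := by
    intro p z u v
    have s1 := hsum p
    have s2 := sum_deriv p v
    simp only [Fin.sum_univ_three] at s1 s2 ⊢
    simp only [← Complex.normSq_eq_norm_sq, Complex.normSq_apply]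
    simp
    linear_combination (z.re ^ 2 + z.im ^ 2) * s1 + 2 * (z.re * u.re + z.im * u.im) * s2
  -- The kinetic energy of the vertex piece is simply discarded.
  have k0 : 0 ≤ ∫ p in sector β,
      (‖(χ 0 p : ℂ) * ψ.grad₁ p + (fderiv ℝ (χ 0) p (1, 0) : ℝ) * ψ.toFun p‖ ^ 2
        + ‖(χ 0 p : ℂ) * ψ.grad₂ p + (fderiv ℝ (χ 0) p (0, 1) : ℝ) * ψ.toFun p‖ ^ 2) :=
    integral_nonneg fun p => by positivity
  have iM := integrable_norm_sq ψ.memLp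
  have iW := integrable_wt_mul ψ.memLp
  have iK := (integrable_norm_sq ψ.memLp₁).fun_add (integrable_norm_sq ψ.memLp₂)
  -- sum of the three kinetic terms
  have up : (∑ j, ∫ p in sector β,
      (‖(χ j p : ℂ) * ψ.grad₁ p + (fderiv ℝ (χ j) p (1, 0) : ℝ) * ψ.toFun p‖ ^ 2
        + ‖(χ j p : ℂ) * ψ.grad₂ p + (fderiv ℝ (χ j) p (0, 1) : ℝ) * ψ.toFun p‖ ^ 2))
      ≤ ψ.kinetic + 6 * C * ψ.wmass := by
    rw [← integral_finsetSum _ fun j _ => ik j, W.kinetic, W.wmass, ← integral_const_mul,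
      ← integral_add iK (iW.const_mul _)]
    apply integral_mono (integrable_finsetSum _ fun j _ => ik j) (iK.fun_add (iW.const_mul _))
    intro p
    simp only [Finset.sum_add_distrib]
    rw [ident, ident]
    have a1 : ∑ j, (fderiv ℝ (χ j) p (1, 0)) ^ 2 ≤ 3 * (C * wt p) := by
      simp only [Fin.sum_univ_three]
      linarith [hd 0 p (1, 0) (by simp), hd 1 p (1, 0) (by simp), hd 2 p (1, 0) (by simp)]
    have a2 : ∑ j, (fderiv ℝ (χ j) p (0, 1)) ^ 2 ≤ 3 * (C * wt p) := by
      simp only [Fin.sum_univ_three]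
      linarith [hd 0 p (0, 1) (by simp), hd 1 p (0, 1) (by simp), hd 2 p (0, 1) (by simp)]
    nlinarith [mul_le_mul_of_nonneg_right a1 (sq_nonneg ‖ψ.toFun p‖),
      mul_le_mul_of_nonneg_right a2 (sq_nonneg ‖ψ.toFun p‖)]
  have low : ψ.mass - C * ψ.wmass ≤ (∫ p in sector β, ‖(χ 1 p : ℂ) * ψ.toFun p‖ ^ 2)
      + ∫ p in sector β, ‖(χ 2 p : ℂ) * ψ.toFun p‖ ^ 2 := by
    rw [W.mass, W.wmass, ← integral_const_mul, ← integral_sub iM (iW.const_mul _),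
      ← integral_add (i0 1) (i0 2)]
    apply integral_mono (iM.sub (iW.const_mul _)) ((i0 1).fun_add (i0 2))
    intro p
    have s1 := hsum p
    simp only [Fin.sum_univ_three] at s1
    simp only [Pi.sub_apply, norm_mul, mul_pow, Complex.norm_real, Real.norm_eq_abs, sq_abs]
    nlinarith [mul_le_mul_of_nonneg_right (hχ0 p) (sq_nonneg ‖ψ.toFun p‖)]
  simp only [Fin.sum_univ_three] at up
  have := mul_le_mul_of_nonneg_left low hT
  linarith

/-- The square of the weight decays like |p|⁻⁴ in dimension two. This is what allows the weighted
mass to be absorbed by the quartic term. -/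
lemma integrable_wt_sq : Integrable (fun p => wt p ^ 2) (volume : Measure (ℝ × ℝ)) := by
  have h := integrable_one_add_norm (E := ℝ × ℝ) (μ := volume) (r := 4)
    (by simp; norm_num)
  refine (h.const_mul 4).mono (continuous_wt.pow 2).aestronglyMeasurable
    (Filter.Eventually.of_forall fun p => ?_)
  have hn : 0 ≤ ‖p‖ := norm_nonneg p
  have hp : ‖p‖ ^ 2 ≤ p.1 ^ 2 + p.2 ^ 2 := by
    rw [Prod.norm_def]
    rcases max_choice ‖p.1‖ ‖p.2‖ with h | h <;>
      rw [h, Real.norm_eq_abs, sq_abs] <;> nlinarith [sq_nonneg p.1, sq_nonneg p.2]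
  rw [Real.norm_of_nonneg (by positivity), Real.norm_of_nonneg (by positivity),
    Real.rpow_neg (by positivity), show (4 : ℝ) = ((4 : ℕ) : ℝ) by norm_num, Real.rpow_natCast,
    ← div_eq_mul_inv, wt, div_pow, div_le_div_iff₀ (by positivity) (by positivity)]
  have h1 : (1 + ‖p‖) ^ 2 ≤ 2 * (1 + p.1 ^ 2 + p.2 ^ 2) := by nlinarith [sq_nonneg (‖p‖ - 1)]
  have h2 : ((1 + ‖p‖) ^ 2) ^ 2 ≤ (2 * (1 + p.1 ^ 2 + p.2 ^ 2)) ^ 2 := by gcongr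
  push_cast
  nlinarith

/-! ### Duality in L² and representatives defined on the whole plane. -/

section L2
variable {α : Type*} [MeasurableSpace α] {μ : Measure α}

lemma norm_toLp_sq {f : α → ℂ} (hf : MemLp f 2 μ) : ‖hf.toLp f‖ ^ 2 = ∫ x, ‖f x‖ ^ 2 ∂μ := by
  rw [← inner_self_eq_norm_sq (𝕜 := ℂ), L2.inner_def, ← integral_re (L2.integrable_inner _ _)]
  apply integral_congr_ae
  filter_upwards [hf.coeFn_toLp] with x hx
  rw [hx, inner_self_eq_norm_sq]

lemma norm_toLp_eq_sqrt {f : α → ℂ} (hf : MemLp f 2 μ) :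
    ‖hf.toLp f‖ = Real.sqrt (∫ x, ‖f x‖ ^ 2 ∂μ) := by
  rw [← norm_toLp_sq hf, Real.sqrt_sq (norm_nonneg _)]

lemma inner_toLp {f g : α → ℂ} (hf : MemLp f 2 μ) (hg : MemLp g 2 μ) :
    inner ℂ (hf.toLp f) (hg.toLp g) = ∫ x, star (f x) * g x ∂μ := by
  rw [L2.inner_def]
  apply integral_congr_ae
  filter_upwards [hf.coeFn_toLp, hg.coeFn_toLp] with x hx hy
  rw [hx, hy, RCLike.inner_apply, mul_comm]; rfl

lemma memLp_star {f : α → ℂ} (hf : MemLp f 2 μ) : MemLp (fun x => star (f x)) 2 μ :=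
  hf.congr_norm (continuous_star.comp_aestronglyMeasurable hf.1)
    (Filter.Eventually.of_forall fun x => by simp)

lemma norm_integral_mul_le {f g : α → ℂ} (hf : MemLp f 2 μ) (hg : MemLp g 2 μ) :
    ‖∫ x, f x * g x ∂μ‖ ≤ Real.sqrt (∫ x, ‖f x‖ ^ 2 ∂μ) * Real.sqrt (∫ x, ‖g x‖ ^ 2 ∂μ) := by
  have h := norm_inner_le_norm (𝕜 := ℂ) ((memLp_star hf).toLp _) (hg.toLp g)
  rw [inner_toLp, norm_toLp_eq_sqrt, norm_toLp_eq_sqrt] at h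
  simpa using h

end L2

lemma CTest.memLp {U V : Set (ℝ × ℝ)} {Φ : ℝ × ℝ → ℂ} (h : CTest U Φ) :
    MemLp Φ 2 (volume.restrict V) :=
  (h.smooth.continuous.memLp_of_hasCompactSupport h.compact).restrict V

lemma CTest.star {U : Set (ℝ × ℝ)} {Φ : ℝ × ℝ → ℂ} (h : CTest U Φ) :
    CTest U (fun p => star (Φ p)) := by
  refine ⟨Complex.conjCLE.contDiff.comp h.smooth, ?_, ?_⟩
  · exact h.compact.comp_left (g := fun z : ℂ => Star.star z) (by simp)
  · refine (closure_mono fun p hp => ?_).trans h.support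
    simpa using hp

/-- `L²` bounds can be read off from pairings with test functions. -/
lemma integral_norm_sq_le_of_test {U : Set (ℝ × ℝ)} (hU : IsOpen U) {h : ℝ × ℝ → ℂ}
    (hh : MemLp h 2 (volume.restrict U)) {C : ℝ} (hC : 0 ≤ C)
    (hb : ∀ Φ, CTest U Φ → ‖∫ p in U, Φ p * h p‖ ≤ C * Real.sqrt (∫ p in U, ‖Φ p‖ ^ 2)) :
    ∫ p in U, ‖h p‖ ^ 2 ≤ C ^ 2 := by
  let D : Submodule ℂ (Lp ℂ 2 (volume.restrict U)) :=
    { carrier := {f | ∃ Φ, CTest U Φ ∧ f =ᵐ[volume.restrict U] Φ}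
      zero_mem' := ⟨fun _ => 0, ⟨contDiff_const, HasCompactSupport.zero, by simp [tsupport]⟩,
        Lp.coeFn_zero ..⟩
      add_mem' := by
        rintro f g ⟨Φ, hΦ, hf⟩ ⟨Ψ, hΨ, hg⟩
        refine ⟨Φ + Ψ, ⟨hΦ.smooth.add hΨ.smooth, hΦ.compact.add hΨ.compact,
          (tsupport_add Φ Ψ).trans (Set.union_subset hΦ.support hΨ.support)⟩, ?_⟩
        exact (Lp.coeFn_add f g).trans (hf.add hg)
      smul_mem' := by
        rintro c f ⟨Φ, hΦ, hf⟩
        refine ⟨c • Φ, ⟨contDiff_const.smul hΦ.smooth, hΦ.compact.smul_left,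
          (tsupport_smul_subset_right (fun _ => c) Φ).trans hΦ.support⟩, ?_⟩
        exact (Lp.coeFn_smul c f).trans (hf.const_smul c) }
  -- Density of test functions in L²: a function orthogonal to all of them vanishes by the
  -- fundamental lemma of the calculus of variations.
  have hD : Dᗮ = ⊥ := by
    rw [Submodule.eq_bot_iff]
    intro x hx
    have hx' : MemLp x 2 (volume.restrict U) := Lp.memLp x
    have hxx : hx'.toLp x = x := Lp.toLp_coeFn x hx'
    have key := hU.ae_eq_zero_of_integral_contDiff_smul_eq_zero (f := (x : ℝ × ℝ → ℂ))
      (locallyIntegrableOn_of_memLp hx') (by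
        intro φ h1 h2 h3
        have hφ : IsTest U φ := ⟨h1, h2, h3⟩
        have hm : hφ.ofReal.memLp.toLp _ ∈ D := ⟨_, hφ.ofReal, hφ.ofReal.memLp.coeFn_toLp⟩
        have e := (Submodule.mem_orthogonal D x).1 hx _ hm
        rw [← hxx, inner_toLp] at e
        simp only [RCLike.star_def, Complex.conj_ofReal] at e
        rw [hφ.ofReal.setIntegral_mul] at e
        simpa using e)
    rw [Lp.eq_zero_iff_ae_eq_zero, Filter.EventuallyEq, ae_restrict_iff' hU.measurableSet]
    exact key
  have hdense : Dense (D : Set (Lp ℂ 2 (volume.restrict U))) := by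
    rw [Submodule.dense_iff_topologicalClosure_eq_top]
    exact Submodule.topologicalClosure_eq_top_iff.2 hD
  have hall : ∀ y : Lp ℂ 2 (volume.restrict U), ‖inner ℂ y (hh.toLp h)‖ ≤ C * ‖y‖ := by
    intro y
    refine hdense.induction (P := fun y => ‖inner ℂ y (hh.toLp h)‖ ≤ C * ‖y‖) ?_ ?_ y
    · rintro f ⟨Φ, hΦ, hf⟩
      have hf' : f = hΦ.memLp.toLp Φ := by
        rw [← Lp.toLp_coeFn f (Lp.memLp f)]; exact MemLp.toLp_congr _ _ hf
      rw [hf', inner_toLp, norm_toLp_eq_sqrt]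
      have := hb _ hΦ.star
      simpa using this
    · exact isClosed_le (by fun_prop) (by fun_prop)
  have h1 := hall (hh.toLp h)
  rw [inner_self_eq_norm_sq_to_K] at h1
  rw [← norm_toLp_sq hh]
  have hn := norm_nonneg (hh.toLp h)
  have h2 : ‖hh.toLp h‖ ^ 2 ≤ C * ‖hh.toLp h‖ := by simpa using h1
  have h3 : ‖hh.toLp h‖ ≤ C := by
    rcases hn.eq_or_lt with h0 | h0
    · rw [← h0]; exact hC
    · nlinarith
  gcongr

/-- Square-integrable functions on the plane that vanish outside `S`. -/
structure Nice (S : Set (ℝ × ℝ)) (f : ℝ × ℝ → ℂ) : Prop where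
  meas : StronglyMeasurable f
  memLp : MemLp f 2 volume
  zero : ∀ p, p ∉ S → f p = 0

lemma Nice.setIntegral {S : Set (ℝ × ℝ)} {f : ℝ × ℝ → ℂ} (h : Nice S f) :
    ∫ p in S, ‖f p‖ ^ 2 = ∫ p, ‖f p‖ ^ 2 :=
  setIntegral_eq_integral_of_forall_compl_eq_zero fun p hp => by rw [h.zero p hp]; simp

lemma Nice.comb {S : Set (ℝ × ℝ)} {f g : ℝ × ℝ → ℂ} (hf : Nice S f) (hg : Nice S g) (a b : ℂ) :
    Nice S (fun p => a * f p + b * g p) :=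
  ⟨(hf.meas.const_mul a).add (hg.meas.const_mul b),
    (hf.memLp.const_mul a).add (hg.memLp.const_mul b),
    fun p hp => by rw [hf.zero p hp, hg.zero p hp]; simp⟩

lemma nice_indicator {S : Set (ℝ × ℝ)} (hS : MeasurableSet S) {f : ℝ × ℝ → ℂ}
    (hf : MemLp f 2 (volume.restrict S)) : Nice S (S.indicator (hf.1.mk f)) := by
  refine ⟨hf.1.stronglyMeasurable_mk.indicator hS, ?_, fun p hp => Set.indicator_of_notMem hp _⟩
  exact (memLp_indicator_iff_restrict hS).2 ((memLp_congr_ae hf.1.ae_eq_mk).1 hf)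

lemma indicator_mk_ae {S : Set (ℝ × ℝ)} (hS : MeasurableSet S) {f : ℝ × ℝ → ℂ}
    (hf : MemLp f 2 (volume.restrict S)) :
    f =ᵐ[volume.restrict S] S.indicator (hf.1.mk f) := by
  have h := hf.1.ae_eq_mk
  rw [Filter.EventuallyEq, ae_restrict_iff' hS] at h ⊢
  filter_upwards [h] with p hp hpS
  rw [Set.indicator_of_mem hpS, hp hpS]

/-- Every element of `W β` has representatives that are `Nice`. -/
lemma W.exists_nice {β : ℝ} (h : β < Real.pi) (ψ : W β) : ∃ χ : W β,
    ψ.toFun =ᵐ[volume.restrict (sector β)] χ.toFun ∧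
    ψ.grad₁ =ᵐ[volume.restrict (sector β)] χ.grad₁ ∧
    ψ.grad₂ =ᵐ[volume.restrict (sector β)] χ.grad₂ ∧
    Nice (sector β) χ.toFun ∧ Nice (sector β) χ.grad₁ ∧ Nice (sector β) χ.grad₂ := by
  have hS := measurableSet_sector h
  have e0 := indicator_mk_ae hS ψ.memLp
  have e1 := indicator_mk_ae hS ψ.memLp₁
  have e2 := indicator_mk_ae hS ψ.memLp₂
  refine ⟨W.mk' h _ _ _ ((memLp_congr_ae e0).1 ψ.memLp) ((memLp_congr_ae e1).1 ψ.memLp₁)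
    ((memLp_congr_ae e2).1 ψ.memLp₂) ((ψ.wd₁ h).congr_ae e0 ?_) ((ψ.wd₂ h).congr_ae e0 ?_),
    e0, e1, e2, nice_indicator hS ψ.memLp, nice_indicator hS ψ.memLp₁, nice_indicator hS ψ.memLp₂⟩
  · filter_upwards [e0, e1] with p h0 h1
    rw [← h0, ← h1]
  · filter_upwards [e0, e2] with p h0 h1
    rw [← h0, ← h1]

/-! ### Parallel transport. -/

/-- The pairing `F q · p`. -/
def Fdot (q p : ℝ × ℝ) : ℝ := F₁ q * p.1 + F₂ q * p.2

/-- F(q) is perpendicular to q, so the transport phase is constant along the displacement and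
transports along multiples of one q compose without extra phase. -/
lemma Fdot_self (q : ℝ × ℝ) : Fdot q q = 0 := by unfold Fdot F₁ F₂; ring

lemma Fdot_sub_smul (q p : ℝ × ℝ) (t : ℝ) : Fdot q (p - t • q) = Fdot q p := by
  unfold Fdot F₁ F₂; simp; ring

lemma Fdot_add_self (q p : ℝ × ℝ) : Fdot q (p + q) = Fdot q p := by
  unfold Fdot F₁ F₂; simp; ring

lemma contDiff_Fdot (q : ℝ × ℝ) : ContDiff ℝ ∞ (Fdot q) := by unfold Fdot; fun_prop

lemma hasFDerivAt_Fdot (q p : ℝ × ℝ) : HasFDerivAt (Fdot q)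
    (F₁ q • ContinuousLinearMap.fst ℝ ℝ ℝ + F₂ q • ContinuousLinearMap.snd ℝ ℝ ℝ) p :=
  ((hasFDerivAt_fst (𝕜 := ℝ) (p := p)).const_mul (F₁ q)).add
    ((hasFDerivAt_snd (𝕜 := ℝ) (p := p)).const_mul (F₂ q))

/-- The phase `exp (-i F(q) · p)`. -/
def phase (q p : ℝ × ℝ) : ℂ := Complex.exp ((-Fdot q p : ℝ) * Complex.I)

lemma norm_phase (q p : ℝ × ℝ) : ‖phase q p‖ = 1 := Complex.norm_exp_ofReal_mul_I _

lemma contDiff_phase (q : ℝ × ℝ) : ContDiff ℝ ∞ (phase q) :=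
  ((Complex.ofRealCLM.contDiff.comp (contDiff_Fdot q).neg).mul contDiff_const).cexp

lemma fderiv_phase (q p v : ℝ × ℝ) :
    fderiv ℝ (phase q) p v = -Complex.I * ((F₁ q * v.1 + F₂ q * v.2 : ℝ) : ℂ) * phase q p := by
  have h1 := ((Complex.ofRealCLM.hasFDerivAt.comp p (hasFDerivAt_Fdot q p).neg).mul_const Complex.I).cexp
  have h2 : fderiv ℝ (phase q) p = _ := h1.fderiv
  rw [h2]
  simp [phase]
  ring

/-- Parallel transport along `q`. -/
def tr (q : ℝ × ℝ) (f : ℝ × ℝ → ℂ) (p : ℝ × ℝ) : ℂ := phase q p * f (p + q)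

lemma norm_tr (q : ℝ × ℝ) (f : ℝ × ℝ → ℂ) (p : ℝ × ℝ) : ‖tr q f p‖ = ‖f (p + q)‖ := by
  rw [tr, norm_mul, norm_phase, one_mul]

lemma memLp_tr {f : ℝ × ℝ → ℂ} (hf : MemLp f 2 volume) (q : ℝ × ℝ) : MemLp (tr q f) 2 volume := by
  have h := hf.comp_measurePreserving (measurePreserving_add_right volume q)
  refine h.congr_norm ((contDiff_phase q).continuous.aestronglyMeasurable.mul h.1) ?_
  exact Filter.Eventually.of_forall fun p => (norm_tr q f p).symm

/-- The sector is a convex cone: displacements by its own elements map it into itself, so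
transported functions never need values from outside. -/
lemma add_mem_sector {β : ℝ} (h0 : 0 < β) (hπ : β < Real.pi) {p q : ℝ × ℝ} (hp : p ∈ sector β)
    (hq : q ∈ sector β) : p + q ∈ sector β := by
  rw [sector_eq h0 hπ] at *
  simp only [Set.mem_ofPred_eq, Prod.fst_add, Prod.snd_add] at *
  constructor <;> linarith [hp.1, hp.2, hq.1, hq.2]

lemma add_smul_mem_sector {β : ℝ} (h0 : 0 < β) (hπ : β < Real.pi) {p q : ℝ × ℝ}
    (hp : p ∈ sector β) (hq : q ∈ sector β) {t : ℝ} (ht : 0 ≤ t) : p + t • q ∈ sector β := by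
  rw [sector_eq h0 hπ] at *
  simp only [Set.mem_ofPred_eq, Prod.fst_add, Prod.snd_add, Prod.smul_fst, Prod.smul_snd,
    smul_eq_mul] at *
  have h1 := mul_nonneg ht hq.1.le
  have h2 := mul_nonneg ht hq.2.le
  constructor
  · linarith [hp.1]
  · nlinarith [hp.2]

/-- Difference quotients along the magnetic translations are controlled by the energy. -/
lemma integral_tr_sub_le {β : ℝ} (h0 : 0 < β) (hπ : β < Real.pi) (ψ : W β)
    (n0 : Nice (sector β) ψ.toFun) (n1 : Nice (sector β) ψ.grad₁) (n2 : Nice (sector β) ψ.grad₂)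
    {q : ℝ × ℝ} (hq : q ∈ sector β) :
    ∫ p in sector β, ‖tr q ψ.toFun p - ψ.toFun p‖ ^ 2
      ≤ ∫ p in sector β, ‖(q.1 : ℂ) * ψ.grad₁ p + (q.2 : ℂ) * ψ.grad₂ p‖ ^ 2 := by
  set S := sector β with hS
  have oS : IsOpen S := isOpen_sector hπ
  set f := ψ.toFun with hf
  set gq : ℝ × ℝ → ℂ := fun p => (q.1 : ℂ) * ψ.grad₁ p + (q.2 : ℂ) * ψ.grad₂ p with hgq
  have ng : Nice S gq := n1.comb n2 _ _
  have lf := n0.memLp.locallyIntegrable (by norm_num)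
  have lfS : LocallyIntegrableOn f S := lf.locallyIntegrableOn S
  have hw : WD S q f (fun p => gq p + Complex.I * (Fdot q p : ℝ) * f p) := by
    have h := (ψ.wd₁ hπ).comb_dir (ψ.wd₂ hπ) q.1 q.2 lfS
      (locallyIntegrableOn_sub oS continuous_F₁ lfS (locallyIntegrableOn_of_memLp ψ.memLp₁))
      (locallyIntegrableOn_sub oS continuous_F₂ lfS (locallyIntegrableOn_of_memLp ψ.memLp₂))
    have e : q.1 • ((1 : ℝ), (0 : ℝ)) + q.2 • ((0 : ℝ), (1 : ℝ)) = q := by ext <;> simp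
    rw [e] at h
    refine h.congr fun p => ?_
    simp only [hgq, Fdot, F₁, F₂]; push_cast; ring
  rw [← Real.sq_sqrt (integral_nonneg (μ := volume.restrict S) fun p => sq_nonneg ‖gq p‖)]
  refine integral_norm_sq_le_of_test oS (((memLp_tr n0.memLp q).sub n0.memLp).restrict S)
    (Real.sqrt_nonneg _) ?_
  intro Φ hΦ
  -- X t is Φ acted on by the transpose of transport along t q. Letting the test function move means
  -- that only smooth functions are differentiated, and no density of smooth functions in `W β` is
  -- required.
  let X : ℝ → ℝ × ℝ → ℂ := fun t p => Φ (p - t • q) * Complex.exp (t * (-Fdot q p : ℝ) * Complex.I)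
  let G : ℝ × ℝ → ℂ := fun p => -fderiv ℝ Φ p q - Complex.I * (Fdot q p : ℝ) * Φ p
  let X' : ℝ → ℝ × ℝ → ℂ := fun t p => G (p - t • q) * Complex.exp (t * (-Fdot q p : ℝ) * Complex.I)
  have cF : Continuous (Fdot q) := (contDiff_Fdot q).continuous
  have cΦ : Continuous Φ := hΦ.smooth.continuous
  have cdΦ : Continuous (fun p => fderiv ℝ Φ p q) := (hΦ.fderiv_apply q).smooth.continuous
  have cX : ∀ t, Continuous (X t) := fun t => by fun_prop
  have cG : Continuous G := by fun_prop
  have cX' : ∀ t, Continuous (X' t) := fun t => by fun_prop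
  have nexp : ∀ (t : ℝ) p, ‖Complex.exp (t * (-Fdot q p : ℝ) * Complex.I)‖ = 1 := fun t p => by
    rw [← Complex.ofReal_mul]; exact Complex.norm_exp_ofReal_mul_I _
  have suppG : HasCompactSupport G := by
    refine HasCompactSupport.sub (f := fun p => -fderiv ℝ Φ p q) ?_ hΦ.compact.mul_left
    exact (hΦ.fderiv_apply q).compact.comp_left (g := fun z : ℂ => -z) (by simp)
  have hXd : ∀ t p, HasDerivAt (fun t => X t p) (X' t p) t := by
    intro t p
    have h1 : HasDerivAt (fun t : ℝ => p - t • q) (-q) t := by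
      simpa using ((hasDerivAt_id t).smul_const q).const_sub p
    have h2 : HasDerivAt (fun t : ℝ => Φ (p - t • q)) (fderiv ℝ Φ (p - t • q) (-q)) t :=
      ((hΦ.smooth.differentiable (by simp) _).hasFDerivAt).comp_hasDerivAt t h1
    have h3 : HasDerivAt (fun t : ℝ => Complex.exp (t * (-Fdot q p : ℝ) * Complex.I))
        (Complex.exp (t * (-Fdot q p : ℝ) * Complex.I) * (1 * (-Fdot q p : ℝ) * Complex.I)) t :=
      (((Complex.ofRealCLM.hasDerivAt (x := t)).mul_const _).mul_const _).cexp
    refine (h2.fun_mul h3).congr_deriv ?_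
    simp only [X', G, Fdot_sub_smul, map_neg]; push_cast; ring
  -- differentiate the pairing
  have hder : ∀ t, HasDerivAt (fun t => ∫ p, X t p * f p) (∫ p, X' t p * f p) t := by
    intro t₀
    obtain ⟨B, hB⟩ := suppG.exists_bound_of_continuous cG
    obtain ⟨R, hR⟩ := suppG.isCompact.isBounded.subset_closedBall (0 : ℝ × ℝ)
    have hB0 : 0 ≤ B := (norm_nonneg _).trans (hB 0)
    let K := Metric.closedBall (0 : ℝ × ℝ) (R + (|t₀| + 1) * ‖q‖)
    have hK : IsCompact K := isCompact_closedBall _ _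
    have bd : ∀ t ∈ Metric.ball t₀ 1, ∀ p, ‖X' t p * f p‖ ≤ K.indicator (fun p => B * ‖f p‖) p := by
      intro t ht p
      rw [norm_mul]
      simp only [X', norm_mul, nexp, mul_one]
      by_cases hp : p ∈ K
      · rw [Set.indicator_of_mem hp]
        exact mul_le_mul_of_nonneg_right (hB _) (norm_nonneg _)
      · have : G (p - t • q) = 0 := by
          apply image_eq_zero_of_notMem_tsupport
          intro hmem
          apply hp
          have h1 := hR hmem
          rw [mem_closedBall_zero_iff] at h1 ⊢
          have h2 : |t| ≤ |t₀| + 1 := by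
            rw [Metric.mem_ball, Real.dist_eq] at ht
            have := abs_sub_abs_le_abs_sub t t₀
            linarith
          calc ‖p‖ = ‖(p - t • q) + t • q‖ := by simp
            _ ≤ ‖p - t • q‖ + |t| * ‖q‖ := by
                refine (norm_add_le _ _).trans ?_
                rw [norm_smul, Real.norm_eq_abs]
            _ ≤ R + (|t₀| + 1) * ‖q‖ := by gcongr
        rw [this, Set.indicator_of_notMem hp]; simp
    have iX : ∀ t, Integrable (fun p => X t p * f p) := by
      intro t
      have hc : HasCompactSupport (X t) := by
        refine HasCompactSupport.mul_right ?_
        exact hΦ.compact.comp_homeomorph (Homeomorph.subRight (t • q))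
      simpa using lf.integrable_smul_left_of_hasCompactSupport (cX t) hc
    refine (hasDerivAt_integral_of_dominated_loc_of_deriv_le (F := fun t p => X t p * f p)
      (F' := fun t p => X' t p * f p) (bound := K.indicator (fun p => B * ‖f p‖))
      (Metric.ball_mem_nhds t₀ one_pos) ?_ (iX t₀) ?_ ?_ ?_ ?_).2
    · exact Filter.Eventually.of_forall fun t => (iX t).1
    · exact (cX' t₀).aestronglyMeasurable.mul n0.memLp.1
    · exact Filter.Eventually.of_forall fun p t ht => bd t ht p
    · rw [integrable_indicator_iff hK.measurableSet]
      exact ((lf.integrableOn_isCompact hK).norm).const_mul B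
    · exact Filter.Eventually.of_forall fun p t ht => (hXd t p).mul_const _
  -- For t ≥ 0 the support moves by t q and stays inside the sector; this is where the cone property
  -- enters.
  have hT : ∀ t, 0 ≤ t → CTest S (X t) := by
    intro t ht
    refine ⟨?_, ?_, ?_⟩
    · have h1 : ContDiff ℝ ∞ (fun p => Φ (p - t • q)) := hΦ.smooth.comp (contDiff_id.sub contDiff_const)
      exact h1.mul ((contDiff_const.mul
        (Complex.ofRealCLM.contDiff.comp (contDiff_Fdot q).neg)).mul contDiff_const).cexp
    · refine HasCompactSupport.mul_right ?_
      exact hΦ.compact.comp_homeomorph (Homeomorph.subRight (t • q))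
    · have h1 : tsupport (X t) ⊆ tsupport (Φ ∘ (Homeomorph.subRight (t • q))) :=
        closure_mono (Function.support_mul_subset_left _ _)
      rw [tsupport_comp_eq_preimage] at h1
      intro p hp
      have h2 := hΦ.support (h1 hp)
      have h3 := add_smul_mem_sector h0 hπ h2 hq ht
      simpa using h3
  have nX : ∀ t, ∫ p, ‖X t p‖ ^ 2 = ∫ p, ‖Φ p‖ ^ 2 := by
    intro t
    simp only [X, norm_mul, nexp, mul_one]
    exact integral_sub_right_eq_self (fun p => ‖Φ p‖ ^ 2) (t • q)
  -- Transport is generated by q·(∇ + iF). With F(q)·q = 0, the time derivative of the pairing is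
  -- exactly the pairing with the magnetic derivative along q.
  have hderiv : ∀ t, 0 ≤ t → ∫ p, X' t p * f p = ∫ p, X t p * gq p := by
    intro t ht
    have hT' := hT t ht
    have e := hw _ hT'
    have e1 : ∀ p, fderiv ℝ (X t) p q = fderiv ℝ Φ (p - t • q) q *
        Complex.exp (t * (-Fdot q p : ℝ) * Complex.I) := by
      intro p
      have k1 : HasFDerivAt (fun p => Φ (p - t • q)) (fderiv ℝ Φ (p - t • q)) p := by
        exact (hΦ.smooth.differentiable (by simp) (p - t • q)).hasFDerivAt.comp p
          ((hasFDerivAt_id p).sub_const (t • q))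
      have k2 : HasFDerivAt (fun p => Complex.exp (t * (-Fdot q p : ℝ) * Complex.I)) _ p :=
        (((Complex.ofRealCLM.hasFDerivAt.comp p (hasFDerivAt_Fdot q p).neg).const_mul
          (t : ℂ)).mul_const Complex.I).cexp
      have k3 : HasFDerivAt (X t) _ p := k1.fun_mul k2
      rw [k3.fderiv]
      have := Fdot_self q
      unfold Fdot at this
      simp only [add_apply, neg_apply, smul_apply,
        ContinuousLinearMap.comp_apply, ContinuousLinearMap.coe_fst', ContinuousLinearMap.coe_snd',
        smul_eq_mul, this]
      simp
      ring
    have lg : LocallyIntegrableOn gq S :=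
      (ng.memLp.locallyIntegrable (by norm_num)).locallyIntegrableOn S
    have lFf : LocallyIntegrableOn (fun p => Complex.I * (Fdot q p : ℝ) * f p) S := by
      have hc : Continuous (fun p => Complex.I * (Fdot q p : ℂ)) := by fun_prop
      exact lfS.continuousOn_mul hc.continuousOn oS.isLocallyClosed
    have i1 := hT'.integrable_mul lg
    have i2 := hT'.integrable_mul lFf
    have i3 := (hT'.fderiv_apply q).integrable_mul lfS
    simp_rw [mul_add] at e
    rw [integral_add i1 i2] at e
    have e2 : ∀ p, X' t p * f p = -(fderiv ℝ (X t) p q * f p)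
        - X t p * (Complex.I * (Fdot q p : ℝ) * f p) := by
      intro p; rw [e1]; simp only [X', X, G, Fdot_sub_smul]; ring
    simp_rw [e2]
    rw [integral_sub i3.fun_neg i2, integral_neg, ← e]; ring
  have hbound : ∀ t ∈ Set.Ico (0 : ℝ) 1, ‖∫ p, X' t p * f p‖ ≤
      Real.sqrt (∫ p in S, ‖gq p‖ ^ 2) * Real.sqrt (∫ p in S, ‖Φ p‖ ^ 2) := by
    intro t ht
    rw [hderiv t ht.1, mul_comm, ng.setIntegral]
    have hΦS : ∫ p in S, ‖Φ p‖ ^ 2 = ∫ p, ‖Φ p‖ ^ 2 :=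
      setIntegral_eq_integral_of_forall_compl_eq_zero fun p hp => by
        rw [image_eq_zero_of_notMem_tsupport (fun h => hp (hΦ.support h))]; simp
    rw [hΦS, ← nX t]
    have hm : MemLp (X t) 2 volume := by simpa using (hT t ht.1).memLp (V := Set.univ)
    exact norm_integral_mul_le hm ng.memLp
  have main := norm_image_sub_le_of_norm_deriv_le_segment_01'
    (fun t _ => (hder t).hasDerivWithinAt) hbound
  have i0 : Integrable (fun p => Φ p * f p) := hΦ.integrable_mul lfS
  have i1 : Integrable (fun p => Φ p * tr q f p) := hΦ.integrable_mul
    (((memLp_tr n0.memLp q).locallyIntegrable (by norm_num)).locallyIntegrableOn S)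
  have eX1 : ∫ p, X 1 p * f p = ∫ p, Φ p * tr q f p := by
    rw [← integral_add_right_eq_self (fun p => X 1 p * f p) q]
    congr 1; ext p
    simp only [X, tr, phase, Fdot_add_self]
    simp; ring
  have eX0 : ∫ p, X 0 p * f p = ∫ p, Φ p * f p := by simp [X]
  rw [eX1, eX0, ← integral_sub i1 i0] at main
  rw [hΦ.setIntegral_mul]
  simpa only [Pi.sub_apply, mul_sub] using main

lemma integral_comb_le {S : Set (ℝ × ℝ)} {g h : ℝ × ℝ → ℂ} (hg : MemLp g 2 (volume.restrict S))
    (hh : MemLp h 2 (volume.restrict S)) (q : ℝ × ℝ) :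
    ∫ p in S, ‖(q.1 : ℂ) * g p + (q.2 : ℂ) * h p‖ ^ 2
      ≤ (q.1 ^ 2 + q.2 ^ 2) * ∫ p in S, (‖g p‖ ^ 2 + ‖h p‖ ^ 2) := by
  rw [← integral_const_mul]
  apply integral_mono (integrable_norm_sq ((hg.const_mul _).add (hh.const_mul _)))
    (((integrable_norm_sq hg).fun_add (integrable_norm_sq hh)).const_mul _)
  intro p
  have h1 : ‖(q.1 : ℂ) * g p + (q.2 : ℂ) * h p‖ ≤ |q.1| * ‖g p‖ + |q.2| * ‖h p‖ := by
    refine (norm_add_le _ _).trans ?_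
    simp
  have h2 : ‖(q.1 : ℂ) * g p + (q.2 : ℂ) * h p‖ ^ 2 ≤ (|q.1| * ‖g p‖ + |q.2| * ‖h p‖) ^ 2 := by
    gcongr
  refine h2.trans ?_
  have h3 := sq_nonneg (|q.1| * ‖h p‖ - |q.2| * ‖g p‖)
  have e1 := sq_abs q.1
  have e2 := sq_abs q.2
  simp only
  rw [← e1, ← e2]
  nlinarith

/-- The `L²` norm on `S`. -/
def nrm (S : Set (ℝ × ℝ)) (f : ℝ × ℝ → ℂ) : ℝ := Real.sqrt (∫ p in S, ‖f p‖ ^ 2)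

lemma nrm_add_le {S : Set (ℝ × ℝ)} {f g : ℝ × ℝ → ℂ} (hf : MemLp f 2 (volume.restrict S))
    (hg : MemLp g 2 (volume.restrict S)) : nrm S (fun p => f p + g p) ≤ nrm S f + nrm S g := by
  have h := norm_add_le (hf.toLp f) (hg.toLp g)
  rw [← MemLp.toLp_add, norm_toLp_eq_sqrt, norm_toLp_eq_sqrt, norm_toLp_eq_sqrt] at h
  exact h

lemma nrm_const_mul {S : Set (ℝ × ℝ)} (c : ℂ) (f : ℝ × ℝ → ℂ) :
    nrm S (fun p => c * f p) = ‖c‖ * nrm S f := by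
  simp only [nrm, norm_mul, mul_pow, integral_const_mul]
  rw [Real.sqrt_mul (by positivity), Real.sqrt_sq (norm_nonneg _)]

lemma integral_tr_le {β : ℝ} (h0 : 0 < β) (hπ : β < Real.pi) {f : ℝ × ℝ → ℂ}
    (hf : MemLp f 2 volume) {q : ℝ × ℝ} (hq : q ∈ sector β) :
    ∫ p in sector β, ‖tr q f p‖ ^ 2 ≤ ∫ p in sector β, ‖f p‖ ^ 2 := by
  have hS := measurableSet_sector hπ
  have i1 := (integrable_norm_sq hf).indicator hS
  have i2 := (integrable_norm_sq (memLp_tr hf q)).indicator hS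
  rw [← integral_indicator hS, ← integral_indicator hS,
    ← integral_add_right_eq_self ((sector β).indicator fun p => ‖f p‖ ^ 2) q]
  apply integral_mono i2 (i1.comp_add_right q)
  intro p
  by_cases hp : p ∈ sector β
  · simp only [Set.indicator_of_mem hp, Set.indicator_of_mem (add_mem_sector h0 hπ hp hq), norm_tr]
    exact le_rfl
  · rw [Set.indicator_of_notMem hp]
    exact Set.indicator_nonneg (fun p _ => sq_nonneg _) _

/-- The phase is the flux of the unit field through the triangle spanned by q and q'. -/
lemma tr_tr (q q' : ℝ × ℝ) (f : ℝ × ℝ → ℂ) (p : ℝ × ℝ) :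
    tr q (tr q' f) p = Complex.exp ((-Fdot q' q : ℝ) * Complex.I) * tr (q + q') f p := by
  simp only [tr, phase]
  rw [← mul_assoc, ← mul_assoc, ← Complex.exp_add, ← Complex.exp_add, add_assoc]
  congr 2
  simp only [Fdot, F₁, F₂, Prod.fst_add, Prod.snd_add]; push_cast; ring

lemma W.mass_congr {β : ℝ} {ψ χ : W β}
    (h : ψ.toFun =ᵐ[volume.restrict (sector β)] χ.toFun) : ψ.mass = χ.mass := by
  apply integral_congr_ae
  filter_upwards [h] with p hp
  rw [hp]

lemma W.kinetic_congr {β : ℝ} {ψ χ : W β}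
    (h1 : ψ.grad₁ =ᵐ[volume.restrict (sector β)] χ.grad₁)
    (h2 : ψ.grad₂ =ᵐ[volume.restrict (sector β)] χ.grad₂) : ψ.kinetic = χ.kinetic := by
  apply integral_congr_ae
  filter_upwards [h1, h2] with p hp hp'
  rw [hp, hp']

lemma W.kinetic_nonneg {β : ℝ} (ψ : W β) : 0 ≤ ψ.kinetic := integral_nonneg fun p => by positivity

lemma W.mass_nonneg {β : ℝ} (ψ : W β) : 0 ≤ ψ.mass := integral_nonneg fun p => by positivity

/-! ### Positivity of the ground energy. -/

/-- The magnetic Neumann energy controls the mass: a consequence of the non-commutation of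
parallel transports. -/
lemma exists_mass_le_kinetic {β : ℝ} (h0 : 0 < β) (hπ : β < Real.pi) :
    ∃ c, 0 < c ∧ ∀ ψ : W β, c * ψ.mass ≤ ψ.kinetic := by
  have hsin : 0 < Real.sin β := Real.sin_pos_of_pos_of_lt_pi h0 hπ
  set k := Real.cos β / Real.sin β with hk
  have hks : k * Real.sin β = Real.cos β := by rw [hk]; field_simp
  -- At height one the sector is x < -cot β. The vectors q and q' are two non-collinear choices,
  -- spanning a triangle of area 1/2, so the flux phase differs from 1.
  let q : ℝ × ℝ := (-k - 1, 1)
  let q' : ℝ × ℝ := (-k - 2, 1)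
  have hq : q ∈ sector β := by
    rw [sector_eq h0 hπ]; simp only [Set.mem_ofPred_eq, q]; constructor
    · norm_num
    · nlinarith
  have hq' : q' ∈ sector β := by
    rw [sector_eq h0 hπ]; simp only [Set.mem_ofPred_eq, q']; constructor
    · norm_num
    · nlinarith
  have hqq : q + q' ∈ sector β := add_mem_sector h0 hπ hq hq'
  have hγ : Fdot q' q = -1 / 2 := by simp only [Fdot, F₁, F₂, q, q']; ring
  let D : ℂ := Complex.exp ((1 / 2 : ℝ) * Complex.I) - 1
  have hD : 0 < ‖D‖ := by
    rw [norm_pos_iff]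
    intro h
    have h1 := congrArg Complex.im h
    simp only [D, Complex.sub_im, Complex.exp_ofReal_mul_I_im, Complex.one_im, sub_zero,
      Complex.zero_im] at h1
    have := Real.sin_pos_of_pos_of_lt_pi (x := 1 / 2) (by norm_num)
      (by linarith [Real.pi_gt_three])
    linarith
  let ℓ : ℝ × ℝ → ℝ := fun q => Real.sqrt (q.1 ^ 2 + q.2 ^ 2)
  let A := ℓ q' + ℓ q + ℓ (q + q') + ‖D‖ * ℓ (q + q')
  have hA : 0 ≤ A := by positivity
  refine ⟨(‖D‖ / (A + 1)) ^ 2, by positivity, fun ψ' => ?_⟩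
  obtain ⟨ψ, e0, e1, e2, n0, n1, n2⟩ := ψ'.exists_nice hπ
  rw [W.mass_congr e0, W.kinetic_congr e1 e2]
  set S := sector β
  set κ := Real.sqrt ψ.kinetic
  have step : ∀ q ∈ S, nrm S (fun p => tr q ψ.toFun p - ψ.toFun p) ≤ ℓ q * κ := by
    intro q hq
    rw [← Real.sqrt_mul (by positivity)]
    exact Real.sqrt_le_sqrt ((integral_tr_sub_le h0 hπ ψ n0 n1 n2 hq).trans
      (integral_comb_le ψ.memLp₁ ψ.memLp₂ q))
  have mt : ∀ q, MemLp (tr q ψ.toFun) 2 volume := fun q => memLp_tr n0.memLp q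
  have md : ∀ q, MemLp (fun p => tr q ψ.toFun p - ψ.toFun p) 2 volume := fun q =>
    (mt q).sub n0.memLp
  have md' : ∀ q, MemLp (fun p => ψ.toFun p - tr q ψ.toFun p) 2 (volume.restrict S) := fun q =>
    (n0.memLp.sub (mt q)).restrict S
  have a1 : nrm S (tr q (fun p => tr q' ψ.toFun p - ψ.toFun p)) ≤ ℓ q' * κ :=
    (Real.sqrt_le_sqrt (integral_tr_le h0 hπ (md q') hq)).trans (step q' hq')
  have a2 := step q hq
  have a3 := step _ hqq
  have sym : nrm S (fun p => ψ.toFun p - tr (q + q') ψ.toFun p)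
      = nrm S (fun p => tr (q + q') ψ.toFun p - ψ.toFun p) := by
    simp only [nrm, norm_sub_rev]
  -- Writing T for transport, T_q T_q' - T_(q+q') telescopes into T_q(T_q' - 1) + (T_q - 1) + (1 -
  -- T_(q+q')), and the left side is D T_(q+q'). Every term on the right is controlled by the
  -- kinetic energy.
  have b1 : ‖D‖ * nrm S (tr (q + q') ψ.toFun) ≤ (ℓ q' + ℓ q + ℓ (q + q')) * κ := by
    rw [← nrm_const_mul]
    have e : (fun p => D * tr (q + q') ψ.toFun p) = fun p =>
        (tr q (fun p => tr q' ψ.toFun p - ψ.toFun p) p + (tr q ψ.toFun p - ψ.toFun p))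
          + (ψ.toFun p - tr (q + q') ψ.toFun p) := by
      funext p
      have h1 := tr_tr q q' ψ.toFun p
      rw [hγ] at h1
      have h2 : tr q (fun p => tr q' ψ.toFun p - ψ.toFun p) p
          = tr q (tr q' ψ.toFun) p - tr q ψ.toFun p := by
        simp only [tr]; ring
      rw [h2, h1]
      simp only [D]
      have : (-(-1 / 2) : ℝ) = 1 / 2 := by norm_num
      rw [this]; ring
    rw [e]
    have m1 : MemLp (fun p => tr q (fun p => tr q' ψ.toFun p - ψ.toFun p) p
        + (tr q ψ.toFun p - ψ.toFun p)) 2 volume := (memLp_tr (md q') q).add (md q)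
    refine (nrm_add_le (m1.restrict S) (md' _)).trans ?_
    have := nrm_add_le ((memLp_tr (md q') q).restrict S) ((md q).restrict S)
    linarith
  -- Transport only contracts the norm on the sector, so one more displacement estimate is needed to
  -- return from the transported function to ψ.
  have b2 : nrm S ψ.toFun ≤ ℓ (q + q') * κ + nrm S (tr (q + q') ψ.toFun) := by
    have e : ψ.toFun = fun p => (ψ.toFun p - tr (q + q') ψ.toFun p) + tr (q + q') ψ.toFun p := by
      funext p; ring
    conv_lhs => rw [e]
    refine (nrm_add_le (md' _) ((mt _).restrict S)).trans ?_
    linarith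
  have b3 : ‖D‖ * nrm S ψ.toFun ≤ (A + 1) * κ := by
    have h1 := mul_le_mul_of_nonneg_left b2 hD.le
    have h2 : 0 ≤ κ := Real.sqrt_nonneg _
    simp only [A]
    nlinarith
  have hm : ψ.mass = nrm S ψ.toFun ^ 2 := (Real.sq_sqrt ψ.mass_nonneg).symm
  have hκ : ψ.kinetic = κ ^ 2 := (Real.sq_sqrt ψ.kinetic_nonneg).symm
  rw [hm, hκ, ← mul_pow]
  apply pow_le_pow_left₀ (mul_nonneg (by positivity) (Real.sqrt_nonneg _))
  rw [div_mul_eq_mul_div, div_le_iff₀ (by positivity)]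
  change ‖D‖ * nrm S ψ.toFun ≤ κ * (A + 1)
  linarith

/-! ### Averages over short transports. -/

section Average

variable {ν : Measure (ℝ × ℝ)} [IsProbabilityMeasure ν]

lemma enorm_integral_sq_le {f : ℝ × ℝ → ℂ} (hf : AEStronglyMeasurable f ν) :
    ‖∫ q, f q ∂ν‖ₑ ^ 2 ≤ ∫⁻ q, ‖f q‖ₑ ^ 2 ∂ν := by
  have h1 : ‖∫ q, f q ∂ν‖ₑ ≤ eLpNorm f 1 ν := by
    rw [eLpNorm_one_eq_lintegral_enorm]; exact enorm_integral_le_lintegral_enorm f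
  have h2 := h1.trans (eLpNorm_le_eLpNorm_of_exponent_le (p := 1) (q := 2) (by norm_num) hf)
  rw [eLpNorm_eq_lintegral_rpow_enorm_toReal (by norm_num) (by norm_num)] at h2
  simp only [ENNReal.toReal_ofNat, ENNReal.rpow_ofNat] at h2
  calc ‖∫ q, f q ∂ν‖ₑ ^ 2 ≤ ((∫⁻ q, ‖f q‖ₑ ^ 2 ∂ν) ^ (1 / 2 : ℝ)) ^ 2 := by gcongr
    _ = _ := by rw [← ENNReal.rpow_natCast, ← ENNReal.rpow_mul]; norm_num

lemma lintegral_average_le {S P : Set (ℝ × ℝ)} {H : ℝ × ℝ → ℝ × ℝ → ℂ}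
    (hH : StronglyMeasurable (Function.uncurry H)) (hP : ∀ᵐ q ∂ν, q ∈ P) {B : ENNReal}
    (hB : ∀ q ∈ P, ∫⁻ p in S, ‖H p q‖ₑ ^ 2 ≤ B) :
    ∫⁻ p in S, ‖∫ q, H p q ∂ν‖ₑ ^ 2 ≤ B := by
  calc ∫⁻ p in S, ‖∫ q, H p q ∂ν‖ₑ ^ 2 ≤ ∫⁻ p in S, ∫⁻ q, ‖H p q‖ₑ ^ 2 ∂ν := by
        apply lintegral_mono
        intro p
        exact enorm_integral_sq_le (hH.comp_measurable measurable_prodMk_left).aestronglyMeasurable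
    _ = ∫⁻ q, (∫⁻ p in S, ‖H p q‖ₑ ^ 2) ∂ν := by
        apply lintegral_lintegral_swap
        exact (hH.enorm.pow_const 2).aemeasurable
    _ ≤ ∫⁻ q, B ∂ν := by
        apply lintegral_mono_ae
        filter_upwards [hP] with q hq using hB q hq
    _ = B := by simp

lemma memLp_average {S P : Set (ℝ × ℝ)} {H : ℝ × ℝ → ℝ × ℝ → ℂ}
    (hH : StronglyMeasurable (Function.uncurry H)) (hP : ∀ᵐ q ∂ν, q ∈ P) {B : ENNReal}
    (hB : ∀ q ∈ P, ∫⁻ p in S, ‖H p q‖ₑ ^ 2 ≤ B) (hBt : B < ⊤) :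
    MemLp (fun p => ∫ q, H p q ∂ν) 2 (volume.restrict S) :=
  (memLp_two_iff hH.integral_prod_right.aestronglyMeasurable).2
    ((lintegral_average_le hH hP hB).trans_lt hBt)

/-- Fubini applies because ab ≤ a² + b² and `ν` is a probability measure. -/
lemma integral_mul_average {P : Set (ℝ × ℝ)} {H : ℝ × ℝ → ℝ × ℝ → ℂ}
    (hH : StronglyMeasurable (Function.uncurry H)) (hP : ∀ᵐ q ∂ν, q ∈ P) {B : ENNReal}
    (hB : ∀ q ∈ P, ∫⁻ p, ‖H p q‖ₑ ^ 2 ≤ B) (hBt : B < ⊤) {k : ℝ × ℝ → ℂ} (hk : Continuous k)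
    (hkc : HasCompactSupport k) :
    ∫ p, k p * ∫ q, H p q ∂ν = ∫ q, (∫ p, k p * H p q) ∂ν ∧
      Integrable (fun q => ∫ p, k p * H p q) ν := by
  simp_rw [← integral_const_mul]
  suffices hi : Integrable (Function.uncurry fun p q => k p * H p q) (volume.prod ν) from
    ⟨integral_integral_swap hi, hi.integral_prod_right⟩
  have hm : StronglyMeasurable (Function.uncurry fun p q => k p * H p q) :=
    (hk.comp continuous_fst).stronglyMeasurable.mul hH
  have hkL : MemLp k 2 volume := hk.memLp_of_hasCompactSupport hkc
  refine ⟨hm.aestronglyMeasurable, ?_⟩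
  rw [hasFiniteIntegral_iff_enorm, lintegral_prod_symm _ hm.enorm.aemeasurable]
  calc ∫⁻ q, (∫⁻ p, ‖k p * H p q‖ₑ) ∂ν ≤ ∫⁻ q, ((∫⁻ p, ‖k p‖ₑ ^ 2) + B) ∂ν := by
        apply lintegral_mono_ae
        filter_upwards [hP] with q hq
        refine le_trans ?_ (add_le_add_right (hB q hq) _)
        rw [← lintegral_add_left (hk.enorm.measurable.pow_const 2)]
        apply lintegral_mono
        intro p
        beta_reduce
        rw [enorm_mul]
        rcases le_total ‖k p‖ₑ ‖H p q‖ₑ with h | h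
        · calc ‖k p‖ₑ * ‖H p q‖ₑ ≤ ‖H p q‖ₑ * ‖H p q‖ₑ := by gcongr
            _ ≤ ‖k p‖ₑ ^ 2 + ‖H p q‖ₑ ^ 2 := by rw [← sq]; exact le_add_self
        · calc ‖k p‖ₑ * ‖H p q‖ₑ ≤ ‖k p‖ₑ * ‖k p‖ₑ := by gcongr
            _ ≤ ‖k p‖ₑ ^ 2 + ‖H p q‖ₑ ^ 2 := by rw [← sq]; exact le_self_add
    _ < ⊤ := by
        simp only [lintegral_const, measure_univ, mul_one]
        exact ENNReal.add_lt_top.2 ⟨(memLp_two_iff hkL.1).1 hkL, hBt⟩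

end Average

lemma sector_small {β : ℝ} (h0 : 0 < β) (hπ : β < Real.pi) {ε : ℝ} (hε : 0 < ε) :
    ∃ q ∈ sector β, ‖q‖ < ε := by
  have hsin : 0 < Real.sin β := Real.sin_pos_of_pos_of_lt_pi h0 hπ
  set k := Real.cos β / Real.sin β with hk
  have hks : k * Real.sin β = Real.cos β := by rw [hk]; field_simp
  let q : ℝ × ℝ := (-k - 1, 1)
  have hd : 0 < ‖q‖ + 1 := by positivity
  set t := ε / (‖q‖ + 1) with ht
  have t0 : 0 < t := by positivity
  refine ⟨t • q, ?_, ?_⟩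
  · rw [sector_eq h0 hπ]; simp only [Set.mem_ofPred_eq, q, Prod.smul_fst, Prod.smul_snd, smul_eq_mul]
    constructor
    · linarith
    · have e : -Real.sin β * (t * (-k - 1)) + -Real.cos β * (t * 1) = t * Real.sin β := by
        rw [← hks]; ring
      rw [e]; positivity
  · rw [norm_smul, Real.norm_of_nonneg t0.le, ht, div_mul_eq_mul_div, div_lt_iff₀ hd]
    nlinarith [norm_nonneg q]

/-- The uniform probability measure on a small piece of the sector. -/
lemma exists_average_measure {β : ℝ} (h0 : 0 < β) (hπ : β < Real.pi) {ε : ℝ} (hε : 0 < ε) :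
    ∃ (ν : Measure (ℝ × ℝ)) (P : Set (ℝ × ℝ)) (A : ENNReal), IsProbabilityMeasure ν ∧
      MeasurableSet P ∧ volume P < ⊤ ∧ P ⊆ sector β ∧ (∀ q ∈ P, ‖q‖ < ε) ∧ (∀ᵐ q ∂ν, q ∈ P) ∧
      A < ⊤ ∧ ν = A • volume.restrict P := by
  let P := sector β ∩ Metric.ball 0 ε
  have oP : IsOpen P := (isOpen_sector hπ).inter Metric.isOpen_ball
  obtain ⟨q, hq, hqε⟩ := sector_small h0 hπ hε
  have hne : P.Nonempty := ⟨q, hq, by simpa using hqε⟩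
  have hpos : volume P ≠ 0 := (oP.measure_pos volume hne).ne'
  have hfin : volume P < ⊤ := lt_of_le_of_lt (measure_mono Set.inter_subset_right)
    Metric.isBounded_ball.measure_lt_top
  have := cond_isProbabilityMeasure_of_finite hpos hfin.ne
  refine ⟨cond volume P, P, (volume P)⁻¹, this, oP.measurableSet, hfin, Set.inter_subset_left,
    fun q hq => by simpa using hq.2, ae_cond_mem oP.measurableSet, ENNReal.inv_lt_top.2 ?_, rfl⟩
  exact pos_iff_ne_zero.2 hpos

lemma stronglyMeasurable_tr {f : ℝ × ℝ → ℂ} (hf : StronglyMeasurable f) :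
    StronglyMeasurable (Function.uncurry fun p q => tr q f p) := by
  have h1 : Continuous (fun z : (ℝ × ℝ) × (ℝ × ℝ) => phase z.2 z.1) := by
    unfold phase Fdot F₁ F₂; fun_prop
  exact h1.stronglyMeasurable.mul (hf.comp_measurable (measurable_fst.add measurable_snd))

lemma lintegral_enorm_tr (f : ℝ × ℝ → ℂ) (q : ℝ × ℝ) :
    ∫⁻ p, ‖tr q f p‖ₑ ^ 2 = ∫⁻ p, ‖f p‖ₑ ^ 2 := by
  have : ∀ p, ‖tr q f p‖ₑ = ‖f (p + q)‖ₑ := fun p => by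
    rw [← ofReal_norm, norm_tr, ofReal_norm]
  simp_rw [this]
  exact lintegral_add_right_eq_self (fun p => ‖f p‖ₑ ^ 2) q

lemma memLp_tr_slice {ν : Measure (ℝ × ℝ)} {f : ℝ × ℝ → ℂ} (hf : StronglyMeasurable f) (hf2 : MemLp f 2 volume)
    {P : Set (ℝ × ℝ)} {A : ENNReal} (hA : A < ⊤) (hν : ν = A • volume.restrict P) (p : ℝ × ℝ) :
    ∫⁻ q, ‖tr q f p‖ₑ ^ 2 ∂ν ≤ A * ∫⁻ q, ‖f q‖ₑ ^ 2 ∧ MemLp (fun q => tr q f p) 2 ν := by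
  have hm : StronglyMeasurable (fun q => tr q f p) := by
    have h1 : Continuous (fun q : ℝ × ℝ => phase q p) := by
      unfold phase Fdot F₁ F₂; fun_prop
    exact h1.stronglyMeasurable.mul (hf.comp_measurable (measurable_const_add p))
  have hle : ∫⁻ q, ‖tr q f p‖ₑ ^ 2 ∂ν ≤ A * ∫⁻ q, ‖f q‖ₑ ^ 2 := by
    have e : ∀ q, ‖tr q f p‖ₑ = ‖f (p + q)‖ₑ := fun q => by
      rw [← ofReal_norm, norm_tr, ofReal_norm]
    have h1 : ∫⁻ q in P, ‖tr q f p‖ₑ ^ 2 ≤ ∫⁻ q, ‖f (p + q)‖ₑ ^ 2 := by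
      simp_rw [e]
      exact setLIntegral_le_lintegral P _
    have h2 : ∫⁻ q, ‖f (p + q)‖ₑ ^ 2 = ∫⁻ q, ‖f q‖ₑ ^ 2 :=
      lintegral_add_left_eq_self (fun p => ‖f p‖ₑ ^ 2) p
    rw [hν, lintegral_smul_measure, smul_eq_mul]
    exact mul_le_mul_right (h1.trans_eq h2) A
  refine ⟨hle, (memLp_two_iff hm.aestronglyMeasurable).2 (hle.trans_lt ?_)⟩
  exact ENNReal.mul_lt_top hA ((memLp_two_iff hf2.1).1 hf2)

section Average
variable {ν : Measure (ℝ × ℝ)} [IsProbabilityMeasure ν]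

lemma WD.average {S P : Set (ℝ × ℝ)} {v : ℝ × ℝ} {a : ℝ × ℝ → ℝ} (ha : Continuous a)
    {H₀ H₁ : ℝ × ℝ → ℝ × ℝ → ℂ} (h₀ : StronglyMeasurable (Function.uncurry H₀))
    (h₁ : StronglyMeasurable (Function.uncurry H₁)) (hP : ∀ᵐ q ∂ν, q ∈ P) {B : ENNReal}
    (hBt : B < ⊤) (b₀ : ∀ q ∈ P, ∫⁻ p, ‖H₀ p q‖ₑ ^ 2 ≤ B) (b₁ : ∀ q ∈ P, ∫⁻ p, ‖H₁ p q‖ₑ ^ 2 ≤ B)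
    (hw : ∀ q ∈ P, WD S v (fun p => H₀ p q) (fun p => H₁ p q - Complex.I * a p * H₀ p q)) :
    WD S v (fun p => ∫ q, H₀ p q ∂ν)
      (fun p => (∫ q, H₁ p q ∂ν) - Complex.I * a p * ∫ q, H₀ p q ∂ν) := by
  intro Φ hΦ
  have cΦ := hΦ.smooth.continuous
  have m₀ : MemLp (fun p => ∫ q, H₀ p q ∂ν) 2 volume := by
    simpa using memLp_average (S := Set.univ) h₀ hP (by simpa using b₀) hBt
  have m₁ : MemLp (fun p => ∫ q, H₁ p q ∂ν) 2 volume := by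
    simpa using memLp_average (S := Set.univ) h₁ hP (by simpa using b₁) hBt
  have l₀ := (m₀.locallyIntegrable (by norm_num))
  have l₁ := (m₁.locallyIntegrable (by norm_num))
  have ck : Continuous (fun p => Φ p * (Complex.I * a p)) := by fun_prop
  have sk : HasCompactSupport (fun p => Φ p * (Complex.I * a p)) := hΦ.compact.mul_right
  have e1 := integral_mul_average h₁ hP b₁ hBt cΦ hΦ.compact
  have e2 := integral_mul_average h₀ hP b₀ hBt ck sk
  have e3 := integral_mul_average h₀ hP b₀ hBt (hΦ.fderiv_apply v).smooth.continuous
    (hΦ.fderiv_apply v).compact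
  have i1 : Integrable (fun p => Φ p * ∫ q, H₁ p q ∂ν) := by
    simpa using l₁.integrable_smul_left_of_hasCompactSupport cΦ hΦ.compact
  have i2 : Integrable (fun p => Φ p * (Complex.I * a p) * ∫ q, H₀ p q ∂ν) := by
    simpa using l₀.integrable_smul_left_of_hasCompactSupport ck sk
  have e4 : ∀ p, Φ p * ((∫ q, H₁ p q ∂ν) - Complex.I * a p * ∫ q, H₀ p q ∂ν)
      = Φ p * (∫ q, H₁ p q ∂ν) - Φ p * (Complex.I * a p) * ∫ q, H₀ p q ∂ν := fun p => by ring
  simp_rw [e4]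
  rw [integral_sub i1 i2, e1.1, e2.1, e3.1, ← integral_sub e1.2 e2.2, ← integral_neg]
  apply integral_congr_ae
  filter_upwards [hP] with q hq
  have hm : ∀ {H : ℝ × ℝ → ℝ × ℝ → ℂ}, StronglyMeasurable (Function.uncurry H) →
      (∫⁻ p, ‖H p q‖ₑ ^ 2 ≤ B) → LocallyIntegrable (fun p => H p q) := by
    intro H hH hB
    have : MemLp (fun p => H p q) 2 volume :=
      (memLp_two_iff (hH.comp_measurable measurable_prodMk_right).aestronglyMeasurable).2
        (hB.trans_lt hBt)
    exact this.locallyIntegrable (by norm_num)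
  have j1 : Integrable (fun p => Φ p * H₁ p q) := by
    simpa using (hm h₁ (b₁ q hq)).integrable_smul_left_of_hasCompactSupport cΦ hΦ.compact
  have j2 : Integrable (fun p => Φ p * (Complex.I * a p) * H₀ p q) := by
    simpa using (hm h₀ (b₀ q hq)).integrable_smul_left_of_hasCompactSupport ck sk
  rw [← hw q hq Φ hΦ, ← integral_sub j1 j2]
  congr 1; ext p; ring

/-- The gain from averaging: since `ν` has bounded density with respect to Lebesgue measure, an L²
function acquires a bound at every point. -/
lemma enorm_average_sq_le {f : ℝ × ℝ → ℂ} (hf : StronglyMeasurable f) (hf2 : MemLp f 2 volume)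
    {P : Set (ℝ × ℝ)} {A : ENNReal} (hA : A < ⊤) (hν : ν = A • volume.restrict P) (p : ℝ × ℝ) :
    ‖∫ q, tr q f p ∂ν‖ₑ ^ 2 ≤ A * ∫⁻ q, ‖f q‖ₑ ^ 2 :=
  (enorm_integral_sq_le (memLp_tr_slice hf hf2 hA hν p).2.1).trans (memLp_tr_slice hf hf2 hA hν p).1

/-- Jensen reduces this to one transport of length controlled by ε. The factor 2 appears because ‖q‖
is the maximum norm. -/
lemma average_sub_le {β : ℝ} (h0 : 0 < β) (hπ : β < Real.pi) (ψ : W β)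
    (n0 : Nice (sector β) ψ.toFun) (n1 : Nice (sector β) ψ.grad₁) (n2 : Nice (sector β) ψ.grad₂)
    {P : Set (ℝ × ℝ)} {A : ENNReal} (hA : A < ⊤) (hν : ν = A • volume.restrict P)
    (hPS : P ⊆ sector β) {ε : ℝ} (hPε : ∀ q ∈ P, ‖q‖ < ε) (hP : ∀ᵐ q ∂ν, q ∈ P) :
    ∫ p in sector β, ‖(∫ q, tr q ψ.toFun p ∂ν) - ψ.toFun p‖ ^ 2 ≤ 2 * ε ^ 2 * ψ.kinetic := by
  have hH : StronglyMeasurable (Function.uncurry fun p q => tr q ψ.toFun p - ψ.toFun p) :=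
    (stronglyMeasurable_tr n0.meas).sub (n0.meas.comp_measurable measurable_fst)
  have hb : ∀ q ∈ P, ∫⁻ p in sector β, ‖tr q ψ.toFun p - ψ.toFun p‖ₑ ^ 2
      ≤ ENNReal.ofReal (2 * ε ^ 2 * ψ.kinetic) := by
    intro q hq
    have hm : MemLp (fun p => tr q ψ.toFun p - ψ.toFun p) 2 volume :=
      (memLp_tr n0.memLp q).sub n0.memLp
    rw [lintegral_enorm_sq (hm.restrict _)]
    apply ENNReal.ofReal_le_ofReal
    refine (integral_tr_sub_le h0 hπ ψ n0 n1 n2 (hPS hq)).trans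
      ((integral_comb_le ψ.memLp₁ ψ.memLp₂ q).trans ?_)
    apply mul_le_mul_of_nonneg_right _ ψ.kinetic_nonneg
    have h1 := hPε q hq
    have h2 : |q.1| ≤ ‖q‖ := norm_fst_le q
    have h3 : |q.2| ≤ ‖q‖ := norm_snd_le q
    have h4 : q.1 ^ 2 ≤ ε ^ 2 := sq_le_sq' (by linarith [neg_abs_le q.1]) (by linarith [le_abs_self q.1])
    have h5 : q.2 ^ 2 ≤ ε ^ 2 := sq_le_sq' (by linarith [neg_abs_le q.2]) (by linarith [le_abs_self q.2])
    linarith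
  have e : ∀ p, ∫ q, (tr q ψ.toFun p - ψ.toFun p) ∂ν = (∫ q, tr q ψ.toFun p ∂ν) - ψ.toFun p := by
    intro p
    rw [integral_sub ((memLp_tr_slice n0.meas n0.memLp hA hν p).2.integrable (by norm_num))
      (integrable_const _)]
    simp
  have h1 := lintegral_average_le (S := sector β) hH hP hb
  have h2 := memLp_average (S := sector β) hH hP hb ENNReal.ofReal_lt_top
  simp_rw [e] at h1 h2
  rwa [lintegral_enorm_sq h2, ENNReal.ofReal_le_ofReal_iff
    (mul_nonneg (by positivity) ψ.kinetic_nonneg)] at h1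

end Average

/-- Transport does not commute with the magnetic derivative. The defect 2i a(q)ψ comes half from
shifting the potential and half from differentiating the phase, and it is small for small q. -/
lemma tr_wd {β : ℝ} (h0 : 0 < β) (hπ : β < Real.pi) {ψ g : ℝ × ℝ → ℂ} {v q : ℝ × ℝ}
    {a : ℝ × ℝ → ℝ} (ha : Continuous a)
    (hadd : ∀ p, a (p + q) = a p + a q) (hv : F₁ q * v.1 + F₂ q * v.2 = a q)
    (hψ : MemLp ψ 2 volume) (hg : MemLp g 2 volume) (hq : q ∈ sector β)
    (hw : WD (sector β) v ψ (fun p => g p - Complex.I * a p * ψ p)) :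
    WD (sector β) v (tr q ψ)
      (fun p => tr q (fun p => g p - 2 * Complex.I * a q * ψ p) p - Complex.I * a p * tr q ψ p) := by
  have hsub : sector β ⊆ (fun p => (ContinuousLinearEquiv.refl ℝ (ℝ × ℝ)) p + q) ⁻¹' sector β :=
    fun p hp => add_mem_sector h0 hπ hp hq
  have h1 := (WD.comp_affine (ContinuousLinearEquiv.refl ℝ (ℝ × ℝ)) (MeasurePreserving.id volume) q
    (v := v) hw).mono hsub
  simp only [ContinuousLinearEquiv.coe_refl', id_eq] at h1
  have l1 : LocallyIntegrableOn (fun p => ψ (p + q)) (sector β) :=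
    ((hψ.comp_measurePreserving (measurePreserving_add_right volume q)).locallyIntegrable
      (by norm_num)).locallyIntegrableOn _
  have l2 : LocallyIntegrableOn (fun p => g (p + q)) (sector β) :=
    ((hg.comp_measurePreserving (measurePreserving_add_right volume q)).locallyIntegrable
      (by norm_num)).locallyIntegrableOn _
  have h2 := h1.mul_smooth (contDiff_phase q) (V := sector β) Set.inter_subset_right l1
    (locallyIntegrableOn_sub (a := fun p => a (p + q)) (isOpen_sector hπ)
      (ha.comp (continuous_add_const q)) l1 l2)
  refine h2.congr fun p => ?_
  rw [fderiv_phase, hv, hadd]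
  simp only [tr]; push_cast; ring

lemma norm_sub_sq_le {x y : ℂ} {ε : ℝ} (hε : 0 < ε) :
    ‖x - y‖ ^ 2 ≤ (1 + ε) * ‖x‖ ^ 2 + (1 + 1 / ε) * ‖y‖ ^ 2 := by
  have h1 : ‖x - y‖ ^ 2 ≤ (‖x‖ + ‖y‖) ^ 2 := by gcongr; exact norm_sub_le x y
  have h2 : 0 ≤ (ε * ‖x‖ - ‖y‖) ^ 2 / ε := by positivity
  have h3 : (ε * ‖x‖ - ‖y‖) ^ 2 / ε = ε * ‖x‖ ^ 2 - 2 * ‖x‖ * ‖y‖ + 1 / ε * ‖y‖ ^ 2 := by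
    field_simp; ring
  nlinarith

/-! ### Approximation in L⁴ and local compactness. -/

/-- Elements of `W β` can be approximated by elements in `L⁴`. -/
lemma exists_L4_approx {β : ℝ} (h0 : 0 < β) (hπ : β < Real.pi) (ψ' : W β) {ε : ℝ} (hε : 0 < ε) :
    ∃ χ : W β, ∫⁻ p in sector β, ‖χ.toFun p‖ₑ ^ 4 < ⊤ ∧
      χ.kinetic ≤ (1 + ε) * ψ'.kinetic + 2 * (ε ^ 2 + ε) * ψ'.mass ∧
      Real.sqrt ψ'.mass ≤ Real.sqrt χ.mass + Real.sqrt (2 * ε ^ 2 * ψ'.kinetic) := by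
  obtain ⟨ψ, e0, e1, e2, n0, n1, n2⟩ := ψ'.exists_nice hπ
  rw [W.mass_congr e0, W.kinetic_congr e1 e2]
  obtain ⟨ν, P, A, hνp, mP, fP, PS, Pε, aP, hA, hν⟩ := exists_average_measure h0 hπ hε
  set S := sector β
  let H₀ : ℝ × ℝ → ℝ × ℝ → ℂ := fun p q => tr q ψ.toFun p
  let H₁ : ℝ × ℝ → ℝ × ℝ → ℂ := fun p q =>
    tr q (fun p => ψ.grad₁ p - 2 * Complex.I * F₁ q * ψ.toFun p) p
  let H₂ : ℝ × ℝ → ℝ × ℝ → ℂ := fun p q =>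
    tr q (fun p => ψ.grad₂ p - 2 * Complex.I * F₂ q * ψ.toFun p) p
  have s₀ : StronglyMeasurable (Function.uncurry H₀) := stronglyMeasurable_tr n0.meas
  have sH : ∀ {g : ℝ × ℝ → ℂ} {a : ℝ × ℝ → ℝ}, StronglyMeasurable g → Continuous a →
      StronglyMeasurable (Function.uncurry fun p q =>
        tr q (fun p => g p - 2 * Complex.I * a q * ψ.toFun p) p) := by
    intro g a hg ha
    have h1 : Continuous (fun z : (ℝ × ℝ) × (ℝ × ℝ) => 2 * Complex.I * (a z.2 : ℂ)) := by fun_prop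
    have h2 := (stronglyMeasurable_tr hg).sub
      (h1.stronglyMeasurable.mul (stronglyMeasurable_tr n0.meas))
    convert h2 using 1
    ext ⟨p, q⟩
    simp only [Function.uncurry, tr, Pi.sub_apply, Pi.mul_apply]; ring
  have s₁ : StronglyMeasurable (Function.uncurry H₁) := sH n1.meas continuous_F₁
  have s₂ : StronglyMeasurable (Function.uncurry H₂) := sH n2.meas continuous_F₂
  -- The defect has squared size 4 a(q)² ≤ ε², and Young's inequality with parameter ε weights it by
  -- 1 + 1/ε, hence ε² + ε.
  have bound : ∀ {g : ℝ × ℝ → ℂ} {a : ℝ × ℝ → ℝ} {q : ℝ × ℝ}, Nice S g → a q ^ 2 ≤ ε ^ 2 / 4 →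
      ∫⁻ p, ‖tr q (fun p => g p - 2 * Complex.I * a q * ψ.toFun p) p‖ₑ ^ 2
        ≤ ENNReal.ofReal ((1 + ε) * (∫ p in S, ‖g p‖ ^ 2) + (ε ^ 2 + ε) * ψ.mass) := by
    intro g a q ng ha
    have hm : MemLp (fun p => g p - 2 * Complex.I * a q * ψ.toFun p) 2 volume :=
      ng.memLp.sub (n0.memLp.const_mul _)
    rw [lintegral_enorm_tr, lintegral_enorm_sq hm]
    apply ENNReal.ofReal_le_ofReal
    have hM : ψ.mass = ∫ p, ‖ψ.toFun p‖ ^ 2 := n0.setIntegral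
    rw [ng.setIntegral, hM, ← integral_const_mul, ← integral_const_mul,
      ← integral_add ((integrable_norm_sq ng.memLp).const_mul _)
        ((integrable_norm_sq n0.memLp).const_mul _)]
    apply integral_mono (integrable_norm_sq hm) (((integrable_norm_sq ng.memLp).const_mul _).fun_add
        ((integrable_norm_sq n0.memLp).const_mul _))
    intro p
    refine (norm_sub_sq_le hε).trans ?_
    have e : ‖2 * Complex.I * (a q : ℂ) * ψ.toFun p‖ ^ 2 = 4 * a q ^ 2 * ‖ψ.toFun p‖ ^ 2 := by
      simp only [norm_mul, mul_pow, Complex.norm_I, Complex.norm_real, Real.norm_eq_abs, sq_abs]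
      norm_num
    rw [e]
    have h1 : (1 + 1 / ε) * (4 * a q ^ 2) ≤ ε ^ 2 + ε := by
      calc (1 + 1 / ε) * (4 * a q ^ 2) ≤ (1 + 1 / ε) * (4 * (ε ^ 2 / 4)) := by gcongr
        _ = ε ^ 2 + ε := by field_simp
    nlinarith [mul_le_mul_of_nonneg_right h1 (sq_nonneg ‖ψ.toFun p‖)]
  have absq : ∀ q ∈ P, q.1 ^ 2 ≤ ε ^ 2 ∧ q.2 ^ 2 ≤ ε ^ 2 := by
    intro q hq
    have h1 := Pε q hq
    have h2 : |q.1| ≤ ‖q‖ := norm_fst_le q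
    have h3 : |q.2| ≤ ‖q‖ := norm_snd_le q
    exact ⟨sq_le_sq' (by linarith [neg_abs_le q.1]) (by linarith [le_abs_self q.1]),
      sq_le_sq' (by linarith [neg_abs_le q.2]) (by linarith [le_abs_self q.2])⟩
  have b₀ : ∀ q ∈ P, ∫⁻ p, ‖H₀ p q‖ₑ ^ 2 ≤ ENNReal.ofReal ψ.mass := by
    intro q _
    have hM : ψ.mass = ∫ p, ‖ψ.toFun p‖ ^ 2 := n0.setIntegral
    rw [lintegral_enorm_tr, hM, lintegral_enorm_sq n0.memLp]
  have b₁ : ∀ q ∈ P, ∫⁻ p, ‖H₁ p q‖ₑ ^ 2 ≤ ENNReal.ofReal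
      ((1 + ε) * (∫ p in S, ‖ψ.grad₁ p‖ ^ 2) + (ε ^ 2 + ε) * ψ.mass) := fun q hq =>
    bound n1 (by have := (absq q hq).2; simp only [F₁]; linarith)
  have b₂ : ∀ q ∈ P, ∫⁻ p, ‖H₂ p q‖ₑ ^ 2 ≤ ENNReal.ofReal
      ((1 + ε) * (∫ p in S, ‖ψ.grad₂ p‖ ^ 2) + (ε ^ 2 + ε) * ψ.mass) := fun q hq =>
    bound n2 (by have := (absq q hq).1; simp only [F₂]; linarith)
  have onS : ∀ {F : ℝ × ℝ → ℝ × ℝ → ℂ} {B : ENNReal}, (∀ q ∈ P, ∫⁻ p, ‖F p q‖ₑ ^ 2 ≤ B) →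
      ∀ q ∈ P, ∫⁻ p in S, ‖F p q‖ₑ ^ 2 ≤ B := fun h q hq =>
    (setLIntegral_le_lintegral _ _).trans (h q hq)
  have m₀ := memLp_average (S := S) s₀ aP (onS b₀) ENNReal.ofReal_lt_top
  have m₁ := memLp_average (S := S) s₁ aP (onS b₁) ENNReal.ofReal_lt_top
  have m₂ := memLp_average (S := S) s₂ aP (onS b₂) ENNReal.ofReal_lt_top
  have w₁ := WD.average (ν := ν) (S := S) (v := (1, 0)) continuous_F₁ s₀ s₁ aP
    (max_lt ENNReal.ofReal_lt_top ENNReal.ofReal_lt_top) (fun q hq => (b₀ q hq).trans (le_max_left _ _))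
    (fun q hq => (b₁ q hq).trans (le_max_right _ _)) (fun q hq =>
      tr_wd h0 hπ continuous_F₁ (fun p => by simp [F₁]; ring) (by simp) n0.memLp n1.memLp (PS hq)
        (ψ.wd₁ hπ))
  have w₂ := WD.average (ν := ν) (S := S) (v := (0, 1)) continuous_F₂ s₀ s₂ aP
    (max_lt ENNReal.ofReal_lt_top ENNReal.ofReal_lt_top) (fun q hq => (b₀ q hq).trans (le_max_left _ _))
    (fun q hq => (b₂ q hq).trans (le_max_right _ _)) (fun q hq =>
      tr_wd h0 hπ continuous_F₂ (fun p => by simp [F₂]; ring) (by simp) n0.memLp n2.memLp (PS hq)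
        (ψ.wd₂ hπ))
  refine ⟨W.mk' hπ _ _ _ m₀ m₁ m₂ w₁ w₂, ?_, ?_, ?_⟩
  -- A function both bounded and in L² lies in L⁴.
  · set c := A * ∫⁻ q, ‖ψ.toFun q‖ₑ ^ 2 with hc
    have hct : c < ⊤ := ENNReal.mul_lt_top hA ((memLp_two_iff n0.memLp.1).1 n0.memLp)
    calc ∫⁻ p in S, ‖∫ q, H₀ p q ∂ν‖ₑ ^ 4 ≤ ∫⁻ p in S, c * ‖∫ q, H₀ p q ∂ν‖ₑ ^ 2 := by
          apply lintegral_mono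
          intro p
          have h4 : ‖∫ q, H₀ p q ∂ν‖ₑ ^ 4 = ‖∫ q, H₀ p q ∂ν‖ₑ ^ 2 * ‖∫ q, H₀ p q ∂ν‖ₑ ^ 2 := by ring
          beta_reduce
          rw [h4]
          gcongr
          exact enorm_average_sq_le n0.meas n0.memLp hA hν p
      _ = c * ∫⁻ p in S, ‖∫ q, H₀ p q ∂ν‖ₑ ^ 2 := lintegral_const_mul' _ _ hct.ne
      _ < ⊤ := ENNReal.mul_lt_top hct ((memLp_two_iff m₀.1).1 m₀)
  · have k₁ := lintegral_average_le (S := S) s₁ aP (onS b₁)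
    have k₂ := lintegral_average_le (S := S) s₂ aP (onS b₂)
    have nn : ∀ g : ℝ × ℝ → ℂ, 0 ≤ (1 + ε) * (∫ p in S, ‖g p‖ ^ 2) + (ε ^ 2 + ε) * ψ.mass :=
      fun g => add_nonneg (mul_nonneg (by positivity) (integral_nonneg fun p => by positivity))
        (mul_nonneg (by positivity) ψ.mass_nonneg)
    rw [lintegral_enorm_sq m₁, ENNReal.ofReal_le_ofReal_iff (nn _)] at k₁
    rw [lintegral_enorm_sq m₂, ENNReal.ofReal_le_ofReal_iff (nn _)] at k₂
    have hK : ψ.kinetic = (∫ p in S, ‖ψ.grad₁ p‖ ^ 2) + ∫ p in S, ‖ψ.grad₂ p‖ ^ 2 :=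
      integral_add (integrable_norm_sq ψ.memLp₁) (integrable_norm_sq ψ.memLp₂)
    have hL : (W.mk' hπ _ _ _ m₀ m₁ m₂ w₁ w₂).kinetic = (∫ p in S, ‖∫ q, H₁ p q ∂ν‖ ^ 2)
        + ∫ p in S, ‖∫ q, H₂ p q ∂ν‖ ^ 2 :=
      integral_add (integrable_norm_sq m₁) (integrable_norm_sq m₂)
    rw [hL, hK]
    linarith
  · have h1 := average_sub_le h0 hπ ψ n0 n1 n2 hA hν PS Pε aP
    have md : MemLp (fun p => ψ.toFun p - ∫ q, H₀ p q ∂ν) 2 (volume.restrict S) := ψ.memLp.sub m₀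
    have h2 := nrm_add_le m₀ md
    have e : (fun p => (∫ q, H₀ p q ∂ν) + (ψ.toFun p - ∫ q, H₀ p q ∂ν)) = ψ.toFun := by
      funext p; ring
    rw [e] at h2
    refine h2.trans (add_le_add le_rfl (Real.sqrt_le_sqrt ?_))
    simp_rw [norm_sub_rev (ψ.toFun _)]
    exact h1

/-- At a fixed point the average is a continuous linear functional on L², so weak convergence of
functions becomes pointwise convergence of their averages. -/
lemma average_eq_setIntegral {S P : Set (ℝ × ℝ)} (mP : MeasurableSet P)
    (hP : volume P < ⊤) {ν : Measure (ℝ × ℝ)} {A : ENNReal} (hν : ν = A • volume.restrict P)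
    (p : ℝ × ℝ) : ∃ h : ℝ × ℝ → ℂ, MemLp h 2 (volume.restrict S) ∧
      ∀ f, Nice S f → ∫ q, tr q f p ∂ν = A.toReal * ∫ x in S, h x * f x := by
  have hc : Continuous (fun x : ℝ × ℝ => phase x p) := by unfold phase Fdot F₁ F₂; fun_prop
  let k : ℝ × ℝ → ℂ := P.indicator fun x => phase x p
  have mk : MemLp k 2 volume := by
    refine (memLp_indicator_const 2 mP (1 : ℂ) (Or.inr hP.ne)).congr_norm
      (hc.aestronglyMeasurable.indicator mP) (Filter.Eventually.of_forall fun x => ?_)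
    by_cases hx : x ∈ P
    · simp [k, hx, norm_phase]
    · simp [k, hx]
  refine ⟨fun x => k (x - p), (mk.comp_measurePreserving
    (measurePreserving_sub_right volume p)).restrict S, fun f hf => ?_⟩
  have h1 : ∫ x in S, k (x - p) * f x = ∫ x, k (x - p) * f x :=
    setIntegral_eq_integral_of_forall_compl_eq_zero fun x hx => by rw [hf.zero x hx, mul_zero]
  have h2 : ∫ x, k (x - p) * f x = ∫ q, k q * f (p + q) := by
    rw [← integral_add_left_eq_self (fun x => k (x - p) * f x) p]
    simp
  have h3 : ∫ q, k q * f (p + q) = ∫ q in P, tr q f p := by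
    rw [← integral_indicator mP]
    congr 1; ext q
    by_cases hq : q ∈ P
    · simp [k, hq, tr]
    · simp [k, hq]
  rw [h1, h2, h3, hν, integral_smul_measure]
  simp

lemma W.wmass_congr {β : ℝ} {ψ χ : W β}
    (h : ψ.toFun =ᵐ[volume.restrict (sector β)] χ.toFun) : ψ.wmass = χ.wmass := by
  apply integral_congr_ae
  filter_upwards [h] with p hp
  rw [hp]

lemma W.wmass_nonneg {β : ℝ} (ψ : W β) : 0 ≤ ψ.wmass :=
  integral_nonneg fun p => mul_nonneg (wt_pos p).le (sq_nonneg _)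

/-- Local compactness of the embedding: bounded sequences in `W β` which tend weakly to zero
tend to zero in the weighted norm. -/
lemma tendsto_wmass {β : ℝ} (h0 : 0 < β) (hπ : β < Real.pi) {r : ℕ → W β} {B : ℝ} (hB : 0 ≤ B)
    (hm : ∀ n, (r n).mass ≤ B) (hk : ∀ n, (r n).kinetic ≤ B)
    (hw : ∀ h, MemLp h 2 (volume.restrict (sector β)) →
      Filter.Tendsto (fun n => ∫ p in sector β, h p * (r n).toFun p) Filter.atTop (nhds 0)) :
    Filter.Tendsto (fun n => (r n).wmass) Filter.atTop (nhds 0) := by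
  choose s e0 e1 e2 n0 n1 n2 using fun n => (r n).exists_nice hπ
  set S := sector β
  have hm' : ∀ n, (s n).mass ≤ B := fun n => by rw [← W.mass_congr (e0 n)]; exact hm n
  have hk' : ∀ n, (s n).kinetic ≤ B := fun n => by
    rw [← W.kinetic_congr (e1 n) (e2 n)]; exact hk n
  have hw' : ∀ h, MemLp h 2 (volume.restrict S) →
      Filter.Tendsto (fun n => ∫ p in S, h p * (s n).toFun p) Filter.atTop (nhds 0) := by
    intro h hh
    refine (hw h hh).congr fun n => integral_congr_ae ?_
    filter_upwards [e0 n] with p hp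
    rw [hp]
  simp_rw [fun n => W.wmass_congr (e0 n)]
  rw [Metric.tendsto_atTop]
  intro δ hδ
  -- Chosen so that 2ηB ≤ δ/2; the added 1 covers B = 0.
  set η := δ / (2 * B + 1) / 2 with hη
  have η0 : 0 < η := by positivity
  have ηB' : 2 * η * B ≤ δ / 2 := by
    have h1 : 2 * η * B = δ * B / (2 * B + 1) := by rw [hη]; field_simp
    rw [h1, div_le_iff₀ (by positivity)]
    nlinarith
  obtain ⟨ν, P, A, hνp, mP, fP, PS, Pε, aP, hA, hν⟩ := exists_average_measure h0 hπ η0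
  let a : ℕ → ℝ × ℝ → ℂ := fun n p => ∫ q, tr q (s n).toFun p ∂ν
  have ha : ∀ p, Filter.Tendsto (fun n => a n p) Filter.atTop (nhds 0) := by
    intro p
    obtain ⟨h, hh, hf⟩ := average_eq_setIntegral (S := S) mP fP hν p
    have := (hw' h hh).const_mul (A.toReal : ℂ)
    rw [mul_zero] at this
    exact this.congr fun n => (hf _ (n0 n)).symm
  have hmass : ∀ n, ∫⁻ q, ‖(s n).toFun q‖ₑ ^ 2 ≤ ENNReal.ofReal B := by
    intro n
    rw [lintegral_enorm_sq (n0 n).memLp, ← (n0 n).setIntegral]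
    exact ENNReal.ofReal_le_ofReal (hm' n)
  have hab : ∀ n p, ‖a n p‖ ^ 2 ≤ A.toReal * B := by
    intro n p
    have h1 := enorm_average_sq_le (n0 n).meas (n0 n).memLp hA hν p
    have h2 := h1.trans (mul_le_mul_right (hmass n) A)
    rw [← ofReal_norm, ← ENNReal.ofReal_pow (norm_nonneg _), ← ENNReal.ofReal_toReal hA.ne,
      ← ENNReal.ofReal_mul ENNReal.toReal_nonneg,
      ENNReal.ofReal_le_ofReal_iff (mul_nonneg ENNReal.toReal_nonneg hB)] at h2
    exact h2
  have sa : ∀ n, StronglyMeasurable (a n) := fun n =>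
    (stronglyMeasurable_tr (n0 n).meas).integral_prod_right
  have iwt : Integrable (fun p => wt p ^ 2 * (A.toReal * B)) (volume.restrict S) :=
    (integrable_wt_sq.mul_const _).restrict
  have meas_wta : ∀ n, AEStronglyMeasurable (fun p => wt p ^ 2 * ‖a n p‖ ^ 2)
      (volume.restrict S) := fun n =>
    ((continuous_wt.pow 2).stronglyMeasurable.mul ((sa n).norm.pow 2)).aestronglyMeasurable
  have bd_wta : ∀ n, ∀ᵐ p ∂(volume.restrict S),
      ‖wt p ^ 2 * ‖a n p‖ ^ 2‖ ≤ wt p ^ 2 * (A.toReal * B) := fun n =>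
    Filter.Eventually.of_forall fun p => by
      rw [Real.norm_of_nonneg (by positivity)]
      exact mul_le_mul_of_nonneg_left (hab n p) (sq_nonneg _)
  -- The averages tend to zero pointwise and are uniformly bounded, so dominated convergence applies
  -- with a multiple of the integrable function `wt` squared.
  have lim : Filter.Tendsto (fun n => ∫ p in S, wt p ^ 2 * ‖a n p‖ ^ 2) Filter.atTop (nhds 0) := by
    have := tendsto_integral_of_dominated_convergence (F := fun n p => wt p ^ 2 * ‖a n p‖ ^ 2)
      (f := fun _ => (0 : ℝ)) _ meas_wta iwt bd_wta (Filter.Eventually.of_forall fun p => by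
        have := (((ha p).norm.pow 2).const_mul (wt p ^ 2))
        simpa using this)
    simpa using this
  have i3 : ∀ n, Integrable (fun p => wt p ^ 2 * ‖a n p‖ ^ 2) (volume.restrict S) := fun n =>
    iwt.mono' (meas_wta n) (bd_wta n)
  -- The weight itself is not integrable, but wt ≤ η + wt²/(4η). The term η costs ηB through the
  -- mass, and replacing the function by its average costs another ηB.
  have key : ∀ n, (s n).wmass ≤ 2 * η * B + 1 / (2 * η) * ∫ p in S, wt p ^ 2 * ‖a n p‖ ^ 2 := by
    intro n
    have h1 := average_sub_le h0 hπ (s n) (n0 n) (n1 n) (n2 n) hA hν PS Pε aP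
    have h1' : ∫ p in S, ‖a n p - (s n).toFun p‖ ^ 2 ≤ 2 * η ^ 2 * B :=
      h1.trans (mul_le_mul_of_nonneg_left (hk' n) (by positivity))
    have ma : MemLp (a n) 2 (volume.restrict S) := by
      refine memLp_average (S := S) (P := P) (stronglyMeasurable_tr (n0 n).meas) aP
        (B := ENNReal.ofReal B) (fun q _ => ?_) ENNReal.ofReal_lt_top
      refine (setLIntegral_le_lintegral _ _).trans ?_
      rw [lintegral_enorm_tr]; exact hmass n
    have i1 : Integrable (fun p => ‖(s n).toFun p‖ ^ 2) (volume.restrict S) :=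
      integrable_norm_sq (s n).memLp
    have i2 : Integrable (fun p => ‖a n p - (s n).toFun p‖ ^ 2) (volume.restrict S) :=
      integrable_norm_sq (ma.sub (s n).memLp)
    calc (s n).wmass ≤ ∫ p in S, (η * ‖(s n).toFun p‖ ^ 2 + (1 / (2 * η) * ‖a n p - (s n).toFun p‖ ^ 2
          + 1 / (2 * η) * (wt p ^ 2 * ‖a n p‖ ^ 2))) := by
          apply integral_mono (integrable_wt_mul (s n).memLp)
            ((i1.const_mul _).fun_add ((i2.const_mul _).fun_add ((i3 n).const_mul _)))
          intro p
          beta_reduce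
          have w0 := wt_pos p
          have w1 := wt_le_one p
          have t1 : wt p ≤ η + 1 / (4 * η) * wt p ^ 2 := by
            have : η + 1 / (4 * η) * wt p ^ 2 - wt p = (2 * η - wt p) ^ 2 / (4 * η) := by
              field_simp; ring
            have h5 : 0 ≤ (2 * η - wt p) ^ 2 / (4 * η) := by positivity
            linarith
          have t2 : ‖(s n).toFun p‖ ^ 2
              ≤ 2 * ‖a n p - (s n).toFun p‖ ^ 2 + 2 * ‖a n p‖ ^ 2 := by
            have h6 : ‖(s n).toFun p‖ ≤ ‖a n p‖ + ‖a n p - (s n).toFun p‖ := by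
              have := norm_sub_le (a n p) (a n p - (s n).toFun p)
              simpa using this
            nlinarith [norm_nonneg ((s n).toFun p), sq_nonneg (‖a n p‖ - ‖a n p - (s n).toFun p‖)]
          have t3 : wt p ^ 2 * ‖(s n).toFun p‖ ^ 2
              ≤ 2 * ‖a n p - (s n).toFun p‖ ^ 2 + 2 * (wt p ^ 2 * ‖a n p‖ ^ 2) := by
            have h7 : wt p ^ 2 ≤ 1 := by nlinarith
            have h8 := mul_le_mul_of_nonneg_left t2 (sq_nonneg (wt p))
            have h9 := mul_le_mul_of_nonneg_right h7 (sq_nonneg ‖a n p - (s n).toFun p‖)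
            linarith
          have t4 := mul_le_mul_of_nonneg_right t1 (sq_nonneg ‖(s n).toFun p‖)
          have t5 := mul_le_mul_of_nonneg_left t3 (show 0 ≤ 1 / (4 * η) by positivity)
          have e : 1 / (4 * η) * 2 = 1 / (2 * η) := by field_simp; norm_num
          rw [← e]
          linarith
      _ = η * (s n).mass + (1 / (2 * η) * (∫ p in S, ‖a n p - (s n).toFun p‖ ^ 2)
          + 1 / (2 * η) * ∫ p in S, wt p ^ 2 * ‖a n p‖ ^ 2) := by
          rw [integral_add (i1.const_mul _) ((i2.const_mul _).fun_add ((i3 n).const_mul _)),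
            integral_add (i2.const_mul _) ((i3 n).const_mul _), integral_const_mul,
            integral_const_mul, integral_const_mul]
          rfl
      _ ≤ 2 * η * B + 1 / (2 * η) * ∫ p in S, wt p ^ 2 * ‖a n p‖ ^ 2 := by
          have h2 := mul_le_mul_of_nonneg_left (hm' n) η0.le
          have h3 := mul_le_mul_of_nonneg_left h1' (show 0 ≤ 1 / (2 * η) by positivity)
          have e : 1 / (2 * η) * (2 * η ^ 2 * B) = η * B := by field_simp
          linarith
  have lim2 := lim.const_mul (1 / (2 * η))
  rw [mul_zero, Metric.tendsto_atTop] at lim2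
  obtain ⟨N, hN⟩ := lim2 (δ / 2) (by positivity)
  refine ⟨N, fun n hn => ?_⟩
  have h1 := hN n hn
  rw [Real.dist_eq, sub_zero] at h1 ⊢
  rw [abs_of_nonneg (s n).wmass_nonneg]
  linarith [key n, le_abs_self (1 / (2 * η) * ∫ p in S, wt p ^ 2 * ‖a n p‖ ^ 2)]

/-! ### Weak limits and lower semicontinuity. -/

section Weak
variable {α : Type*} [MeasurableSpace α] {μ : Measure α}

/-- Weak sequential compactness of balls in `L²`. -/
lemma exists_weak_limit [MeasureTheory.IsSeparable μ] {f : ℕ → α → ℂ} (hf : ∀ n, MemLp (f n) 2 μ)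
    {B : ℝ} (hB : ∀ n, ∫ x, ‖f n x‖ ^ 2 ∂μ ≤ B) :
    ∃ (φ : ℕ → ℕ) (g : α → ℂ), StrictMono φ ∧ StronglyMeasurable g ∧ MemLp g 2 μ ∧
      ∀ h, MemLp h 2 μ → Filter.Tendsto (fun n => ∫ x, h x * f (φ n) x ∂μ) Filter.atTop
        (nhds (∫ x, h x * g x ∂μ)) := by
  have : Fact ((2 : ENNReal) ≠ ⊤) := ⟨by norm_num⟩
  -- The Riesz isomorphism reduces the claim to sequential Banach–Alaoglu, available because L² is
  -- separable.
  let D := InnerProductSpace.toDual ℂ (Lp ℂ 2 μ)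
  let u : ℕ → WeakDual ℂ (Lp ℂ 2 μ) := fun n => StrongDual.toWeakDual (D ((hf n).toLp (f n)))
  have hu : ∀ n, u n ∈ WeakDual.toStrongDual ⁻¹'
      Metric.closedBall (0 : StrongDual ℂ (Lp ℂ 2 μ)) (Real.sqrt B) := by
    intro n
    rw [Set.mem_preimage, mem_closedBall_zero_iff]
    change ‖D ((hf n).toLp (f n))‖ ≤ _
    rw [LinearIsometryEquiv.norm_map, norm_toLp_eq_sqrt]
    exact Real.sqrt_le_sqrt (hB n)
  obtain ⟨x, -, φ, hφ, hx⟩ := WeakDual.isSeqCompact_closedBall ℂ (Lp ℂ 2 μ) 0 (Real.sqrt B) hu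
  let g := D.symm (WeakDual.toStrongDual x)
  refine ⟨φ, g, hφ, Lp.stronglyMeasurable g, Lp.memLp g, fun h hh => ?_⟩
  have h1 := ((WeakDual.eval_continuous ((memLp_star hh).toLp _)).tendsto x).comp hx
  have h2 : ∀ n, (u n) ((memLp_star hh).toLp _) = star (∫ x, h x * f n x ∂μ) := by
    intro n
    change inner ℂ ((hf n).toLp (f n)) ((memLp_star hh).toLp _) = _
    rw [inner_toLp]
    have := (integral_conj (μ := μ) (f := fun x => h x * f n x))
    rw [← starRingEnd_apply, ← this]
    congr 1; ext x
    simp [mul_comm]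
  have h3 : x ((memLp_star hh).toLp _) = star (∫ x, h x * g x ∂μ) := by
    have e : x = StrongDual.toWeakDual (D g) := by simp [g]
    rw [e]
    change inner ℂ g ((memLp_star hh).toLp _) = _
    rw [← Lp.toLp_coeFn g (Lp.memLp g), inner_toLp, Lp.toLp_coeFn]
    have := (integral_conj (μ := μ) (f := fun x => h x * g x))
    rw [← starRingEnd_apply, ← this]
    congr 1; ext x
    simp [mul_comm]
  have h4 : Filter.Tendsto (fun n => star (∫ x, h x * f (φ n) x ∂μ)) Filter.atTop
      (nhds (star (∫ x, h x * g x ∂μ))) := by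
    rw [← h3]
    exact h1.congr fun n => h2 (φ n)
  have h5 := (continuous_star.tendsto _).comp h4
  simpa [Function.comp_def] using h5

/-- `f n` tends to `g` weakly in `L²`. -/
def WeakTo (μ : Measure α) (f : ℕ → α → ℂ) (g : α → ℂ) : Prop :=
  ∀ h, MemLp h 2 μ → Filter.Tendsto (fun n => ∫ x, h x * f n x ∂μ) Filter.atTop
    (nhds (∫ x, h x * g x ∂μ))

lemma WeakTo.comp {f : ℕ → α → ℂ} {g : α → ℂ} (h : WeakTo μ f g) {φ : ℕ → ℕ} (hφ : StrictMono φ) :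
    WeakTo μ (fun n => f (φ n)) g := fun k hk => (h k hk).comp hφ.tendsto_atTop

lemma integrable_mul_of_memLp {f g : α → ℂ} (hf : MemLp f 2 μ) (hg : MemLp g 2 μ) :
    Integrable (fun x => f x * g x) μ := hf.integrable_mul hg

/-- The difference is written with coefficients 1 and -1 to agree by definition with `W.comb`. -/
lemma WeakTo.tendsto_sub {f : ℕ → α → ℂ} {g : α → ℂ} (h : WeakTo μ f g)
    (hf : ∀ n, MemLp (f n) 2 μ) (hg : MemLp g 2 μ) :
    WeakTo μ (fun n x => 1 * f n x + -1 * g x) (fun _ => 0) := by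
  intro k hk
  have h1 := (h k hk).sub_const (∫ x, k x * g x ∂μ)
  simp only [mul_zero, integral_zero]
  rw [sub_self] at h1
  refine h1.congr fun n => ?_
  rw [← integral_sub (integrable_mul_of_memLp hk (hf n)) (integrable_mul_of_memLp hk hg)]
  congr 1; ext x; ring

lemma norm_sq_expand (a b : ℂ) :
    ‖a‖ ^ 2 = ‖b‖ ^ 2 + ‖1 * a + -1 * b‖ ^ 2 + 2 * (star b * (1 * a + -1 * b)).re := by
  simp only [← Complex.normSq_eq_norm_sq, Complex.normSq_apply]
  simp
  ring

/-- Expanding the square around g leaves a cross term linear in the remainder, which vanishes in the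
limit. No strong convergence is involved. -/
lemma WeakTo.tendsto_norm_sq {f : ℕ → α → ℂ} {g : α → ℂ} (h : WeakTo μ f g)
    (hf : ∀ n, MemLp (f n) 2 μ) (hg : MemLp g 2 μ) :
    Filter.Tendsto (fun n => (∫ x, ‖f n x‖ ^ 2 ∂μ) - ∫ x, ‖1 * f n x + -1 * g x‖ ^ 2 ∂μ)
      Filter.atTop (nhds (∫ x, ‖g x‖ ^ 2 ∂μ)) := by
  have h1 := h.tendsto_sub hf hg _ (memLp_star hg)
  simp only [mul_zero, integral_zero] at h1
  have h2 := (((Complex.continuous_re.tendsto _).comp h1).const_mul 2).const_add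
    (∫ x, ‖g x‖ ^ 2 ∂μ)
  simp only [Complex.zero_re, mul_zero, add_zero] at h2
  refine h2.congr fun n => ?_
  have md : MemLp (fun x => 1 * f n x + -1 * g x) 2 μ := ((hf n).const_mul 1).add (hg.const_mul (-1))
  have i1 := integrable_norm_sq hg
  have i2 := integrable_norm_sq md
  have i3 := integrable_mul_of_memLp (memLp_star hg) md
  have i4 : Integrable (fun x => 2 * (star (g x) * (1 * f n x + -1 * g x)).re) μ :=
    i3.re.const_mul 2
  have e : ∫ x, ‖f n x‖ ^ 2 ∂μ = ∫ x, (‖g x‖ ^ 2 + ‖1 * f n x + -1 * g x‖ ^ 2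
      + 2 * (star (g x) * (1 * f n x + -1 * g x)).re) ∂μ := by
    congr 1; ext x; exact norm_sq_expand _ _
  have er : (∫ x, star (g x) * (1 * f n x + -1 * g x) ∂μ).re
      = ∫ x, (star (g x) * (1 * f n x + -1 * g x)).re ∂μ := (integral_re i3).symm
  rw [e, integral_add (i1.fun_add i2) i4, integral_add i1 i2, integral_const_mul]
  simp only [Function.comp_apply]
  rw [er]
  ring

/-- Convexity of |a|⁴: it lies above its tangent at b. The defect contains the factor (|a|-|b|)². -/
lemma quartic_tangent (a b : ℂ) :
    4 * (((‖b‖ ^ 2 : ℝ) : ℂ) * star b * a).re - 3 * ‖b‖ ^ 4 ≤ ‖a‖ ^ 4 := by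
  have h1 : (star b * a).re ≤ ‖b‖ * ‖a‖ := by
    refine (Complex.re_le_norm _).trans ?_
    rw [norm_mul, norm_star]
  have h2 : (((‖b‖ ^ 2 : ℝ) : ℂ) * star b * a).re = ‖b‖ ^ 2 * (star b * a).re := by
    rw [mul_assoc, Complex.re_ofReal_mul]
  have h3 := mul_le_mul_of_nonneg_left h1 (sq_nonneg ‖b‖)
  have h4 : 0 ≤ (‖a‖ - ‖b‖) ^ 2 * (‖a‖ ^ 2 + 2 * ‖a‖ * ‖b‖ + 3 * ‖b‖ ^ 2) := by positivity
  rw [h2]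
  nlinarith

lemma integrable_norm_four {f : α → ℂ} (hf : AEStronglyMeasurable f μ)
    (h : ∫⁻ x, ‖f x‖ₑ ^ 4 ∂μ < ⊤) : Integrable (fun x => ‖f x‖ ^ 4) μ := by
  refine ⟨(hf.norm.pow 4), ?_⟩
  rw [hasFiniteIntegral_iff_enorm]
  refine lt_of_eq_of_lt (lintegral_congr fun x => ?_) h
  simp

lemma lintegral_enorm_four {f : α → ℂ} (h : Integrable (fun x => ‖f x‖ ^ 4) μ) :
    ∫⁻ x, ‖f x‖ₑ ^ 4 ∂μ = ENNReal.ofReal (∫ x, ‖f x‖ ^ 4 ∂μ) := by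
  rw [ofReal_integral_eq_lintegral_ofReal h (Filter.Eventually.of_forall fun x => by positivity)]
  refine lintegral_congr fun x => ?_
  rw [ENNReal.ofReal_pow (norm_nonneg _), ofReal_norm]

/-- Weak lower semicontinuity of the `L⁴` norm. -/
lemma WeakTo.lintegral_four_le {f : ℕ → α → ℂ} {g : α → ℂ} (h : WeakTo μ f g)
    (hf : ∀ n, MemLp (f n) 2 μ) (hg : MemLp g 2 μ) (mg : StronglyMeasurable g) {c : ℕ → ℝ} {C : ℝ}
    (hc : ∀ n, ∫⁻ x, ‖f n x‖ₑ ^ 4 ∂μ ≤ ENNReal.ofReal (c n)) (c0 : ∀ n, 0 ≤ c n)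
    (hC : Filter.Tendsto c Filter.atTop (nhds C)) :
    ∫⁻ x, ‖g x‖ₑ ^ 4 ∂μ ≤ ENNReal.ofReal C := by
  -- The natural test function |g|² times the conjugate of g need not be in L² yet. On the set |g| ≤
  -- m it is, and the tangent inequality passes to the limit there, leaving 4 - 3 = 1 copies of the
  -- quartic integral; then m tends to infinity.
  let T : ℕ → Set α := fun m => {x | ‖g x‖ ≤ m}
  have mT : ∀ m, MeasurableSet (T m) := fun m =>
    measurableSet_le mg.norm.measurable measurable_const
  have iT : ∀ m, IntegrableOn (fun x => ‖g x‖ ^ 4) (T m) μ := by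
    intro m
    refine Integrable.mono' (((integrable_norm_sq hg).const_mul ((m : ℝ) ^ 2)).integrableOn)
      (mg.norm.pow 4).aestronglyMeasurable ?_
    rw [ae_restrict_iff' (mT m)]
    refine Filter.Eventually.of_forall fun x hx => ?_
    rw [Real.norm_of_nonneg (by positivity)]
    have h1 : ‖g x‖ ≤ m := hx
    have h2 : ‖g x‖ ^ 2 ≤ (m : ℝ) ^ 2 := by gcongr
    nlinarith [sq_nonneg ‖g x‖]
  have key : ∀ m, ∫ x in T m, ‖g x‖ ^ 4 ∂μ ≤ C := by
    intro m
    let k : α → ℂ := (T m).indicator fun x => ((‖g x‖ ^ 2 : ℝ) : ℂ) * star (g x)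
    have kb : ∀ x, ‖k x‖ ≤ ‖((m : ℝ) ^ 2 : ℝ) * g x‖ := by
      intro x
      by_cases hx : x ∈ T m
      · have h1 : ‖g x‖ ≤ m := hx
        have h2 : ‖g x‖ ^ 2 ≤ (m : ℝ) ^ 2 := by gcongr
        simp only [k, Set.indicator_of_mem hx, norm_mul, norm_star, Complex.norm_real]
        rw [Real.norm_of_nonneg (by positivity), Real.norm_of_nonneg (by positivity)]
        gcongr
      · simp only [k, Set.indicator_of_notMem hx, norm_zero]
        exact norm_nonneg _
    have mk : StronglyMeasurable k :=
      ((Complex.continuous_ofReal.comp_stronglyMeasurable (mg.norm.pow 2)).mul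
        (continuous_star.comp_stronglyMeasurable mg)).indicator (mT m)
    have hk : MemLp k 2 μ := (hg.const_mul (((m : ℝ) ^ 2 : ℝ) : ℂ)).mono mk.aestronglyMeasurable
      (Filter.Eventually.of_forall kb)
    have e0 : ∀ F : α → ℂ, ∫ x, k x * F x ∂μ
        = ∫ x in T m, ((‖g x‖ ^ 2 : ℝ) : ℂ) * star (g x) * F x ∂μ := by
      intro F
      rw [← integral_indicator (mT m)]
      congr 1; ext x
      by_cases hx : x ∈ T m
      · simp [k, hx]
      · simp [k, hx]
    have lim := (((Complex.continuous_re.tendsto _).comp (h k hk)).const_mul 4).sub_const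
      (3 * ∫ x in T m, ‖g x‖ ^ 4 ∂μ)
    have eg : (∫ x, k x * g x ∂μ).re = ∫ x in T m, ‖g x‖ ^ 4 ∂μ := by
      rw [e0]
      have : ∀ x, ((‖g x‖ ^ 2 : ℝ) : ℂ) * star (g x) * g x = ((‖g x‖ ^ 4 : ℝ) : ℂ) := by
        intro x
        rw [mul_assoc, ← starRingEnd_apply, Complex.conj_mul']
        push_cast; ring
      simp_rw [this]
      exact (congrArg Complex.re (integral_ofReal (𝕜 := ℂ) (f := fun x => ‖g x‖ ^ 4))).trans
        (Complex.ofReal_re _)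
    rw [eg] at lim
    have le : ∀ n, 4 * (∫ x, k x * f n x ∂μ).re - 3 * ∫ x in T m, ‖g x‖ ^ 4 ∂μ ≤ c n := by
      intro n
      have i1 := integrable_norm_four (hf n).1 ((hc n).trans_lt ENNReal.ofReal_lt_top)
      have hn := hc n
      rw [lintegral_enorm_four i1, ENNReal.ofReal_le_ofReal_iff (c0 n)] at hn
      have i2 := (integrable_mul_of_memLp hk (hf n))
      have i3 : IntegrableOn (fun x => ((‖g x‖ ^ 2 : ℝ) : ℂ) * star (g x) * f n x) (T m) μ := by
        rw [← integrable_indicator_iff (mT m)]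
        refine i2.congr (Filter.Eventually.of_forall fun x => ?_)
        by_cases hx : x ∈ T m
        · simp [k, hx]
        · simp [k, hx]
      have e1 : (∫ x, k x * f n x ∂μ).re
          = ∫ x in T m, (((‖g x‖ ^ 2 : ℝ) : ℂ) * star (g x) * f n x).re ∂μ := by
        rw [e0]; exact (integral_re i3).symm
      have i4 : IntegrableOn (fun x => 4 * (((‖g x‖ ^ 2 : ℝ) : ℂ) * star (g x) * f n x).re) (T m) μ :=
        i3.re.const_mul 4
      rw [e1, ← integral_const_mul, ← integral_const_mul,
        ← integral_sub i4 ((iT m).const_mul 3)]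
      refine le_trans ?_ ((setIntegral_le_integral i1
        (Filter.Eventually.of_forall fun x => by positivity) (s := T m)).trans hn)
      apply integral_mono (i4.sub ((iT m).const_mul 3)) i1.integrableOn
      intro x
      exact quartic_tangent (f n x) (g x)
    have := le_of_tendsto_of_tendsto' lim hC le
    linarith
  have mono := lintegral_tendsto_of_tendsto_of_monotone (μ := μ)
    (f := fun m => (T m).indicator fun x => ‖g x‖ₑ ^ 4) (F := fun x => ‖g x‖ₑ ^ 4)
    (fun m => ((mg.enorm.pow_const 4).indicator (mT m)).aemeasurable)
    (Filter.Eventually.of_forall fun x i j hij => by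
      apply Set.indicator_le_indicator_of_subset _ (fun _ => zero_le)
      intro y hy
      exact le_trans (show ‖g y‖ ≤ i from hy) (by exact_mod_cast hij))
    (Filter.Eventually.of_forall fun x => by
      obtain ⟨N, hN⟩ := exists_nat_ge ‖g x‖
      refine tendsto_const_nhds.congr' ?_
      filter_upwards [Filter.eventually_ge_atTop N] with m hm
      rw [Set.indicator_of_mem]
      exact le_trans hN (by exact_mod_cast hm))
  refine le_of_tendsto' mono fun m => ?_
  rw [lintegral_indicator (mT m), lintegral_enorm_four (iT m)]
  exact ENNReal.ofReal_le_ofReal (key m)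

end Weak

lemma IsTest.memLp_mul {U : Set (ℝ × ℝ)} {φ : ℝ × ℝ → ℝ} (h : IsTest U φ) {k : ℝ × ℝ → ℂ}
    (hk : Continuous k) {V : Set (ℝ × ℝ)} :
    MemLp (fun p => k p * (φ p : ℂ)) 2 (volume.restrict V) := by
  have hc : Continuous (fun p => k p * (φ p : ℂ)) :=
    hk.mul (Complex.continuous_ofReal.comp h.smooth.continuous)
  have hs : HasCompactSupport (fun p => k p * (φ p : ℂ)) :=
    (h.compact.comp_left (g := ((↑) : ℝ → ℂ)) Complex.ofReal_zero).mul_left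
  exact (hc.memLp_of_hasCompactSupport hs).restrict V

lemma IsTest.memLp_fderiv {U : Set (ℝ × ℝ)} {φ : ℝ × ℝ → ℝ} (h : IsTest U φ) (v : ℝ × ℝ)
    {V : Set (ℝ × ℝ)} :
    MemLp (fun p => ((fderiv ℝ φ p v : ℝ) : ℂ)) 2 (volume.restrict V) := by
  have hc : Continuous (fun p => ((fderiv ℝ φ p v : ℝ) : ℂ)) :=
    Complex.continuous_ofReal.comp
      ((h.smooth.continuous_fderiv (by simp)).clm_apply continuous_const)
  have hs : HasCompactSupport (fun p => ((fderiv ℝ φ p v : ℝ) : ℂ)) :=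
    (h.compact.fderiv_apply ℝ v).comp_left (g := ((↑) : ℝ → ℂ)) Complex.ofReal_zero
  exact (hc.memLp_of_hasCompactSupport hs).restrict V

/-- Both sides of the defining identity are pairings with fixed L² functions: the potential is
unbounded, but the test function has compact support. -/
lemma IsWeakMagDeriv.of_weakTo {U : Set (ℝ × ℝ)} {v : ℝ × ℝ} {a : ℝ × ℝ → ℝ} (ha : Continuous a)
    {ψ d : ℕ → ℝ × ℝ → ℂ} {ψ' d' : ℝ × ℝ → ℂ} (h : ∀ n, IsWeakMagDeriv U v a (ψ n) (d n))
    (h0 : WeakTo (volume.restrict U) ψ ψ') (h1 : WeakTo (volume.restrict U) d d') :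
    IsWeakMagDeriv U v a ψ' d' := by
  intro φ hφ
  have m1 := hφ.memLp_mul (V := U) (continuous_const (y := (1 : ℂ)))
  have m2 : MemLp (fun p => Complex.I * (a p : ℂ) * (φ p : ℂ) - ((fderiv ℝ φ p v : ℝ) : ℂ)) 2
      (volume.restrict U) :=
    (hφ.memLp_mul (k := fun p => Complex.I * (a p : ℂ)) (by fun_prop)).sub (hφ.memLp_fderiv v)
  have l1 := h1 _ m1
  have l2 := h0 _ m2
  simp only [one_mul] at l1
  have e : ∀ f : ℝ × ℝ → ℂ, ∫ p in U, (Complex.I * (a p : ℂ) * (φ p : ℂ)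
      - ((fderiv ℝ φ p v : ℝ) : ℂ)) * f p = ∫ p in U, (-((fderiv ℝ φ p v : ℝ) : ℂ) * f p
        + Complex.I * (a p : ℂ) * (φ p : ℂ) * f p) := by
    intro f; congr 1; ext p; ring
  simp_rw [e] at l2
  exact tendsto_nhds_unique l1 (l2.congr fun n => (h n φ hφ).symm)

/-- Weak sequential compactness of bounded sets of `W β`. -/
lemma W.exists_weak_limit {β : ℝ} {ψ : ℕ → W β} {B : ℝ} (hm : ∀ n, (ψ n).mass ≤ B)
    (hk : ∀ n, (ψ n).kinetic ≤ B) : ∃ (φ : ℕ → ℕ) (χ : W β), StrictMono φ ∧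
      StronglyMeasurable χ.toFun ∧
      WeakTo (volume.restrict (sector β)) (fun n => (ψ (φ n)).toFun) χ.toFun ∧
      WeakTo (volume.restrict (sector β)) (fun n => (ψ (φ n)).grad₁) χ.grad₁ ∧
      WeakTo (volume.restrict (sector β)) (fun n => (ψ (φ n)).grad₂) χ.grad₂ := by
  have hK : ∀ n, (ψ n).kinetic = (∫ p in sector β, ‖(ψ n).grad₁ p‖ ^ 2)
      + ∫ p in sector β, ‖(ψ n).grad₂ p‖ ^ 2 := fun n =>
    integral_add (integrable_norm_sq (ψ n).memLp₁) (integrable_norm_sq (ψ n).memLp₂)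
  have nn : ∀ g : ℝ × ℝ → ℂ, 0 ≤ ∫ p in sector β, ‖g p‖ ^ 2 := fun g =>
    integral_nonneg fun p => by positivity
  obtain ⟨φ₀, g₀, s₀, t₀, m₀, l₀⟩ := SectorGL.exists_weak_limit (fun n => (ψ n).memLp) hm
  obtain ⟨φ₁, g₁, s₁, -, m₁, l₁⟩ := SectorGL.exists_weak_limit (fun n => (ψ (φ₀ n)).memLp₁)
    (B := B) fun n => by linarith [hk (φ₀ n), hK (φ₀ n), nn (ψ (φ₀ n)).grad₂]
  obtain ⟨φ₂, g₂, s₂, -, m₂, l₂⟩ := SectorGL.exists_weak_limit (fun n => (ψ (φ₀ (φ₁ n))).memLp₂)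
    (B := B) fun n => by
      linarith [hk (φ₀ (φ₁ n)), hK (φ₀ (φ₁ n)), nn (ψ (φ₀ (φ₁ n))).grad₁]
  have w₀ : WeakTo (volume.restrict (sector β)) (fun n => (ψ (φ₀ (φ₁ (φ₂ n)))).toFun) g₀ :=
    (WeakTo.comp l₀ s₁ : WeakTo _ (fun n => (ψ (φ₀ (φ₁ n))).toFun) g₀).comp s₂
  have w₁ : WeakTo (volume.restrict (sector β)) (fun n => (ψ (φ₀ (φ₁ (φ₂ n)))).grad₁) g₁ :=
    WeakTo.comp (f := fun n => (ψ (φ₀ (φ₁ n))).grad₁) l₁ s₂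
  have w₂ : WeakTo (volume.restrict (sector β)) (fun n => (ψ (φ₀ (φ₁ (φ₂ n)))).grad₂) g₂ := l₂
  exact ⟨fun n => φ₀ (φ₁ (φ₂ n)), ⟨g₀, g₁, g₂, m₀, m₁, m₂,
    IsWeakMagDeriv.of_weakTo continuous_F₁ (fun n => (ψ (φ₀ (φ₁ (φ₂ n)))).weak₁) w₀ w₁,
    IsWeakMagDeriv.of_weakTo continuous_F₂ (fun n => (ψ (φ₀ (φ₁ (φ₂ n)))).weak₂) w₀ w₂⟩,
    s₀.comp (s₁.comp s₂), t₀, w₀, w₁, w₂⟩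

/-! ### The energy as a real number and its negativity. -/

/-- `∫_{S_β} |ψ|⁴`, meaningful if `ψ.InL4`. -/
def W.quartic {β : ℝ} (ψ : W β) : ℝ := ∫ p in sector β, ‖ψ.toFun p‖ ^ 4

/-- `ψ ∈ L⁴(S_β)`. -/
def W.InL4 {β : ℝ} (ψ : W β) : Prop := ∫⁻ p in sector β, ‖ψ.toFun p‖ₑ ^ 4 < ⊤

/-- The energy of `ψ ∈ L⁴(S_β)` as a real number. -/
def W.realEnergy {β : ℝ} (μ : ℝ) (ψ : W β) : ℝ :=
  ψ.kinetic - μ * ψ.mass + μ / 2 * ψ.quartic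

lemma W.quartic_nonneg {β : ℝ} (ψ : W β) : 0 ≤ ψ.quartic := integral_nonneg fun p => by positivity

lemma W.InL4.integrable {β : ℝ} {ψ : W β} (h : ψ.InL4) :
    Integrable (fun p => ‖ψ.toFun p‖ ^ 4) (volume.restrict (sector β)) :=
  integrable_norm_four ψ.memLp.1 h

lemma W.InL4.lintegral {β : ℝ} {ψ : W β} (h : ψ.InL4) :
    ∫⁻ p in sector β, ‖ψ.toFun p‖ₑ ^ 4 = ENNReal.ofReal ψ.quartic :=
  lintegral_enorm_four h.integrable

lemma W.InL4.energy_eq {β : ℝ} {ψ : W β} (h : ψ.InL4) (μ : ℝ) :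
    ψ.energy μ = (ψ.realEnergy μ : EReal) := by
  rw [W.energy, h.lintegral, EReal.coe_ennreal_ofReal, max_eq_left ψ.quartic_nonneg,
    ← EReal.coe_mul, ← EReal.coe_add, W.realEnergy]

lemma W.inL4_of_energy_lt_top {β μ : ℝ} (hμ : 0 < μ) {ψ : W β} (h : ψ.energy μ < ⊤) : ψ.InL4 := by
  by_contra hn
  have e : ∫⁻ p in sector β, ‖ψ.toFun p‖ₑ ^ 4 = ⊤ := not_lt_top_iff.1 hn
  rw [W.energy, e, EReal.coe_ennreal_top, EReal.coe_mul_top_of_pos (by positivity),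
    EReal.coe_add_top] at h
  exact lt_irrefl _ h

/-- Real multiples. -/
def W.smul {β : ℝ} (hπ : β < Real.pi) (t : ℝ) (ψ : W β) : W β := W.comb hπ t 0 ψ ψ

lemma norm_smul_comb (t : ℝ) (a : ℂ) : ‖(t : ℂ) * a + 0 * a‖ = |t| * ‖a‖ := by
  rw [zero_mul, add_zero, norm_mul, Complex.norm_real, Real.norm_eq_abs]

lemma W.mass_smul {β : ℝ} (hπ : β < Real.pi) (t : ℝ) (ψ : W β) :
    (W.smul hπ t ψ).mass = t ^ 2 * ψ.mass := by
  unfold W.mass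
  rw [← integral_const_mul]
  congr 1; ext p
  change ‖(t : ℂ) * ψ.toFun p + 0 * ψ.toFun p‖ ^ 2 = _
  rw [norm_smul_comb, mul_pow, sq_abs]

lemma W.kinetic_smul {β : ℝ} (hπ : β < Real.pi) (t : ℝ) (ψ : W β) :
    (W.smul hπ t ψ).kinetic = t ^ 2 * ψ.kinetic := by
  unfold W.kinetic
  rw [← integral_const_mul]
  congr 1; ext p
  change ‖(t : ℂ) * ψ.grad₁ p + 0 * ψ.grad₁ p‖ ^ 2 + ‖(t : ℂ) * ψ.grad₂ p + 0 * ψ.grad₂ p‖ ^ 2 = _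
  rw [norm_smul_comb, norm_smul_comb, mul_pow, mul_pow, sq_abs]; ring

lemma W.quartic_smul {β : ℝ} (hπ : β < Real.pi) (t : ℝ) (ψ : W β) :
    (W.smul hπ t ψ).quartic = t ^ 4 * ψ.quartic := by
  unfold W.quartic
  rw [← integral_const_mul]
  congr 1; ext p
  change ‖(t : ℂ) * ψ.toFun p + 0 * ψ.toFun p‖ ^ 4 = _
  rw [norm_smul_comb, mul_pow, show |t| ^ 4 = (|t| ^ 2) ^ 2 by ring, sq_abs]; ring

lemma W.InL4.smul {β : ℝ} (hπ : β < Real.pi) (t : ℝ) {ψ : W β} (h : ψ.InL4) :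
    (W.smul hπ t ψ).InL4 := by
  have i := h.integrable.const_mul (t ^ 4)
  have e : (fun p => t ^ 4 * ‖ψ.toFun p‖ ^ 4) = fun p => ‖(W.smul hπ t ψ).toFun p‖ ^ 4 := by
    ext p
    change _ = ‖(t : ℂ) * ψ.toFun p + 0 * ψ.toFun p‖ ^ 4
    rw [norm_smul_comb, mul_pow, show |t| ^ 4 = (|t| ^ 2) ^ 2 by ring, sq_abs]; ring
  rw [e] at i
  rw [W.InL4, lintegral_enorm_four i]
  exact ENNReal.ofReal_lt_top

/-- There are normalized functions. -/
lemma exists_mass_one {β : ℝ} (h0 : 0 < β) (hπ : β < Real.pi) : ∃ ψ : W β, ψ.mass = 1 := by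
  obtain ⟨x, hx, -⟩ := sector_small h0 hπ one_pos
  have hS := isOpen_sector hπ
  obtain ⟨f, hfs, hfc, hf, -, hfx⟩ := exists_contDiff_tsupport_subset (n := ⊤) (hS.mem_nhds hx)
  have hf' : ContDiff ℝ ∞ f := hf
  let Φ : ℝ × ℝ → ℂ := fun p => (f p : ℂ)
  have cf : ContDiff ℝ ∞ Φ := Complex.ofRealCLM.contDiff.comp hf'
  have sc : HasCompactSupport Φ := hfc.comp_left (g := ((↑) : ℝ → ℂ)) Complex.ofReal_zero
  have dc : ∀ v, Continuous (fun p => fderiv ℝ Φ p v) := fun v =>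
    (cf.continuous_fderiv (by simp)).clm_apply continuous_const
  have w : ∀ v, WD (sector β) v Φ (fun p => fderiv ℝ Φ p v) := by
    intro v Ψ hΨ
    have cΨ := hΨ.smooth
    have dΨ : Continuous (fun p => fderiv ℝ Ψ p v) :=
      (cΨ.continuous_fderiv (by simp)).clm_apply continuous_const
    have := integral_mul_fderiv_eq_neg_fderiv_mul_of_integrable (μ := (volume : Measure (ℝ × ℝ)))
      (f := Ψ) (g := Φ) (v := v) (𝕜 := ℂ)
      ((dΨ.mul cf.continuous).integrable_of_hasCompactSupport sc.mul_left)
      ((cΨ.continuous.mul (dc v)).integrable_of_hasCompactSupport hΨ.compact.mul_right)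
      ((cΨ.continuous.mul cf.continuous).integrable_of_hasCompactSupport hΨ.compact.mul_right)
      (fun x _ => cΨ.differentiable (by simp) x) (fun x _ => cf.differentiable (by simp) x)
    exact this
  have mk : ∀ {k : ℝ × ℝ → ℂ}, Continuous k → HasCompactSupport k →
      MemLp k 2 (volume.restrict (sector β)) := fun hk hs =>
    (hk.memLp_of_hasCompactSupport hs).restrict _
  have gm : ∀ (v : ℝ × ℝ) {a : ℝ × ℝ → ℝ}, Continuous a →
      MemLp (fun p => fderiv ℝ Φ p v + Complex.I * a p * Φ p) 2 (volume.restrict (sector β)) :=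
    fun v a ha => (mk (dc v) (sc.fderiv_apply ℝ v)).add
      (mk (k := fun p => Complex.I * a p * Φ p) (by have := cf.continuous; fun_prop) sc.mul_left)
  let ψ : W β := W.mk' hπ Φ (fun p => fderiv ℝ Φ p (1, 0) + Complex.I * F₁ p * Φ p)
    (fun p => fderiv ℝ Φ p (0, 1) + Complex.I * F₂ p * Φ p) (mk cf.continuous sc)
    (gm _ continuous_F₁) (gm _ continuous_F₂) ((w _).congr fun p => by ring)
    ((w _).congr fun p => by ring)
  have hpos : 0 < ψ.mass := by
    have c2 : Continuous (fun p => ‖Φ p‖ ^ 2) := cf.continuous.norm.pow 2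
    have e : ψ.mass = ∫ p, ‖Φ p‖ ^ 2 := by
      apply setIntegral_eq_integral_of_forall_compl_eq_zero
      intro p hp
      have : f p = 0 := image_eq_zero_of_notMem_tsupport fun hq => hp (hfs hq)
      change ‖Φ p‖ ^ 2 = 0
      simp [Φ, this]
    rw [e]
    apply c2.integral_pos_of_hasCompactSupport_nonneg_nonzero
      (sc.norm.comp_left (g := fun x => x ^ 2) (by simp)) (fun p => by positivity) (x := x)
    simp [Φ, hfx]
  refine ⟨W.smul hπ (1 / Real.sqrt ψ.mass) ψ, ?_⟩
  rw [W.mass_smul, div_pow, Real.sq_sqrt hpos.le]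
  field_simp

/-- A normalized function must be exhibited, since a real infimum over the empty set is 0. -/
lemma muBeta_pos {β : ℝ} (h0 : 0 < β) (hπ : β < Real.pi) : 0 < muBeta β := by
  obtain ⟨c, hc, h⟩ := exists_mass_le_kinetic h0 hπ
  obtain ⟨ψ, hψ⟩ := exists_mass_one h0 hπ
  refine hc.trans_le (le_csInf ⟨_, ψ, hψ, rfl⟩ ?_)
  rintro q ⟨χ, hχ, rfl⟩
  have := h χ
  rwa [hχ, mul_one] at this

/-- An almost optimal function for μ_β has kinetic energy below μ times its mass, and this survives
L⁴ approximation. For a small multiple the quartic term is of higher order, so the quadratic part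
decides the sign. -/
lemma exists_realEnergy_neg {β : ℝ} (h0 : 0 < β) (hπ : β < Real.pi) {μ : ℝ}
    (hμ : muBeta β < μ) : ∃ ψ : W β, ψ.InL4 ∧ ψ.realEnergy μ < 0 := by
  have hμ0 := (muBeta_pos h0 hπ).trans hμ
  obtain ⟨ψ₀, hψ₀⟩ := exists_mass_one h0 hπ
  obtain ⟨q, ⟨ψ, hm, rfl⟩, hq⟩ := exists_lt_of_csInf_lt (⟨_, ψ₀, hψ₀, rfl⟩ :
    {q : ℝ | ∃ ψ : W β, ψ.mass = 1 ∧ q = ψ.kinetic}.Nonempty) hμ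
  have hK := ψ.kinetic_nonneg
  set K := ψ.kinetic
  set s := Real.sqrt (2 * K)
  have hs : 0 ≤ s := Real.sqrt_nonneg _
  -- T collects the first-order coefficients in ε: K + 4 bounds the kinetic error when ε ≤ 1, and
  -- 2μs the loss of mass. The extra 1 + μ gives ε ≤ 1 and a strict inequality.
  set T := 1 + (K + 4) + 2 * μ * s + μ
  have hT : 0 < T := by positivity
  set ε := (μ - K) / T with hε
  have ε0 : 0 < ε := div_pos (by linarith) hT
  have εT : ε * T = μ - K := by rw [hε]; field_simp
  have ε1 : ε ≤ 1 := by
    rw [hε, div_le_one hT]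
    have : 0 ≤ 2 * μ * s := by positivity
    linarith
  obtain ⟨χ, hχ, hk, hmass⟩ := exists_L4_approx h0 hπ ψ ε0
  rw [hm, Real.sqrt_one] at hmass
  have e1 : Real.sqrt (2 * ε ^ 2 * ψ.kinetic) = ε * s := by
    rw [show 2 * ε ^ 2 * ψ.kinetic = ε ^ 2 * (2 * K) by ring, Real.sqrt_mul (sq_nonneg _),
      Real.sqrt_sq ε0.le]
  rw [e1] at hmass
  have hM : 1 - 2 * (ε * s) ≤ χ.mass := by
    have h1 := Real.sq_sqrt χ.mass_nonneg
    have h2 := Real.sqrt_nonneg χ.mass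
    by_cases h3 : ε * s ≤ 1
    · have h4 := pow_le_pow_left₀ (show 0 ≤ 1 - ε * s by linarith)
        (show 1 - ε * s ≤ Real.sqrt χ.mass by linarith) 2
      nlinarith [sq_nonneg (ε * s)]
    · linarith [χ.mass_nonneg]
  have hlt : χ.kinetic < μ * χ.mass := by
    have h1 : ε ^ 2 ≤ ε := by nlinarith
    have h2 := mul_le_mul_of_nonneg_left hM hμ0.le
    rw [hm] at hk
    have h3 : ε * T = ε + ε * (K + 4) + 2 * μ * (ε * s) + ε * μ := by ring
    have h4 : 0 < ε * μ := by positivity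
    have h5 : (1 + ε) * ψ.kinetic = K + ε * K := by ring
    nlinarith
  set L := χ.quartic
  have hL : 0 ≤ L := χ.quartic_nonneg
  set d := μ * χ.mass - χ.kinetic with hd
  have d0 : 0 < d := by rw [hd]; linarith
  set r := d / (μ * L + 1) with hr
  have r0 : 0 < r := by positivity
  have hrL : r * (μ * L) ≤ d := by
    rw [hr, div_mul_eq_mul_div, div_le_iff₀ (by positivity)]
    nlinarith
  refine ⟨W.smul hπ (Real.sqrt r) χ, W.InL4.smul hπ _ hχ, ?_⟩
  have h4 : Real.sqrt r ^ 4 = r ^ 2 := by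
    rw [show Real.sqrt r ^ 4 = (Real.sqrt r ^ 2) ^ 2 by ring, Real.sq_sqrt r0.le]
  rw [W.realEnergy, W.kinetic_smul, W.mass_smul, W.quartic_smul, Real.sq_sqrt r0.le, h4]
  have : r * χ.kinetic - μ * (r * χ.mass) + μ / 2 * (r ^ 2 * L) = r * (r * (μ * L) / 2 - d) := by
    rw [hd]; ring
  rw [this]
  exact mul_neg_of_pos_of_neg r0 (by linarith)

lemma eSector_neg {β : ℝ} (h0 : 0 < β) (hπ : β < Real.pi) {μ : ℝ} (hμ : muBeta β < μ) :
    eSector β μ < 0 := by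
  obtain ⟨ψ, h4, h⟩ := exists_realEnergy_neg h0 hπ hμ
  refine (iInf_le (fun ψ : W β => ψ.energy μ) ψ).trans_lt ?_
  rw [h4.energy_eq]
  exact_mod_cast h

/-! ### Coercivity and existence of minimizers. -/

/-- Half of the quartic term absorbs the weighted mass by completing a square, at the price of
(C²/μ) ∫ `wt`². The constant D does not depend on μ, which makes the final bound uniform. -/
lemma exists_coercive {β : ℝ} (h0 : 0 < β) (hπ : β < Real.pi) : ∃ D, 0 ≤ D ∧
    ∀ μ, 0 < μ → ∀ ψ : W β, ψ.InL4 →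
      (Theta0 - μ) * ψ.mass + μ / 4 * ψ.quartic ≤ ψ.realEnergy μ + D / μ := by
  obtain ⟨C, hC, h⟩ := exists_hardy h0 hπ
  refine ⟨C ^ 2 * ∫ p in sector β, wt p ^ 2, mul_nonneg (sq_nonneg _)
    (integral_nonneg fun p => sq_nonneg _), fun μ hμ ψ h4 => ?_⟩
  have hw : C * ψ.wmass ≤ μ / 4 * ψ.quartic + C ^ 2 / μ * ∫ p in sector β, wt p ^ 2 := by
    unfold W.wmass W.quartic
    have i1 := integrable_wt_mul ψ.memLp
    have i2 := h4.integrable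
    have i3 : Integrable (fun p => wt p ^ 2) (volume.restrict (sector β)) := integrable_wt_sq.restrict
    rw [← integral_const_mul, ← integral_const_mul, ← integral_const_mul,
      ← integral_add (i2.const_mul _) (i3.const_mul _)]
    apply integral_mono (i1.const_mul _) ((i2.const_mul _).fun_add (i3.const_mul _))
    intro p
    beta_reduce
    set y := ‖ψ.toFun p‖
    have e : μ / 4 * y ^ 4 + C ^ 2 / μ * wt p ^ 2 - C * (wt p * y ^ 2)
        = (μ * y ^ 2 - 2 * C * wt p) ^ 2 / (4 * μ) := by
      field_simp; ring
    have h5 : 0 ≤ (μ * y ^ 2 - 2 * C * wt p) ^ 2 / (4 * μ) := by positivity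
    linarith
  have h1 := h ψ
  have e : C ^ 2 / μ * ∫ p in sector β, wt p ^ 2 = (C ^ 2 * ∫ p in sector β, wt p ^ 2) / μ := by ring
  rw [W.realEnergy, ← e]
  linarith

lemma eSector_ne_bot {β : ℝ} (h0 : 0 < β) (hπ : β < Real.pi) {μ : ℝ} (hμ : 0 < μ)
    (hT : μ ≤ Theta0) : eSector β μ ≠ ⊥ := by
  obtain ⟨D, hD, h⟩ := exists_coercive h0 hπ
  have : ((-(D / μ) : ℝ) : EReal) ≤ eSector β μ := by
    refine le_iInf fun ψ => ?_
    by_cases hψ : ψ.energy μ < ⊤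
    · have h4 := W.inL4_of_energy_lt_top hμ hψ
      rw [h4.energy_eq, EReal.coe_le_coe_iff]
      have h1 := h μ hμ ψ h4
      have h2 : 0 ≤ (Theta0 - μ) * ψ.mass := mul_nonneg (by linarith) ψ.mass_nonneg
      have h3 : 0 ≤ μ / 4 * ψ.quartic := mul_nonneg (by positivity) ψ.quartic_nonneg
      linarith
    · rw [not_lt_top_iff.1 hψ]; exact le_top
  intro hb
  rw [hb] at this
  exact absurd (le_bot_iff.1 this) (EReal.coe_ne_bot _)

lemma norm_comb_sub_sq_le (a b : ℂ) : ‖1 * a + -1 * b‖ ^ 2 ≤ 2 * ‖a‖ ^ 2 + 2 * ‖b‖ ^ 2 := by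
  have h1 : ‖1 * a + -1 * b‖ ≤ ‖a‖ + ‖b‖ := by
    have := norm_sub_le a b
    rwa [one_mul, neg_one_mul, ← sub_eq_add_neg]
  nlinarith [norm_nonneg (1 * a + -1 * b), sq_nonneg (‖a‖ - ‖b‖)]

lemma integral_comb_sub_le {α : Type*} [MeasurableSpace α] {μ : Measure α} {f g : α → ℂ}
    (hf : MemLp f 2 μ) (hg : MemLp g 2 μ) : ∫ x, ‖1 * f x + -1 * g x‖ ^ 2 ∂μ
      ≤ 2 * (∫ x, ‖f x‖ ^ 2 ∂μ) + 2 * ∫ x, ‖g x‖ ^ 2 ∂μ := by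
  have i1 := integrable_norm_sq hf
  have i2 := integrable_norm_sq hg
  rw [← integral_const_mul, ← integral_const_mul, ← integral_add (i1.const_mul _) (i2.const_mul _)]
  exact integral_mono (integrable_norm_sq ((hf.const_mul 1).add (hg.const_mul (-1))))
    ((i1.const_mul _).fun_add (i2.const_mul _)) fun x => norm_comb_sub_sq_le _ _

lemma W.kinetic_eq {β : ℝ} (ψ : W β) : ψ.kinetic = (∫ p in sector β, ‖ψ.grad₁ p‖ ^ 2)
    + ∫ p in sector β, ‖ψ.grad₂ p‖ ^ 2 :=
  integral_add (integrable_norm_sq ψ.memLp₁) (integrable_norm_sq ψ.memLp₂)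

/-- The direct method: coercivity bounds a minimizing sequence because μ < Θ₀, and the weak limit χ
is optimal because the quadratic energy of the remainders cannot be negative in the limit. -/
lemma exists_minimizer {β : ℝ} (h0 : 0 < β) (hπ : β < Real.pi) {μ : ℝ} (hμ : muBeta β < μ)
    (hT : μ < Theta0) : ∃ ψ : W β, ψ.InL4 ∧ ψ.IsMinimizer μ := by
  have hμ0 := (muBeta_pos h0 hπ).trans hμ
  have hδ : 0 < Theta0 - μ := by linarith
  obtain ⟨D, hD, hco⟩ := exists_coercive h0 hπ
  obtain ⟨C, hC, hardy⟩ := exists_hardy h0 hπ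
  set e := (eSector β μ).toReal
  have he : (e : EReal) = eSector β μ := EReal.coe_toReal
    ((eSector_neg h0 hπ hμ).trans EReal.zero_lt_top).ne (eSector_ne_bot h0 hπ hμ0 hT.le)
  have hseq : ∀ n : ℕ, ∃ ψ : W β, ψ.energy μ < ((e + 1 / ((n : ℝ) + 1) : ℝ) : EReal) := by
    intro n
    refine iInf_lt_iff.1 (lt_of_eq_of_lt he.symm ?_)
    rw [EReal.coe_lt_coe_iff]
    have : 0 < 1 / ((n : ℝ) + 1) := by positivity
    linarith
  choose ψ hψ using hseq
  have h4 : ∀ n, (ψ n).InL4 := fun n =>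
    W.inL4_of_energy_lt_top hμ0 ((hψ n).trans (EReal.coe_lt_top _))
  have hre : ∀ n : ℕ, (ψ n).realEnergy μ < e + 1 / ((n : ℝ) + 1) := fun n => by
    have := hψ n
    rwa [(h4 n).energy_eq, EReal.coe_lt_coe_iff] at this
  have hre1 : ∀ n, (ψ n).realEnergy μ < e + 1 := fun n => by
    have h1 : 1 / ((n : ℝ) + 1) ≤ 1 := by
      rw [div_le_one (by positivity)]; linarith [(Nat.cast_nonneg n : (0 : ℝ) ≤ n)]
    linarith [hre n]
  set R := e + 1 + D / μ
  have hM : ∀ n, (ψ n).mass ≤ R / (Theta0 - μ) := fun n => by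
    rw [le_div_iff₀ hδ]
    have h1 := hco μ hμ0 _ (h4 n)
    have h2 : 0 ≤ μ / 4 * (ψ n).quartic := mul_nonneg (by positivity) (ψ n).quartic_nonneg
    linarith [hre1 n]
  have hK : ∀ n, (ψ n).kinetic ≤ e + 1 + μ * (R / (Theta0 - μ)) := fun n => by
    have h1 := hre1 n
    have h2 : 0 ≤ μ / 2 * (ψ n).quartic := mul_nonneg (by positivity) (ψ n).quartic_nonneg
    have h3 := mul_le_mul_of_nonneg_left (hM n) hμ0.le
    rw [W.realEnergy] at h1
    linarith
  set B := max (R / (Theta0 - μ)) (e + 1 + μ * (R / (Theta0 - μ)))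
  have hMB : ∀ n, (ψ n).mass ≤ B := fun n => (hM n).trans (le_max_left _ _)
  have hKB : ∀ n, (ψ n).kinetic ≤ B := fun n => (hK n).trans (le_max_right _ _)
  have hB : 0 ≤ B := (ψ 0).mass_nonneg.trans (hMB 0)
  obtain ⟨φ, χ, hφ, mχ, w₀, w₁, w₂⟩ := W.exists_weak_limit hMB hKB
  let r : ℕ → W β := fun n => W.comb hπ 1 (-1) (ψ (φ n)) χ
  have m0 := χ.mass_nonneg
  have k0 := χ.kinetic_nonneg
  have rm : ∀ n, (r n).mass ≤ 2 * B + 2 * χ.mass + 2 * χ.kinetic := fun n => by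
    have h1 : (r n).mass ≤ 2 * (ψ (φ n)).mass + 2 * χ.mass :=
      integral_comb_sub_le (ψ (φ n)).memLp χ.memLp
    linarith [hMB (φ n)]
  have rk : ∀ n, (r n).kinetic ≤ 2 * B + 2 * χ.mass + 2 * χ.kinetic := fun n => by
    have h1 : (r n).kinetic ≤ 2 * (ψ (φ n)).kinetic + 2 * χ.kinetic := by
      rw [W.kinetic_eq (r n), W.kinetic_eq (ψ (φ n)), W.kinetic_eq χ]
      have h2 := integral_comb_sub_le (ψ (φ n)).memLp₁ χ.memLp₁
      have h3 := integral_comb_sub_le (ψ (φ n)).memLp₂ χ.memLp₂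
      have h4 := add_le_add h2 h3
      refine h4.trans_eq ?_
      ring
    linarith [hKB (φ n)]
  -- With the localization inequality and μ < Θ₀, this shows that kinetic minus μ times mass of the
  -- remainder is bounded below by a quantity tending to zero.
  have rw0 := tendsto_wmass h0 hπ (r := r) (by positivity) rm rk fun k hk => by
    have := w₀.tendsto_sub (fun n => (ψ (φ n)).memLp) χ.memLp k hk
    simp only [mul_zero, integral_zero] at this
    exact this
  have tM : Filter.Tendsto (fun n => (ψ (φ n)).mass - (r n).mass) Filter.atTop (nhds χ.mass) :=
    w₀.tendsto_norm_sq (fun n => (ψ (φ n)).memLp) χ.memLp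
  have tK : Filter.Tendsto (fun n => (ψ (φ n)).kinetic - (r n).kinetic) Filter.atTop
      (nhds χ.kinetic) := by
    have := (w₁.tendsto_norm_sq (fun n => (ψ (φ n)).memLp₁) χ.memLp₁).add
      (w₂.tendsto_norm_sq (fun n => (ψ (φ n)).memLp₂) χ.memLp₂)
    rw [W.kinetic_eq χ]
    refine this.congr fun n => ?_
    rw [W.kinetic_eq (ψ (φ n)), W.kinetic_eq (r n)]
    change _ = _ - ((∫ p in sector β, ‖1 * (ψ (φ n)).grad₁ p + -1 * χ.grad₁ p‖ ^ 2)
      + ∫ p in sector β, ‖1 * (ψ (φ n)).grad₂ p + -1 * χ.grad₂ p‖ ^ 2)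
    ring
  -- An upper bound for the quartic terms with a computable limit. Lower semicontinuity then bounds
  -- the quartic integral of χ by exactly the amount that makes its energy at most e.
  let c : ℕ → ℝ := fun n => 2 / μ * (e + 1 / ((φ n : ℝ) + 1)
    - (((ψ (φ n)).kinetic - (r n).kinetic) - μ * ((ψ (φ n)).mass - (r n).mass) - C * (r n).wmass))
  have tc : Filter.Tendsto c Filter.atTop (nhds (2 / μ * (e - (χ.kinetic - μ * χ.mass)))) := by
    have t1 := (tendsto_one_div_add_atTop_nhds_zero_nat (𝕜 := ℝ)).comp hφ.tendsto_atTop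
    have t2 := ((t1.const_add e).sub ((tK.sub (tM.const_mul μ)).sub (rw0.const_mul C))).const_mul
      (2 / μ)
    rw [add_zero, mul_zero, sub_zero] at t2
    exact t2
  have hcn : ∀ n, (ψ (φ n)).quartic ≤ c n := by
    intro n
    have h1 := hre (φ n)
    have h2 := hardy (r n)
    have h3 : μ * (r n).mass ≤ Theta0 * (r n).mass :=
      mul_le_mul_of_nonneg_right hT.le (r n).mass_nonneg
    rw [W.realEnergy] at h1
    have h5 : μ / 2 * (ψ (φ n)).quartic ≤ e + 1 / ((φ n : ℝ) + 1)
        - (((ψ (φ n)).kinetic - (r n).kinetic) - μ * ((ψ (φ n)).mass - (r n).mass)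
          - C * (r n).wmass) := by linarith
    have h6 := mul_le_mul_of_nonneg_left h5 (show 0 ≤ 2 / μ by positivity)
    have h7 : 2 / μ * (μ / 2 * (ψ (φ n)).quartic) = (ψ (φ n)).quartic := by field_simp
    rwa [h7] at h6
  have c0 : ∀ n, 0 ≤ c n := fun n => (ψ (φ n)).quartic_nonneg.trans (hcn n)
  have l4 := w₀.lintegral_four_le (fun n => (ψ (φ n)).memLp) χ.memLp mχ (c := c)
    (fun n => (h4 (φ n)).lintegral.trans_le (ENNReal.ofReal_le_ofReal (hcn n))) c0 tc
  have hχ : χ.InL4 := l4.trans_lt ENNReal.ofReal_lt_top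
  rw [hχ.lintegral, ENNReal.ofReal_le_ofReal_iff (ge_of_tendsto' tc c0)] at l4
  refine ⟨χ, hχ, le_antisymm ?_ (iInf_le (fun ψ : W β => ψ.energy μ) χ)⟩
  rw [hχ.energy_eq, ← he, EReal.coe_le_coe_iff, W.realEnergy]
  have h6 := mul_le_mul_of_nonneg_left l4 (show 0 ≤ μ / 2 by positivity)
  have h7 : μ / 2 * (2 / μ * (e - (χ.kinetic - μ * χ.mass))) = e - (χ.kinetic - μ * χ.mass) := by
    field_simp
  linarith

lemma W.IsMinimizer.inL4 {β : ℝ} (h0 : 0 < β) (hπ : β < Real.pi) {μ : ℝ} (hμ : muBeta β < μ)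
    {ψ : W β} (h : ψ.IsMinimizer μ) : ψ.InL4 := by
  apply W.inL4_of_energy_lt_top ((muBeta_pos h0 hπ).trans hμ)
  rw [h]
  exact (eSector_neg h0 hπ hμ).trans EReal.zero_lt_top

lemma W.IsMinimizer.realEnergy_eq {β : ℝ} {μ : ℝ} {ψ : W β} (h : ψ.IsMinimizer μ) (h4 : ψ.InL4) :
    ψ.realEnergy μ = (eSector β μ).toReal := by
  rw [← h, h4.energy_eq, EReal.toReal_coe]

lemma W.IsMinimizer.realEnergy_neg {β : ℝ} (h0 : 0 < β) (hπ : β < Real.pi) {μ : ℝ}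
    (hμ : muBeta β < μ) {ψ : W β} (h : ψ.IsMinimizer μ) : ψ.realEnergy μ < 0 := by
  have h1 := eSector_neg h0 hπ hμ
  rw [← h, (h.inL4 h0 hπ hμ).energy_eq] at h1
  exact_mod_cast h1

lemma eSector_le {β : ℝ} {ψ : W β} (h : ψ.InL4) (μ : ℝ) : eSector β μ ≤ (ψ.realEnergy μ : EReal) :=
  (iInf_le (fun ψ : W β => ψ.energy μ) ψ).trans_eq (h.energy_eq μ)

lemma toReal_eSector_le {β : ℝ} (h0 : 0 < β) (hπ : β < Real.pi) {μ : ℝ} (hμ : 0 < μ)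
    (hT : μ ≤ Theta0) {ψ : W β} (h : ψ.InL4) : (eSector β μ).toReal ≤ ψ.realEnergy μ := by
  have := EReal.toReal_le_toReal (eSector_le h μ) (eSector_ne_bot h0 hπ hμ hT) (EReal.coe_ne_top _)
  rwa [EReal.toReal_coe] at this

lemma W.IsMinimizer.nontrivial {β : ℝ} (h0 : 0 < β) (hπ : β < Real.pi) {μ : ℝ}
    (hμ : muBeta β < μ) {ψ : W β} (h : ψ.IsMinimizer μ) : ψ.Nontrivial := by
  intro hz
  have hm : ψ.mass = 0 := by
    unfold W.mass
    rw [← integral_zero (ℝ × ℝ) ℝ (μ := volume.restrict (sector β))]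
    apply integral_congr_ae
    filter_upwards [hz] with p hp
    rw [hp]; simp
  have h1 := h.realEnergy_neg h0 hπ hμ
  have hμ0 := (muBeta_pos h0 hπ).trans hμ
  have h2 : 0 ≤ μ / 2 * ψ.quartic := mul_nonneg (by positivity) ψ.quartic_nonneg
  rw [W.realEnergy, hm] at h1
  linarith [ψ.kinetic_nonneg]

/-! ### Dependence on μ and uniform bounds. -/

/-- A minimizer at the smaller parameter serves as trial function at the larger one. Its energy is
negative and its kinetic part is not, so the slope of its energy in μ, which is half the quartic
integral minus the mass, is strictly negative. -/
lemma strictAntiOn_eSector {β : ℝ} (h0 : 0 < β) (hπ : β < Real.pi) :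
    StrictAntiOn (eSector β) (Set.Ioo (muBeta β) Theta0) := by
  intro μ hμ ν hν hlt
  obtain ⟨ψ, h4, h⟩ := exists_minimizer h0 hπ hμ.1 hμ.2
  refine (eSector_le h4 ν).trans_lt ?_
  rw [← h, h4.energy_eq, EReal.coe_lt_coe_iff]
  have h1 := h.realEnergy_neg h0 hπ hμ.1
  have h2 := ψ.kinetic_nonneg
  have hμ0 := (muBeta_pos h0 hπ).trans hμ.1
  rw [W.realEnergy] at h1 ⊢
  rw [W.realEnergy]
  have h3 : 0 < ψ.mass - ψ.quartic / 2 := by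
    by_contra hn
    have := mul_nonneg hμ0.le (by linarith : 0 ≤ ψ.quartic / 2 - ψ.mass)
    nlinarith
  nlinarith [mul_pos (sub_pos.2 hlt) h3]

/-- An infimum of affine functions is concave. Using the minimizer at the intermediate point as
trial function at both ends keeps the argument among real numbers. -/
lemma concaveOn_eSector {β : ℝ} (h0 : 0 < β) (hπ : β < Real.pi) :
    ConcaveOn ℝ (Set.Ioo (muBeta β) Theta0) (fun μ => (eSector β μ).toReal) := by
  refine ⟨convex_Ioo _ _, fun x hx y hy a b ha hb hab => ?_⟩
  have hz := convex_Ioo (𝕜 := ℝ) (muBeta β) Theta0 hx hy ha hb hab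
  obtain ⟨ψ, h4, h⟩ := exists_minimizer h0 hπ hz.1 hz.2
  have hpos := muBeta_pos h0 hπ
  have h1 := mul_le_mul_of_nonneg_left
    (toReal_eSector_le h0 hπ (hpos.trans hx.1) hx.2.le h4) ha
  have h2 := mul_le_mul_of_nonneg_left
    (toReal_eSector_le h0 hπ (hpos.trans hy.1) hy.2.le h4) hb
  beta_reduce
  rw [← h.realEnergy_eq h4]
  simp only [smul_eq_mul]
  refine (add_le_add h1 h2).trans_eq ?_
  simp only [W.realEnergy]
  have : b = 1 - a := by linarith
  subst this
  ring

lemma W.InL4.lintegral_total {β : ℝ} {ψ : W β} (h : ψ.InL4) :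
    ∫⁻ p in sector β, (‖ψ.grad₁ p‖ₑ ^ 2 + ‖ψ.grad₂ p‖ₑ ^ 2 + ‖ψ.toFun p‖ₑ ^ 2 + ‖ψ.toFun p‖ₑ ^ 4)
      = ENNReal.ofReal (ψ.kinetic + ψ.mass + ψ.quartic) := by
  have k1 := (integrable_norm_sq ψ.memLp₁).fun_add (integrable_norm_sq ψ.memLp₂)
  have i := integrable_norm_sq ψ.memLp
  have e : ψ.kinetic + ψ.mass + ψ.quartic = ∫ p in sector β, (‖ψ.grad₁ p‖ ^ 2 + ‖ψ.grad₂ p‖ ^ 2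
      + ‖ψ.toFun p‖ ^ 2 + ‖ψ.toFun p‖ ^ 4) := by
    rw [integral_add (k1.fun_add i) h.integrable, integral_add k1 i]
    rfl
  rw [e, ofReal_integral_eq_lintegral_ofReal ((k1.fun_add i).fun_add h.integrable)
    (Filter.Eventually.of_forall fun p => by positivity)]
  refine lintegral_congr fun p => ?_
  rw [ENNReal.ofReal_add (by positivity) (by positivity),
    ENNReal.ofReal_add (by positivity) (by positivity),
    ENNReal.ofReal_add (by positivity) (by positivity), ENNReal.ofReal_pow (norm_nonneg _),
    ENNReal.ofReal_pow (norm_nonneg _), ENNReal.ofReal_pow (norm_nonneg _),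
    ENNReal.ofReal_pow (norm_nonneg _), ofReal_norm, ofReal_norm, ofReal_norm]

/-- Minimizers have negative energy, so coercivity bounds (Θ₀-μ) times the mass, as well as the
quartic integral; 1/μ is controlled by 1/μ_β. Negativity also bounds the kinetic energy by μ times
the mass. -/
lemma exists_minimizer_bound {β : ℝ} (h0 : 0 < β) (hπ : β < Real.pi) :
    ∃ C : ℝ, ∀ μ ∈ Set.Ioo (muBeta β) Theta0, ∀ ψ : W β, ψ.IsMinimizer μ →
      ψ.kinetic + ψ.mass + ψ.quartic ≤ C / (Theta0 - μ) := by
  obtain ⟨D, hD, hco⟩ := exists_coercive h0 hπ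
  have hb := muBeta_pos h0 hπ
  set b := muBeta β
  refine ⟨Theta0 * (D / b) + D / b + Theta0 * (4 * (D / b) / b), fun μ hμ ψ h => ?_⟩
  have hμ0 := hb.trans hμ.1
  have hδ : 0 < Theta0 - μ := by linarith [hμ.2]
  have h4 := h.inL4 h0 hπ hμ.1
  have h1 := hco μ hμ0 ψ h4
  have h2 := h.realEnergy_neg h0 hπ hμ.1
  have hDμ : D / μ ≤ D / b := div_le_div_of_nonneg_left hD hb hμ.1.le
  have hM := ψ.mass_nonneg
  have hL := ψ.quartic_nonneg
  have hδM : 0 ≤ (Theta0 - μ) * ψ.mass := by positivity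
  have hμL : 0 ≤ μ / 4 * ψ.quartic := by positivity
  have m1 : (Theta0 - μ) * ψ.mass ≤ D / b := by linarith
  have l1 : ψ.quartic ≤ 4 * (D / b) / b := by
    rw [le_div_iff₀ hb]
    have : b * ψ.quartic ≤ μ * ψ.quartic := mul_le_mul_of_nonneg_right hμ.1.le hL
    linarith
  have k1 : ψ.kinetic ≤ Theta0 * ψ.mass := by
    rw [W.realEnergy] at h2
    have : μ * ψ.mass ≤ Theta0 * ψ.mass := mul_le_mul_of_nonneg_right hμ.2.le hM
    linarith
  have hT : 0 ≤ Theta0 := by linarith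
  rw [le_div_iff₀ hδ]
  have k2 : ψ.kinetic * (Theta0 - μ) ≤ Theta0 * (D / b) := by
    have h5 := mul_le_mul_of_nonneg_right k1 hδ.le
    have h6 := mul_le_mul_of_nonneg_left m1 hT
    linarith
  have l2 : ψ.quartic * (Theta0 - μ) ≤ Theta0 * (4 * (D / b) / b) := by
    have h5 : ψ.quartic * (Theta0 - μ) ≤ ψ.quartic * Theta0 :=
      mul_le_mul_of_nonneg_left (by linarith) hL
    have h6 := mul_le_mul_of_nonneg_right l1 hT
    linarith
  linarith

end SectorGL

end

theorem proposition4p1 (β : ℝ) (hβ₀ : 0 < β) (hβπ : β < Real.pi)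
    (hμβ : SectorGL.muBeta β < SectorGL.Theta0) :
    StrictAntiOn (SectorGL.eSector β) (Set.Ioo (SectorGL.muBeta β) SectorGL.Theta0) ∧
    (∀ μ ∈ Set.Ioo (SectorGL.muBeta β) SectorGL.Theta0,
      SectorGL.eSector β μ ≠ ⊥ ∧ SectorGL.eSector β μ ≠ ⊤) ∧
    ConcaveOn ℝ (Set.Ioo (SectorGL.muBeta β) SectorGL.Theta0)
      (fun μ => (SectorGL.eSector β μ).toReal) ∧
    (∀ μ ∈ Set.Ioc (SectorGL.muBeta β) SectorGL.Theta0, SectorGL.eSector β μ < 0) ∧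
    ∃ C : ℝ, ∀ μ ∈ Set.Ioo (SectorGL.muBeta β) SectorGL.Theta0,
      (∃ ψ : SectorGL.W β, ψ.IsMinimizer μ ∧ ψ.Nontrivial) ∧
      ∀ ψ : SectorGL.W β, ψ.IsMinimizer μ →
        ∫⁻ p in SectorGL.sector β, (‖ψ.grad₁ p‖ₑ ^ 2 + ‖ψ.grad₂ p‖ₑ ^ 2
            + ‖ψ.toFun p‖ₑ ^ 2 + ‖ψ.toFun p‖ₑ ^ 4)
          ≤ ENNReal.ofReal (C / (SectorGL.Theta0 - μ)) := by
  refine ⟨SectorGL.strictAntiOn_eSector hβ₀ hβπ, fun μ hμ => ⟨SectorGL.eSector_ne_bot hβ₀ hβπ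
    ((SectorGL.muBeta_pos hβ₀ hβπ).trans hμ.1) hμ.2.le,
    ((SectorGL.eSector_neg hβ₀ hβπ hμ.1).trans EReal.zero_lt_top).ne⟩,
    SectorGL.concaveOn_eSector hβ₀ hβπ, fun μ hμ => SectorGL.eSector_neg hβ₀ hβπ hμ.1, ?_⟩
  obtain ⟨C, hC⟩ := SectorGL.exists_minimizer_bound hβ₀ hβπ
  refine ⟨C, fun μ hμ => ⟨?_, fun ψ h => ?_⟩⟩
  · obtain ⟨ψ, -, h⟩ := SectorGL.exists_minimizer hβ₀ hβπ hμ.1 hμ.2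
    exact ⟨ψ, h, h.nontrivial hβ₀ hβπ hμ.1⟩
  · rw [(h.inL4 hβ₀ hβπ hμ.1).lintegral_total]
    exact ENNReal.ofReal_le_ofReal (hC μ hμ ψ h)
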